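/- Consider two-player extensive-form games with perfect information: a finite rooted tree with set $H$ of decision nodes and set $Z$ of leaves, an assignment of a player (leader $L$ or follower $F$) to every decision node, and payoff functions $U_L,U_F:Z\to\mathbb R$. The leader commits to a behavioral strategy $\delta_L$ (a distribution over the children at each of her nodes), and the follower answers with a pure strategy $\pi_F$. Write $p_{(\delta_L,\pi_F)}$ for the induced distribution on $Z$, $U(p)=\sum_{z\in Z}U(z)p(z)$ and $U(\delta_L,\pi_F)=U(p_{(\delta_L,\pi_F)})$. A strong Stackelberg equilibrium (SSE) with behavioral commitment of a game with payoffs $(U_L,\tilde U_F)$ is a pair $(\delta_L,\pi_F)$ that maximizes $U_L(\delta_L,\pi_F)$ among all pairs in which $\pi_F$ maximizes $\tilde U_F(\delta_L,\cdot)$ over the follower's pure strategies. A distribution $p$ on $Z$ is induced by $\tilde U_F:Z\to\mathbb R$ if $p=p_{(\delta_L,\pi_F)}$ for some SSE with behavioral commitment $(\delta_L,\pi_F)$ of the game with payoffs $(U_L,\tilde U_F)$; it is inducible if some $\tilde U_F$ induces it. Theorem. There are a program of a random access machine with unit-cost exact real arithmetic (addition, subtraction, multiplication, division and comparison of reals,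 without rounding) and a constant $C$ such that, for every such game, the program, given the tree, the assignment of players and the payoffs $U_L,U_F$, halts after at most $C\,(|H|\cdot|Z|^2+1)$ steps, that is, in polynomial time $O(|H|\cdot|Z|^2)$ whenever $H\neq\emptyset$, and outputs a distribution $p^*$ on $Z$ and a payoff function $\tilde U_F^*:Z\to\mathbb R$ such that 1. $\tilde U_F^*$ induces $p^*$ (with behavioral commitment); 2. $U_F(p^*)\ge U_F(p)$ for every distribution $p$ on $Z$ that is inducible (with behavioral commitment); 3. $p^*$ is Y-shape, i.e. its support has at most two elements. -/

import Mathlib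

namespace Stackelberg

/-! ### Extensive-form games with perfect information -/

/-- A finite rooted tree whose `n` nodes are numbered in an arbitrary way. It is presented by its
parent map: the root is (by convention) its own parent, and following parents from any node one
arrives at the root. -/
structure RootedTree (n : ℕ) where
  root : Fin n
  parent : Fin n → Fin n
  parent_root : parent root = root
  reaches_root : ∀ v, ∃ k : ℕ, parent^[k] v = root

namespace RootedTree

variable {n : ℕ} (T : RootedTree n)

/-- `Child(v)`. -/
def children (v : Fin n) : Finset (Fin n) :=
  Finset.univ.filter fun w => w ≠ T.root ∧ T.parent w = v

/-- The set `H` of decision (internal) nodes. -/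
abbrev Decision : Type := {v : Fin n // (T.children v).Nonempty}

/-- The set `Z` of terminal (leaf) nodes. -/
abbrev Leaf : Type := {v : Fin n // T.children v = ∅}

open Classical in
/-- The nodes on the path from the root to `v`, including `v`, but not the root. They stand for
the edges of this path (each such node for the edge that enters it). -/
noncomputable def path (v : Fin n) : Finset (Fin n) :=
  Finset.univ.filter fun w => w ≠ T.root ∧ ∃ k : ℕ, T.parent^[k] v = w

theorem mem_children_parent {w : Fin n} (h : w ≠ T.root) : w ∈ T.children (T.parent w) := by
  simp [children, h]

/-- The parent of a node different from the root, as a decision node. -/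
def parentDecision (w : Fin n) (h : w ≠ T.root) : T.Decision :=
  ⟨T.parent w, w, T.mem_children_parent h⟩

end RootedTree

inductive Player
  | leader
  | follower

/-- A game tree together with the player who moves at each decision node. An extensive-form game is
such a tree `G` with payoff functions `UL UF : G.Leaf → ℝ`. -/
structure GameTree (n : ℕ) extends RootedTree n where
  owner : toRootedTree.Decision → Player

namespace GameTree

variable {n : ℕ} (G : GameTree n)

/-- The decision nodes of player `i`. -/
abbrev NodesOf (i : Player) : Type := {v : G.Decision // G.owner v = i}

/-- Behavioral strategies of the leader: a probability distribution over the children at each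
decision node of the leader. -/
abbrev LeaderStrategy : Type :=
  ∀ v : G.NodesOf Player.leader, stdSimplex ℝ {w : Fin n // w ∈ G.children v.1.1}

/-- Pure strategies of the follower: a child of each decision node of the follower. -/
abbrev FollowerStrategy : Type :=
  ∀ v : G.NodesOf Player.follower, {w : Fin n // w ∈ G.children v.1.1}

variable {G}

/-- The probability that `w` is chosen at its parent when play has arrived there. -/
noncomputable def moveProb (δ : G.LeaderStrategy) (π : G.FollowerStrategy) (w : Fin n)
    (hw : w ≠ G.root) : ℝ :=
  match h : G.owner (G.parentDecision w hw) with
  | Player.leader => (δ ⟨G.parentDecision w hw, h⟩).1 ⟨w, G.mem_children_parent hw⟩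
  | Player.follower => if (π ⟨G.parentDecision w hw, h⟩).1 = w then 1 else 0

/-- The distribution over the leaves that a strategy profile realizes: the probability of a leaf
is the product of the probabilities of the moves on the path from the root to it. -/
noncomputable def outcome (δ : G.LeaderStrategy) (π : G.FollowerStrategy) (z : G.Leaf) : ℝ :=
  ∏ w ∈ G.path z.1, if hw : w ≠ G.root then moveProb δ π w hw else 1

/-- The expected utility under a distribution over the leaves. -/
noncomputable def utility (U p : G.Leaf → ℝ) : ℝ := ∑ z, U z * p z

/-- `π ∈ BR(δ)` for the follower's payoff function `UF`. -/
def IsBestResponse (UF : G.Leaf → ℝ) (δ : G.LeaderStrategy) (π : G.FollowerStrategy) : Prop :=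
  ∀ π' : G.FollowerStrategy, utility UF (outcome δ π') ≤ utility UF (outcome δ π)

/-- `(δ, π)` is a strong Stackelberg equilibrium with behavioral commitment of `(G, UL, UF)`. -/
def IsSSE (UL UF : G.Leaf → ℝ) (δ : G.LeaderStrategy) (π : G.FollowerStrategy) : Prop :=
  IsBestResponse UF δ π ∧
    ∀ (δ' : G.LeaderStrategy) (π' : G.FollowerStrategy), IsBestResponse UF δ' π' →
      utility UL (outcome δ' π') ≤ utility UL (outcome δ π)

/-- The reported payoff function `R` induces `p` (with behavioral commitment). -/
def Induces (UL R p : G.Leaf → ℝ) : Prop :=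
  ∃ (δ : G.LeaderStrategy) (π : G.FollowerStrategy), outcome δ π = p ∧ IsSSE UL R δ π

/-- `p` is inducible (with behavioral commitment). -/
def Inducible (UL p : G.Leaf → ℝ) : Prop := ∃ R : G.Leaf → ℝ, Induces UL R p

/-- `p` is a distribution over the leaves that is induced by the payoff function `R` and that is,
for the true payoff function `UF` of the follower, optimal among all inducible distributions. -/
def IsOptimalReport (UL UF p R : G.Leaf → ℝ) : Prop :=
  p ∈ stdSimplex ℝ G.Leaf ∧ Induces UL R p ∧
    ∀ q : G.Leaf → ℝ, Inducible UL q → utility UF q ≤ utility UF p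

/-- `p` is Y-shape: its support has at most two elements. -/
def IsYShape (p : G.Leaf → ℝ) : Prop := (Function.support p).ncard ≤ 2

end GameTree

/-! ### Random access machines with real arithmetic

The machine has index registers that hold natural numbers, data registers that hold real numbers,
and a random access memory for each of the two sorts, divided into banks (a program names only
finitely many banks and registers). Every instruction and every test takes one step. Natural numbers
can only be added and subtracted; real numbers are added, subtracted, multiplied and divided
exactly; no operation turns a real number into a natural number. -/

structure State where
  ireg : ℕ → ℕ
  rreg : ℕ → ℝ
  /-- `imem k a` is the cell with address `a` of the index memory bank `k`. -/
  imem : ℕ → ℕ → ℕ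
  /-- `rmem k a` is the cell with address `a` of the data memory bank `k`. -/
  rmem : ℕ → ℕ → ℝ

inductive Instr
  | iconst (d c : ℕ)
  | imove (d a : ℕ)
  | iadd (d a b : ℕ)
  | isub (d a b : ℕ)
  | iload (d k a : ℕ)
  | istore (k a b : ℕ)
  | rconst (d : ℕ) (c : ℚ)
  | rmove (d a : ℕ)
  | radd (d a b : ℕ)
  | rsub (d a b : ℕ)
  | rmul (d a b : ℕ)
  | rdiv (d a b : ℕ)
  | rload (d k a : ℕ)
  | rstore (k a b : ℕ)

namespace State

def setI (s : State) (d x : ℕ) : State :=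
  { s with ireg := Function.update s.ireg d x }

noncomputable def setR (s : State) (d : ℕ) (x : ℝ) : State :=
  { s with rreg := Function.update s.rreg d x }

def writeI (s : State) (k a x : ℕ) : State :=
  { s with imem := Function.update s.imem k (Function.update (s.imem k) a x) }

noncomputable def writeR (s : State) (k a : ℕ) (x : ℝ) : State :=
  { s with rmem := Function.update s.rmem k (Function.update (s.rmem k) a x) }

end State

/-- The effect of an instruction: `d` is the register written to, `a` and `b` are the registers of
the operands, `k` is a memory bank. Loads and stores take their address from the index register `a`.
Subtraction of natural numbers is truncated, and division by `0` returns `0`. -/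
noncomputable def Instr.apply : Instr → State → State
  | iconst d c, s => s.setI d c
  | imove d a, s => s.setI d (s.ireg a)
  | iadd d a b, s => s.setI d (s.ireg a + s.ireg b)
  | isub d a b, s => s.setI d (s.ireg a - s.ireg b)
  | iload d k a, s => s.setI d (s.imem k (s.ireg a))
  | istore k a b, s => s.writeI k (s.ireg a) (s.ireg b)
  | rconst d c, s => s.setR d (c : ℝ)
  | rmove d a, s => s.setR d (s.rreg a)
  | radd d a b, s => s.setR d (s.rreg a + s.rreg b)
  | rsub d a b, s => s.setR d (s.rreg a - s.rreg b)
  | rmul d a b, s => s.setR d (s.rreg a * s.rreg b)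
  | rdiv d a b, s => s.setR d (s.rreg a / s.rreg b)
  | rload d k a, s => s.setR d (s.rmem k (s.ireg a))
  | rstore k a b, s => s.writeR k (s.ireg a) (s.rreg b)

/-- Tests that compare two registers. -/
inductive Test
  | ieq (a b : ℕ)
  | ilt (a b : ℕ)
  | req (a b : ℕ)
  | rlt (a b : ℕ)

def Test.Holds : Test → State → Prop
  | ieq a b, s => s.ireg a = s.ireg b
  | ilt a b, s => s.ireg a < s.ireg b
  | req a b, s => s.rreg a = s.rreg b
  | rlt a b, s => s.rreg a < s.rreg b

/-- Programs; the conditional jumps of the machine appear as conditionals and loops. -/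
inductive Prog
  | skip
  | op (c : Instr)
  | seq (P Q : Prog)
  | ite (b : Test) (P Q : Prog)
  | loop (b : Test) (P : Prog)

/-- `Exec P s t s'`: started in state `s`, the program `P` halts after exactly `t` steps in state
`s'`. Here `loop b P` repeats `P` as long as the test `b` holds. -/
inductive Exec : Prog → State → ℕ → State → Prop
  | skip (s : State) : Exec Prog.skip s 1 s
  | op (c : Instr) (s : State) : Exec (Prog.op c) s 1 (c.apply s)
  | seq {P Q : Prog} {s s' s'' : State} {t t' : ℕ} :
      Exec P s t s' → Exec Q s' t' s'' → Exec (Prog.seq P Q) s (t + t') s''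
  | ite_true {b : Test} {P Q : Prog} {s s' : State} {t : ℕ} :
      b.Holds s → Exec P s t s' → Exec (Prog.ite b P Q) s (t + 1) s'
  | ite_false {b : Test} {P Q : Prog} {s s' : State} {t : ℕ} :
      ¬ b.Holds s → Exec Q s t s' → Exec (Prog.ite b P Q) s (t + 1) s'
  | loop_done {b : Test} {P : Prog} {s : State} :
      ¬ b.Holds s → Exec (Prog.loop b P) s 1 s
  | loop_step {b : Test} {P : Prog} {s s' s'' : State} {t t' : ℕ} :
      b.Holds s → Exec P s t s' → Exec (Prog.loop b P) s' t' s'' →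
        Exec (Prog.loop b P) s (t + t' + 1) s''

/-! ### Input format -/

namespace GameTree

variable {n : ℕ}

/-- `0` for a decision node of the leader (and for a leaf), `1` for one of the follower. -/
def ownerCode (G : GameTree n) (v : Fin n) : ℕ :=
  if h : (G.children v).Nonempty then
    match G.owner ⟨v, h⟩ with
    | Player.leader => 0
    | Player.follower => 1
  else 0

/-- The payoff at a leaf, and `0` at a decision node. -/
noncomputable def payoffCode {G : GameTree n} (U : G.Leaf → ℝ) (v : Fin n) : ℝ :=
  if h : G.children v = ∅ then U ⟨v, h⟩ else 0

/-- The initial state of the machine for the game `(G, UL, UF)`: index registers `0` and `1` hold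
the number of nodes and the root, the index memory banks `0` and `1` hold the parent and the owner
of each node, the data memory banks `0` and `1` hold the payoffs of the leader and the follower at
each leaf; everything else is `0`. -/
noncomputable def input (G : GameTree n) (UL UF : G.Leaf → ℝ) : State where
  ireg := fun r => if r = 0 then n else if r = 1 then (G.root : ℕ) else 0
  rreg := fun _ => 0
  imem := fun k a =>
    if h : a < n then
      if k = 0 then (G.parent ⟨a, h⟩ : ℕ) else if k = 1 then G.ownerCode ⟨a, h⟩ else 0
    else 0
  rmem := fun k a =>
    if h : a < n then
      if k = 0 then payoffCode UL ⟨a, h⟩ else if k = 1 then payoffCode UF ⟨a, h⟩ else 0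
    else 0

end GameTree

end Stackelberg

namespace Stackelberg

namespace RootedTree

variable {n : ℕ} (T : RootedTree n)

/-! ### Rooted trees -/

/-! Let $M(v)$ (`maximin`) be the value of the zero-sum subgame at $v$ in which the leader maximizes
her payoff and the follower minimizes it. Inducibility is governed by the leader's expected payoff
$x$ and by threats, that is, subtrees $w$ with $M(w)\le x$ that the follower could enter instead of
staying on the play.

Necessity (`RootedTree.exists_supported_pair`). An inducible $p$ has $x\ge M(\mathrm{root})$,
because the leader can commit to a maximin strategy. Descend from the root. At a leader's node all
children in the support give her exactly $x$, since she could move to the best one with certainty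
(`exists_extension`); the descent continues at one that is no worse than the average for the true
payoff of the follower. At a follower's node either a child off the play has $M\le x$, which is a
threat, or the child played is the one where his security under the report is largest: otherwise the
leader could lure him to a child with $M>x$ by punishing him at the others. In the latter case
optimality is inherited by the subgame. The descent ends at a single leaf or at a threat. Below a
threat, planar convexity (`exists_two_points_dominating`) replaces the play by a mixture of two
leaves that is no worse for both players. The two leaves part at a node of the leader, because the
follower plays a pure strategy.

Sufficiency (`induces_report`). Take one leaf of payoff $x$, or a mixture of two leaves parting at a
leader's node $l$ with expected payoff $x$ and a threat above $l$; in both cases let $x\ge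
M(\mathrm{root})$. The follower reports $x-U_L$ at these leaves, $M(w)-U_L$ in every subtree $w$
hanging off the path to $l$ with $M(w)\le x$, and $x-B$ at all other leaves, where $B\ge U_L$.
Reported payoff plus leader's payoff never exceeds $x$ (`report_add_le`), and the follower can
secure $0$ by entering a threat (`security_report_nonneg`); so no commitment gives the leader more
than $x$. Against a leader who realizes the candidate and plays maximin off its path, the follower
gets at most $0$ (`value_report_le`), which the candidate gives him.

For a fixed pair of leaves it is optimal either to lower $x$ to the least admissible value or to
keep one leaf only (`dominates_pair`), so finitely many candidates suffice. The values $M$ and the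
threats are computed in linear time; for each ordered pair of leaves, the parting node and the least
threat above it are found by walks of length at most $|H|$. This gives $O(|H|\cdot|Z|^2)$. Programs
are verified together with their running times through `WP`. -/

theorem mem_children {v w : Fin n} : w ∈ T.children v ↔ w ≠ T.root ∧ T.parent w = v := by
  simp [children]

theorem root_notMem_children (v : Fin n) : T.root ∉ T.children v := by
  simp [mem_children]

/-- The number of edges on the path from the root to `v`. -/
def depth (v : Fin n) : ℕ := Nat.find (T.reaches_root v)

theorem iterate_depth (v : Fin n) : T.parent^[T.depth v] v = T.root :=
  Nat.find_spec (T.reaches_root v)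

theorem depth_root : T.depth T.root = 0 := by
  simp [depth]

theorem depth_of_ne_root {v : Fin n} (h : v ≠ T.root) : T.depth v = T.depth (T.parent v) + 1 := by
  have h1 : T.depth v ≠ 0 := fun h0 => h (by simpa [h0] using T.iterate_depth v)
  apply le_antisymm
  · exact Nat.find_min' _ (by simpa [Function.iterate_succ_apply] using T.iterate_depth (T.parent v))
  · obtain ⟨m, hm⟩ := Nat.exists_eq_succ_of_ne_zero h1
    have := T.iterate_depth v
    rw [hm, Function.iterate_succ_apply] at this
    have h2 : T.depth (T.parent v) ≤ m := Nat.find_min' _ this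
    omega

theorem depth_child {v w : Fin n} (h : w ∈ T.children v) : T.depth w = T.depth v + 1 := by
  obtain ⟨h1, rfl⟩ := T.mem_children.1 h
  exact T.depth_of_ne_root h1

theorem wellFounded_children : WellFounded fun w v => w ∈ T.children v := by
  have : WellFounded fun w v : Fin n => T.depth v < T.depth w :=
    @Finite.wellFounded_of_trans_of_irrefl (Fin n) _ (fun w v => T.depth v < T.depth w)
      ⟨fun _ _ _ h1 h2 => lt_trans h2 h1⟩ ⟨fun _ => lt_irrefl _⟩
  exact Subrelation.wf (fun h => by rw [T.depth_child h]; omega) this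

theorem induction_children {p : Fin n → Prop} (h : ∀ v, (∀ w ∈ T.children v, p w) → p v)
    (v : Fin n) : p v :=
  T.wellFounded_children.induction v h

theorem induction_parent {p : Fin n → Prop} (h0 : p T.root)
    (h : ∀ v, v ≠ T.root → p (T.parent v) → p v) (v : Fin n) : p v := by
  induction hd : T.depth v generalizing v with
  | zero =>
    have hv : v = T.root := by simpa [hd] using T.iterate_depth v
    exact hv ▸ h0
  | succ d ih =>
    have hv : v ≠ T.root := by rintro rfl; simp [depth_root] at hd
    exact h v hv (ih _ (by have := T.depth_of_ne_root hv; omega))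

/-- `u` lies in the subtree of `v`. -/
def Below (v u : Fin n) : Prop := ∃ k : ℕ, T.parent^[k] u = v

variable {T}

theorem Below.refl (v : Fin n) : T.Below v v := ⟨0, rfl⟩

theorem Below.trans {a b c : Fin n} (h1 : T.Below a b) (h2 : T.Below b c) : T.Below a c := by
  obtain ⟨k, rfl⟩ := h1
  obtain ⟨l, rfl⟩ := h2
  exact ⟨k + l, Function.iterate_add_apply _ _ _ _⟩

theorem below_root (v : Fin n) : T.Below T.root v := T.reaches_root v

theorem below_parent (v : Fin n) : T.Below (T.parent v) v := ⟨1, rfl⟩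

theorem below_of_mem_children {v w : Fin n} (h : w ∈ T.children v) : T.Below v w :=
  (T.mem_children.1 h).2 ▸ below_parent w

theorem below_iff {v u : Fin n} : T.Below v u ↔ u = v ∨ T.Below v (T.parent u) := by
  constructor
  · rintro ⟨k, rfl⟩
    cases k with
    | zero => exact Or.inl rfl
    | succ k => exact Or.inr ⟨k, rfl⟩
  · rintro (rfl | h)
    · exact Below.refl _
    · exact h.trans (below_parent u)

theorem below_root_right {v : Fin n} : T.Below v T.root ↔ v = T.root := by
  constructor
  · rintro ⟨k, rfl⟩
    exact Function.iterate_fixed T.parent_root k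
  · rintro rfl
    exact Below.refl _

theorem Below.depth_le {v u : Fin n} (h : T.Below v u) : T.depth v ≤ T.depth u := by
  induction u using T.induction_parent with
  | h0 => rw [below_root_right.1 h]
  | h u hu ih =>
    rcases below_iff.1 h with rfl | h
    · rfl
    · have := T.depth_of_ne_root hu
      have := ih h
      omega

theorem Below.eq_of_depth {v u : Fin n} (h : T.Below v u) (hd : T.depth u ≤ T.depth v) :
    v = u := by
  rcases below_iff.1 h with rfl | h'
  · rfl
  · by_cases hu : u = T.root
    · subst hu; exact below_root_right.1 h
    · have := T.depth_of_ne_root hu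
      have := h'.depth_le
      omega

theorem Below.antisymm {v u : Fin n} (h : T.Below v u) (h' : T.Below u v) : v = u :=
  h.eq_of_depth h'.depth_le

theorem Below.exists_child {v u : Fin n} (h : T.Below v u) (hne : u ≠ v) :
    ∃ w ∈ T.children v, T.Below w u := by
  induction u using T.induction_parent with
  | h0 => exact absurd (below_root_right.1 h).symm hne
  | h u hu ih =>
    rcases below_iff.1 h with rfl | h'
    · exact absurd rfl hne
    · by_cases hp : T.parent u = v
      · exact ⟨u, T.mem_children.2 ⟨hu, hp⟩, Below.refl u⟩
      · obtain ⟨w, hw, hwu⟩ := ih h' hp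
        exact ⟨w, hw, hwu.trans (below_parent u)⟩

theorem Below.total {a b u : Fin n} (ha : T.Below a u) (hb : T.Below b u) :
    T.Below a b ∨ T.Below b a := by
  induction u using T.induction_parent with
  | h0 => rw [below_root_right.1 ha, below_root_right.1 hb]; exact Or.inl (Below.refl _)
  | h u hu ih =>
    rcases below_iff.1 ha with rfl | ha'
    · exact Or.inr hb
    · rcases below_iff.1 hb with rfl | hb'
      · exact Or.inl ha
      · exact ih ha' hb'

/-- The ancestors of a node form a chain, and siblings have equal depth. -/
theorem eq_of_below_of_mem_children {v w w' u : Fin n} (hw : w ∈ T.children v)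
    (hw' : w' ∈ T.children v) (h : T.Below w u) (h' : T.Below w' u) : w = w' := by
  have h1 := T.depth_child hw
  have h2 := T.depth_child hw'
  rcases h.total h' with h | h
  · exact h.eq_of_depth (by omega)
  · exact (h.eq_of_depth (by omega)).symm

theorem not_below_of_mem_children {v w : Fin n} (hw : w ∈ T.children v) : ¬ T.Below w v := by
  intro h
  have := h.depth_le
  have := T.depth_child hw
  omega

/-- An ancestor of a child of `v` is an ancestor of `v` or this child. -/
theorem below_child_iff {a v w : Fin n} (hw : w ∈ T.children v) :
    T.Below a w ↔ a = w ∨ T.Below a v := by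
  rw [below_iff, (T.mem_children.1 hw).2, eq_comm]

/-- A descendant of a leaf is the leaf itself. -/
theorem eq_of_below_leaf {v u : Fin n} (hv : T.children v = ∅) (h : T.Below v u) : u = v := by
  by_contra hne
  obtain ⟨w, hw, -⟩ := h.exists_child hne
  simp [hv] at hw

theorem depth_iterate {v : Fin n} {k : ℕ} (hk : k ≤ T.depth v) :
    T.depth (T.parent^[k] v) = T.depth v - k := by
  induction k with
  | zero => rfl
  | succ k ih =>
    have h1 := ih (by omega)
    have h2 : T.parent^[k] v ≠ T.root := by
      intro h; rw [h, depth_root] at h1; omega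
    have := T.depth_of_ne_root h2
    rw [Function.iterate_succ_apply']
    omega

theorem iterate_ne_root {v : Fin n} {k : ℕ} (hk : k < T.depth v) : T.parent^[k] v ≠ T.root := by
  intro h
  have := depth_iterate (T := T) hk.le
  rw [h, depth_root] at this
  omega

/-- The proper ancestors of `v` are decision nodes, told apart by their depths. Every walk to the
root thus takes at most $|H|$ rounds. -/
theorem depth_le_card (v : Fin n) : T.depth v ≤ Fintype.card T.Decision := by
  have hdec : ∀ k : Fin (T.depth v), (T.children (T.parent^[k + 1] v)).Nonempty := fun k =>
    ⟨T.parent^[k] v, T.mem_children.2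
      ⟨iterate_ne_root k.2, (Function.iterate_succ_apply' _ _ _).symm⟩⟩
  let f : Fin (T.depth v) → T.Decision := fun k => ⟨T.parent^[k + 1] v, hdec k⟩
  have hf : Function.Injective f := by
    intro k l h
    have h := congrArg (fun d : T.Decision => T.depth d.1) h
    simp only [f] at h
    rw [depth_iterate (by omega), depth_iterate (by omega)] at h
    exact Fin.ext (by omega)
  simpa using Fintype.card_le_of_injective f hf

theorem card_decision_add_card_leaf :
    Fintype.card T.Decision + Fintype.card T.Leaf = n := by
  rw [Fintype.card_subtype, Fintype.card_subtype]
  have := Finset.card_filter_add_card_filter_not (s := (Finset.univ : Finset (Fin n)))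
    (fun v => (T.children v).Nonempty)
  simp only [Finset.not_nonempty_iff_eq_empty] at this
  simpa using this

/-! ### Where the path to a node leaves the path to another node -/

theorem exists_iterate_below (a v : Fin n) : ∃ k : ℕ, T.Below (T.parent^[k] v) a := by
  obtain ⟨k, hk⟩ := T.reaches_root v
  exact ⟨k, hk ▸ below_root a⟩

open Classical in
/-- The distance from `v` to its deepest ancestor that is also an ancestor of `a`. -/
noncomputable def hit (a v : Fin n) : ℕ := Nat.find (exists_iterate_below (T := T) a v)

variable (T) in
/-- The deepest common ancestor of `a` and `v`. -/
noncomputable def junction (a v : Fin n) : Fin n := T.parent^[hit (T := T) a v] v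

variable (T) in
/-- The child of the deepest common ancestor of `a` and `v` that leads to `v`. -/
noncomputable def branch (a v : Fin n) : Fin n := T.parent^[hit (T := T) a v - 1] v

theorem junction_below (a v : Fin n) : T.Below (T.junction a v) a := by
  classical
  exact Nat.find_spec (exists_iterate_below (T := T) a v)

theorem not_below_of_lt_hit {a v : Fin n} {k : ℕ} (hk : k < hit (T := T) a v) :
    ¬ T.Below (T.parent^[k] v) a := by
  classical
  exact Nat.find_min (exists_iterate_below (T := T) a v) hk

theorem hit_le_depth (a v : Fin n) : hit (T := T) a v ≤ T.depth v := by
  classical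
  exact Nat.find_min' _ (by rw [iterate_depth]; exact below_root a)

theorem hit_pos {a v : Fin n} (h : ¬ T.Below v a) : 0 < hit (T := T) a v := by
  rw [Nat.pos_iff_ne_zero]
  intro h0
  have := junction_below (T := T) a v
  rw [junction, h0] at this
  exact h this

theorem branch_spec {a v : Fin n} (h : ¬ T.Below v a) :
    T.branch a v ∈ T.children (T.junction a v) ∧ T.Below (T.branch a v) v ∧
      ¬ T.Below (T.branch a v) a := by
  have h0 := hit_pos h
  have h1 := hit_le_depth (T := T) a v
  refine ⟨T.mem_children.2 ⟨iterate_ne_root (by omega), ?_⟩, ⟨_, rfl⟩,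
    not_below_of_lt_hit (by omega)⟩
  rw [branch, ← Function.iterate_succ_apply' T.parent, junction]
  congr 1
  omega

/-- The ancestors of `v` form a chain, so only one edge towards `v` leaves the path to `a`. This is
how `junction` and `branch` are identified in practice. -/
theorem branch_unique {a v c w : Fin n} (hc : T.Below c a) (hw : w ∈ T.children c)
    (hwa : ¬ T.Below w a) (hwv : T.Below w v) : T.junction a v = c ∧ T.branch a v = w := by
  have h : ¬ T.Below v a := fun h => hwa (hwv.trans h)
  obtain ⟨h1, h2, h3⟩ := branch_spec h
  have h4 := junction_below (T := T) a v
  have key : T.branch a v = w := by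
    rcases h2.total hwv with h5 | h5
    · rcases (below_child_iff hw).1 h5 with h6 | h6
      · exact h6
      · exact absurd (h6.trans hc) h3
    · rcases (below_child_iff h1).1 h5 with h6 | h6
      · exact h6.symm
      · exact absurd (h6.trans h4) hwa
  refine ⟨?_, key⟩
  rw [← (T.mem_children.1 h1).2, key, (T.mem_children.1 hw).2]

/-- Once a path has left the path to `a`, the place where it left no longer changes. Hanging
subtrees can therefore be treated by induction with `junction` and `branch` fixed. -/
theorem branch_child {a v w : Fin n} (h : ¬ T.Below v a) (hw : w ∈ T.children v) :
    ¬ T.Below w a ∧ T.junction a w = T.junction a v ∧ T.branch a w = T.branch a v := by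
  obtain ⟨h1, h2, h3⟩ := branch_spec h
  have hvw := below_of_mem_children hw
  exact ⟨fun h' => h (hvw.trans h'), branch_unique (junction_below a v) h1 h3 (h2.trans hvw)⟩

theorem branch_child_of_below {a v w : Fin n} (h : T.Below v a) (hw : w ∈ T.children v)
    (hwa : ¬ T.Below w a) : T.junction a w = v ∧ T.branch a w = w :=
  branch_unique h hw hwa (Below.refl w)

end RootedTree

namespace RootedTree

variable {n : ℕ} (T : RootedTree n) (F : Fin n → Prop) [DecidablePred F]

/-! ### Values of strategy profiles and of the zero-sum game

A profile is given by the probabilities `q w` with which the leader enters the node `w` from its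
parent and by the child `c v` that the follower chooses at `v`; `F` is the set of nodes of the
follower. -/

/-- Backward induction: `Φ v` computes the value at `v` from the values at the children of `v`. -/
noncomputable def fold (Φ : Fin n → (Fin n → ℝ) → ℝ) : Fin n → ℝ :=
  T.wellFounded_children.fix fun v rec =>
    Φ v fun w => if h : w ∈ T.children v then rec w h else 0

theorem fold_eq (Φ : Fin n → (Fin n → ℝ) → ℝ) (v : Fin n) :
    T.fold Φ v = Φ v fun w => if w ∈ T.children v then T.fold Φ w else 0 := by
  rw [fold, WellFounded.fix_eq]
  rfl

/-- The probability with which `w` is entered from its parent. -/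
def entry (q : Fin n → ℝ) (c : Fin n → Fin n) (w : Fin n) : ℝ :=
  if F (T.parent w) then (if c (T.parent w) = w then 1 else 0) else q w

/-- The expected payoff in the subgame at `v`. -/
noncomputable def value (u : Fin n → ℝ) (p : Fin n → ℝ) : Fin n → ℝ :=
  T.fold fun v g => if (T.children v).Nonempty then ∑ w ∈ T.children v, p w * g w else u v

/-- The value of the zero-sum subgame at `v` in which the leader maximizes `u`. -/
noncomputable def maximin (u : Fin n → ℝ) : Fin n → ℝ :=
  T.fold fun v g => if h : (T.children v).Nonempty then
    (if F v then (T.children v).inf' h g else (T.children v).sup' h g) else u v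

/-- The payoff of a best response to `q` in the subgame at `v`. -/
noncomputable def responseValue (u q : Fin n → ℝ) : Fin n → ℝ :=
  T.fold fun v g => if h : (T.children v).Nonempty then
    (if F v then (T.children v).sup' h g else ∑ w ∈ T.children v, q w * g w) else u v

/-- No normalization is needed at nodes of the follower: `entry` never reads `q` at their children.
-/
def IsLeader (q : Fin n → ℝ) : Prop :=
  (∀ w, 0 ≤ q w) ∧ ∀ v, (T.children v).Nonempty → ¬ F v → ∑ w ∈ T.children v, q w = 1

def IsFollower (c : Fin n → Fin n) : Prop :=
  ∀ v, (T.children v).Nonempty → F v → c v ∈ T.children v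

variable {T F}

theorem value_leaf {u p : Fin n → ℝ} {v : Fin n} (h : T.children v = ∅) :
    T.value u p v = u v := by
  rw [value, fold_eq]
  simp [h]

theorem value_node {u p : Fin n → ℝ} {v : Fin n} (h : (T.children v).Nonempty) :
    T.value u p v = ∑ w ∈ T.children v, p w * T.value u p w := by
  rw [value, fold_eq, if_pos h]
  exact Finset.sum_congr rfl fun w hw => by simp only [if_pos hw]

theorem value_leader {u q : Fin n → ℝ} {c : Fin n → Fin n} {v : Fin n}
    (h : (T.children v).Nonempty) (hF : ¬ F v) :
    T.value u (T.entry F q c) v = ∑ w ∈ T.children v, q w * T.value u (T.entry F q c) w := by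
  rw [value_node h]
  refine Finset.sum_congr rfl fun w hw => ?_
  rw [entry, (T.mem_children.1 hw).2, if_neg hF]

theorem value_follower {u q : Fin n → ℝ} {c : Fin n → Fin n} {v : Fin n}
    (h : c v ∈ T.children v) (hF : F v) :
    T.value u (T.entry F q c) v = T.value u (T.entry F q c) (c v) := by
  rw [value_node ⟨_, h⟩, Finset.sum_eq_single_of_mem _ h]
  · rw [entry, (T.mem_children.1 h).2, if_pos hF, if_pos rfl, one_mul]
  · intro w hw hne
    rw [entry, (T.mem_children.1 hw).2, if_pos hF, if_neg (Ne.symm hne), zero_mul]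

theorem maximin_leaf {u : Fin n → ℝ} {v : Fin n} (h : T.children v = ∅) :
    T.maximin F u v = u v := by
  rw [maximin, fold_eq]
  simp [h]

theorem maximin_leader {u : Fin n → ℝ} {v : Fin n} (h : (T.children v).Nonempty) (hF : ¬ F v) :
    (∀ w ∈ T.children v, T.maximin F u w ≤ T.maximin F u v) ∧
      ∃ w ∈ T.children v, T.maximin F u v = T.maximin F u w := by
  have key : T.maximin F u v = (T.children v).sup' h (T.maximin F u) := by
    rw [maximin, fold_eq, dif_pos h, if_neg hF]
    exact Finset.sup'_congr h rfl fun w hw => if_pos hw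
  rw [key]
  exact ⟨fun w hw => Finset.le_sup' _ hw, Finset.exists_mem_eq_sup' h _⟩

theorem maximin_follower {u : Fin n → ℝ} {v : Fin n} (h : (T.children v).Nonempty) (hF : F v) :
    (∀ w ∈ T.children v, T.maximin F u v ≤ T.maximin F u w) ∧
      ∃ w ∈ T.children v, T.maximin F u v = T.maximin F u w := by
  have key : T.maximin F u v = (T.children v).inf' h (T.maximin F u) := by
    rw [maximin, fold_eq, dif_pos h, if_pos hF]
    exact Finset.inf'_congr h rfl fun w hw => if_pos hw
  rw [key]
  exact ⟨fun w hw => Finset.inf'_le _ hw, Finset.exists_mem_eq_inf' h _⟩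

theorem responseValue_leaf {u q : Fin n → ℝ} {v : Fin n} (h : T.children v = ∅) :
    T.responseValue F u q v = u v := by
  rw [responseValue, fold_eq]
  simp [h]

theorem responseValue_leader {u q : Fin n → ℝ} {v : Fin n} (h : (T.children v).Nonempty)
    (hF : ¬ F v) :
    T.responseValue F u q v = ∑ w ∈ T.children v, q w * T.responseValue F u q w := by
  rw [responseValue, fold_eq, dif_pos h, if_neg hF]
  exact Finset.sum_congr rfl fun w hw => by simp only [if_pos hw]

theorem responseValue_follower {u q : Fin n → ℝ} {v : Fin n} (h : (T.children v).Nonempty)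
    (hF : F v) :
    (∀ w ∈ T.children v, T.responseValue F u q w ≤ T.responseValue F u q v) ∧
      ∃ w ∈ T.children v, T.responseValue F u q v = T.responseValue F u q w := by
  have key : T.responseValue F u q v = (T.children v).sup' h (T.responseValue F u q) := by
    rw [responseValue, fold_eq, dif_pos h, if_pos hF]
    exact Finset.sup'_congr h rfl fun w hw => if_pos hw
  rw [key]
  exact ⟨fun w hw => Finset.le_sup' _ hw, Finset.exists_mem_eq_sup' h _⟩

/-- Values only depend on the payoffs and on the profile in the subtree. -/
theorem value_congr {u u' q q' : Fin n → ℝ} {c c' : Fin n → Fin n} (v : Fin n)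
    (hu : ∀ w, T.Below v w → u w = u' w) (hq : ∀ w, T.Below v w → w ≠ v → q w = q' w)
    (hc : ∀ w, T.Below v w → c w = c' w) :
    T.value u (T.entry F q c) v = T.value u' (T.entry F q' c') v := by
  induction v using T.induction_children with
  | h v ih =>
    rcases (T.children v).eq_empty_or_nonempty with h | h
    · rw [value_leaf h, value_leaf h, hu v (Below.refl v)]
    · rw [value_node h, value_node h]
      refine Finset.sum_congr rfl fun w hw => ?_
      have hvw := below_of_mem_children hw
      have hne : w ≠ v := by rintro rfl; exact not_below_of_mem_children hw (Below.refl _)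
      rw [ih w hw (fun x hx => hu x (hvw.trans hx))
        (fun x hx _ => hq x (hvw.trans hx)
          (fun h => not_below_of_mem_children hw (h ▸ hx)))
        (fun x hx => hc x (hvw.trans hx))]
      rw [entry, entry, (T.mem_children.1 hw).2, hq w hvw hne, hc v (Below.refl v)]

/-- Used to evaluate strategies glued together from pieces living in different subtrees. -/
theorem responseValue_congr {u q q' : Fin n → ℝ} (v : Fin n)
    (hq : ∀ w, T.Below v w → w ≠ v → q w = q' w) :
    T.responseValue F u q v = T.responseValue F u q' v := by
  induction v using T.induction_children with
  | h v ih =>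
    have ih' : ∀ w ∈ T.children v, T.responseValue F u q w = T.responseValue F u q' w := by
      intro w hw
      have hvw := below_of_mem_children hw
      exact ih w hw (fun x hx _ => hq x (hvw.trans hx)
          (fun h => not_below_of_mem_children hw (h ▸ hx)))
    rcases (T.children v).eq_empty_or_nonempty with h | h
    · rw [responseValue_leaf h, responseValue_leaf h]
    · by_cases hF : F v
      · obtain ⟨h1, w, hw, h2⟩ := responseValue_follower (u := u) (q := q) h hF
        obtain ⟨h1', w', hw', h2'⟩ := responseValue_follower (u := u) (q := q') h hF
        apply le_antisymm
        · rw [h2, ih' w hw]; exact h1' w hw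
        · rw [h2', ← ih' w' hw']; exact h1 w' hw'
      · rw [responseValue_leader h hF, responseValue_leader h hF]
        refine Finset.sum_congr rfl fun w hw => ?_
        have hne : w ≠ v := by rintro rfl; exact not_below_of_mem_children hw (Below.refl _)
        rw [ih' w hw, hq w (below_of_mem_children hw) hne]

theorem value_le_responseValue {u q : Fin n → ℝ} {c : Fin n → Fin n} (hq : T.IsLeader F q)
    (hc : T.IsFollower F c) (v : Fin n) :
    T.value u (T.entry F q c) v ≤ T.responseValue F u q v := by
  induction v using T.induction_children with
  | h v ih =>
    rcases (T.children v).eq_empty_or_nonempty with h | h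
    · rw [value_leaf h, responseValue_leaf h]
    · by_cases hF : F v
      · have := hc v h hF
        rw [value_follower this hF]
        exact (ih _ this).trans ((responseValue_follower h hF).1 _ this)
      · rw [value_leader h hF, responseValue_leader h hF]
        exact Finset.sum_le_sum fun w hw => mul_le_mul_of_nonneg_left (ih w hw) (hq.1 w)

/-- Choosing a best child at every node of the follower gives one response that is optimal in all
subgames at once. -/
theorem exists_value_eq_responseValue (u q : Fin n → ℝ) :
    ∃ c, T.IsFollower F c ∧ ∀ v, T.value u (T.entry F q c) v = T.responseValue F u q v := by
  have hex : ∀ v, ∃ w, (T.children v).Nonempty → F v →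
      w ∈ T.children v ∧ T.responseValue F u q v = T.responseValue F u q w := by
    intro v
    by_cases h : (T.children v).Nonempty
    · by_cases hF : F v
      · obtain ⟨w, hw, h2⟩ := (responseValue_follower (u := u) (q := q) h hF).2
        exact ⟨w, fun _ _ => ⟨hw, h2⟩⟩
      · exact ⟨v, fun _ h' => absurd h' hF⟩
    · exact ⟨v, fun h' => absurd h' h⟩
  choose c hc using hex
  refine ⟨c, fun v h hF => (hc v h hF).1, fun v => ?_⟩
  induction v using T.induction_children with
  | h v ih =>
    rcases (T.children v).eq_empty_or_nonempty with h | h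
    · rw [value_leaf h, responseValue_leaf h]
    · by_cases hF : F v
      · obtain ⟨h1, h2⟩ := hc v h hF
        rw [value_follower h1 hF, h2, ih _ h1]
      · rw [value_leader h hF, responseValue_leader h hF]
        exact Finset.sum_congr rfl fun w hw => by rw [ih w hw]

/-- An optimal strategy of the leader in the zero-sum game. -/
theorem exists_leader_maximin (u : Fin n → ℝ) :
    ∃ q, T.IsLeader F q ∧ ∀ c, T.IsFollower F c → ∀ v,
      T.maximin F u v ≤ T.value u (T.entry F q c) v := by
  have hex : ∀ v, ∃ w, (T.children v).Nonempty → ¬ F v →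
      w ∈ T.children v ∧ T.maximin F u v = T.maximin F u w := by
    intro v
    by_cases h : (T.children v).Nonempty
    · by_cases hF : F v
      · exact ⟨v, fun _ h' => absurd hF h'⟩
      · obtain ⟨w, hw, h2⟩ := (maximin_leader (u := u) h hF).2
        exact ⟨w, fun _ _ => ⟨hw, h2⟩⟩
    · exact ⟨v, fun h' => absurd h' h⟩
  choose s hs using hex
  have hsum : ∀ v (g : Fin n → ℝ), (T.children v).Nonempty → ¬ F v →
      ∑ w ∈ T.children v, (if w = s (T.parent w) then (1 : ℝ) else 0) * g w = g (s v) := by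
    intro v g h hF
    rw [Finset.sum_eq_single_of_mem _ (hs v h hF).1]
    · rw [(T.mem_children.1 (hs v h hF).1).2]; simp
    · intro w hw hne
      rw [(T.mem_children.1 hw).2, if_neg hne, zero_mul]
  refine ⟨fun w => if w = s (T.parent w) then 1 else 0,
    ⟨fun w => by dsimp only; split_ifs <;> norm_num, fun v h hF => ?_⟩, fun c hc v => ?_⟩
  · simpa using hsum v (fun _ => 1) h hF
  · induction v using T.induction_children with
    | h v ih =>
      rcases (T.children v).eq_empty_or_nonempty with h | h
      · rw [value_leaf h, maximin_leaf h]
      · by_cases hF : F v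
        · have := hc v h hF
          rw [value_follower this hF]
          exact ((maximin_follower h hF).1 _ this).trans (ih _ this)
        · rw [value_leader h hF, hsum v _ h hF, (hs v h hF).2]
          exact ih _ (hs v h hF).1

/-- An optimal strategy of the follower in the zero-sum game. -/
theorem exists_follower_maximin (u : Fin n → ℝ) :
    ∃ c, T.IsFollower F c ∧ ∀ q, T.IsLeader F q → ∀ v,
      T.value u (T.entry F q c) v ≤ T.maximin F u v := by
  have hex : ∀ v, ∃ w, (T.children v).Nonempty → F v →
      w ∈ T.children v ∧ T.maximin F u v = T.maximin F u w := by
    intro v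
    by_cases h : (T.children v).Nonempty
    · by_cases hF : F v
      · obtain ⟨w, hw, h2⟩ := (maximin_follower (u := u) h hF).2
        exact ⟨w, fun _ _ => ⟨hw, h2⟩⟩
      · exact ⟨v, fun _ h' => absurd h' hF⟩
    · exact ⟨v, fun h' => absurd h' h⟩
  choose c hc using hex
  refine ⟨c, fun v h hF => (hc v h hF).1, fun q hq v => ?_⟩
  induction v using T.induction_children with
  | h v ih =>
    rcases (T.children v).eq_empty_or_nonempty with h | h
    · rw [value_leaf h, maximin_leaf h]
    · by_cases hF : F v
      · obtain ⟨h1, h2⟩ := hc v h hF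
        rw [value_follower h1 hF, h2]
        exact ih _ h1
      · rw [value_leader h hF]
        calc ∑ w ∈ T.children v, q w * T.value u (T.entry F q c) w
            ≤ ∑ w ∈ T.children v, q w * T.maximin F u v :=
              Finset.sum_le_sum fun w hw => mul_le_mul_of_nonneg_left
                ((ih w hw).trans ((maximin_leader h hF).1 w hw)) (hq.1 w)
          _ = T.maximin F u v := by rw [← Finset.sum_mul, hq.2 v h hF, one_mul]

theorem value_neg (u p : Fin n → ℝ) (v : Fin n) :
    T.value (fun w => -u w) p v = -T.value u p v := by
  induction v using T.induction_children with
  | h v ih =>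
    rcases (T.children v).eq_empty_or_nonempty with h | h
    · rw [value_leaf h, value_leaf h]
    · rw [value_node h, value_node h, ← Finset.sum_neg_distrib]
      exact Finset.sum_congr rfl fun w hw => by rw [ih w hw, mul_neg]

/-- What the follower can secure with the payoffs `r` in the subgame at `v`. -/
noncomputable def security (T : RootedTree n) (F : Fin n → Prop) [DecidablePred F]
    (r : Fin n → ℝ) (v : Fin n) : ℝ :=
  -T.maximin F (fun w => -r w) v

/-- The follower may ignore the commitment and play his optimal strategy in the zero-sum game with
leader's payoffs `-r`. -/
theorem security_le_responseValue {r q : Fin n → ℝ} (hq : T.IsLeader F q) (v : Fin n) :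
    T.security F r v ≤ T.responseValue F r q v := by
  obtain ⟨c, hc, h⟩ := exists_follower_maximin (T := T) (F := F) (fun w => -r w)
  have h1 := h q hq v
  rw [value_neg] at h1
  have h2 := value_le_responseValue (u := r) hq hc v
  rw [security]
  linarith

/-- The punishment strategy: the leader plays as if her payoffs were `-r`, and holds the follower
down to his security level in every subgame simultaneously. -/
theorem exists_responseValue_le_security (r : Fin n → ℝ) :
    ∃ q, T.IsLeader F q ∧ ∀ v, T.responseValue F r q v ≤ T.security F r v := by
  obtain ⟨q, hq, h⟩ := exists_leader_maximin (T := T) (F := F) (fun w => -r w)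
  refine ⟨q, hq, fun v => ?_⟩
  obtain ⟨c, hc, hv⟩ := exists_value_eq_responseValue (T := T) (F := F) r q
  have h1 := h c hc v
  rw [value_neg, hv] at h1
  rw [security]
  linarith

end RootedTree

/-! ### Domination by two points in the plane -/

/-- A convex combination of points of the plane is dominated by a convex combination of two of
them. -/
theorem exists_two_points_dominating {ι : Type*} (s : Finset ι) (ρ X Y : ι → ℝ)
    (hρ : ∀ i ∈ s, 0 < ρ i) (hsum : ∑ i ∈ s, ρ i = 1) :
    ∃ i ∈ s, ∃ j ∈ s, ∃ t : ℝ, 0 ≤ t ∧ t ≤ 1 ∧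
      ∑ k ∈ s, ρ k * X k ≤ t * X i + (1 - t) * X j ∧
      ∑ k ∈ s, ρ k * Y k ≤ t * Y i + (1 - t) * Y j := by
  classical
  set x := ∑ k ∈ s, ρ k * X k with hx
  set y := ∑ k ∈ s, ρ k * Y k with hy
  by_contra! hcon
  have hX : ∑ k ∈ s, ρ k * (X k - x) = 0 := by
    simp only [mul_sub, Finset.sum_sub_distrib, ← Finset.sum_mul, hsum]
    rw [← hx]; ring
  have hY : ∑ k ∈ s, ρ k * (Y k - y) = 0 := by
    simp only [mul_sub, Finset.sum_sub_distrib, ← Finset.sum_mul, hsum]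
    rw [← hy]; ring
  -- The same point taken twice: no single point dominates the mean.
  have hsing : ∀ i ∈ s, x ≤ X i → Y i < y := by
    intro i hi hxi
    have := hcon i hi i hi 1 zero_le_one le_rfl (by linarith)
    linarith
  have hpair : ∀ i ∈ s, x ≤ X i → ∀ j ∈ s, X j < x →
      (X i - x) * (Y j - y) + (x - X j) * (Y i - y) < 0 := by
    intro i hi hxi j hj hxj
    have hd : 0 < X i - X j := by linarith
    -- The weight is the one for which the mixture of `i` and `j` has first coordinate exactly `x`.
    have h := hcon i hi j hj ((x - X j) / (X i - X j)) (div_nonneg (by linarith) hd.le)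
      ((div_le_one hd).2 (by linarith)) (le_of_eq (by field_simp; ring))
    have h2 : (X i - X j) * ((x - X j) / (X i - X j) * Y i +
        (1 - (x - X j) / (X i - X j)) * Y j) < (X i - X j) * y :=
      mul_lt_mul_of_pos_left h hd
    have h3 : (X i - X j) * ((x - X j) / (X i - X j) * Y i +
        (1 - (x - X j) / (X i - X j)) * Y j) = (x - X j) * Y i + (X i - x) * Y j := by
      field_simp; ring
    rw [h3] at h2
    linarith
  have hne : s.Nonempty := by
    rw [Finset.nonempty_iff_ne_empty]
    rintro rfl
    simp at hsum
  by_cases hB : ∃ j ∈ s, X j < x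
  · obtain ⟨j, hj, hxj⟩ := hB
    have hA : ∃ i ∈ s, x ≤ X i := by
      by_contra! hA
      have := Finset.sum_lt_sum_of_nonempty hne
        fun i hi => mul_neg_of_pos_of_neg (hρ i hi) (sub_neg.2 (hA i hi))
      rw [hX] at this
      simp at this
    obtain ⟨i, hi, hxi⟩ := hA
    have hX' := Finset.sum_filter_add_sum_filter_not s (fun k => x ≤ X k)
      (fun k => ρ k * (X k - x))
    have hY' := Finset.sum_filter_add_sum_filter_not s (fun k => x ≤ X k)
      (fun k => ρ k * (Y k - y))
    rw [hX] at hX'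
    rw [hY] at hY'
    -- The pair inequalities are summed with weights `ρ k * ρ l` over the points with first
    -- coordinate at least `x` and those with a smaller one. The double sum splits into products of
    -- the total deviations of the two groups; these are opposite in both coordinates, so it
    -- vanishes.
    have hlt : ∑ k ∈ s.filter (fun k => x ≤ X k), ∑ l ∈ s.filter (fun k => ¬ x ≤ X k),
        ρ k * ρ l * ((X k - x) * (Y l - y) + (x - X l) * (Y k - y)) < 0 := by
      have hterm : ∀ k ∈ s.filter (fun k => x ≤ X k), ∀ l ∈ s.filter (fun k => ¬ x ≤ X k),
          ρ k * ρ l * ((X k - x) * (Y l - y) + (x - X l) * (Y k - y)) < 0 := by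
        intro k hk l hl
        rw [Finset.mem_filter] at hk hl
        exact mul_neg_of_pos_of_neg (mul_pos (hρ k hk.1) (hρ l hl.1))
          (hpair k hk.1 hk.2 l hl.1 (not_le.1 hl.2))
      exact Finset.sum_neg (fun k hk => Finset.sum_neg (hterm k hk)
        ⟨j, Finset.mem_filter.2 ⟨hj, not_le.2 hxj⟩⟩) ⟨i, Finset.mem_filter.2 ⟨hi, hxi⟩⟩
    have heq : ∑ k ∈ s.filter (fun k => x ≤ X k), ∑ l ∈ s.filter (fun k => ¬ x ≤ X k),
        ρ k * ρ l * ((X k - x) * (Y l - y) + (x - X l) * (Y k - y)) =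
        (∑ k ∈ s.filter (fun k => x ≤ X k), ρ k * (X k - x)) *
          (∑ l ∈ s.filter (fun k => ¬ x ≤ X k), ρ l * (Y l - y)) -
        (∑ k ∈ s.filter (fun k => x ≤ X k), ρ k * (Y k - y)) *
          (∑ l ∈ s.filter (fun k => ¬ x ≤ X k), ρ l * (X l - x)) := by
      rw [Finset.sum_mul_sum, Finset.sum_mul_sum, ← Finset.sum_sub_distrib]
      refine Finset.sum_congr rfl fun k _ => ?_
      rw [← Finset.sum_sub_distrib]
      exact Finset.sum_congr rfl fun l _ => by ring
    rw [heq, eq_neg_of_add_eq_zero_right hX', eq_neg_of_add_eq_zero_right hY'] at hlt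
    linarith
  · push Not at hB
    have := Finset.sum_lt_sum_of_nonempty hne
      fun i hi => mul_neg_of_pos_of_neg (hρ i hi) (sub_neg.2 (hsing i hi (hB i hi)))
    rw [hY] at this
    simp at this

/-! ### Commitments in subgames, threats, and the necessary condition for inducibility -/

namespace RootedTree

variable {n : ℕ} {T : RootedTree n} {F : Fin n → Prop} [DecidablePred F]

/-- A commitment in the subgame at `w` can be extended to its parent `v` in such a way that the
follower goes to `w`, provided that `v` belongs to the leader or that the follower can secure the
most at `w`. -/
theorem exists_extension {r q : Fin n → ℝ} {c : Fin n → Fin n} {v w : Fin n}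
    (hq : T.IsLeader F q) (hc : T.IsFollower F c) (hw : w ∈ T.children v)
    (hsec : F v → ∀ w' ∈ T.children v, T.security F r w' ≤ T.security F r w)
    (hbr : T.value r (T.entry F q c) w = T.responseValue F r q w) :
    ∃ q' c', T.IsLeader F q' ∧ T.IsFollower F c' ∧
      T.value r (T.entry F q' c') v = T.responseValue F r q' v ∧
      ∀ u, T.value u (T.entry F q' c') v = T.value u (T.entry F q c) w := by
  classical
  obtain ⟨qp, hqp, hpun⟩ := exists_responseValue_le_security (T := T) (F := F) r
  have hvw := below_of_mem_children hw
  have hwv := not_below_of_mem_children hw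
  have hpw := (T.mem_children.1 hw).2
  have hnv : (T.children v).Nonempty := ⟨w, hw⟩
  -- The leader keeps `q` strictly below `w`, moves from `v` to `w` with certainty if `v` is hers,
  -- and punishes everywhere else.
  let q' : Fin n → ℝ := fun x => if T.Below w x ∧ x ≠ w then q x else
    if T.parent x = v then (if x = w then 1 else 0) else qp x
  let c' : Fin n → Fin n := fun y => if y = v then w else c y
  have hq'w : ∀ x, T.Below w x → x ≠ w → q' x = q x := fun x h1 h2 => if_pos ⟨h1, h2⟩
  have hq'v : ∀ x ∈ T.children v, q' x = if x = w then 1 else 0 := by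
    intro x hx
    have : ¬ (T.Below w x ∧ x ≠ w) := fun h =>
      h.2 (eq_of_below_of_mem_children hx hw (Below.refl x) h.1)
    simp only [q', if_neg this, if_pos (T.mem_children.1 hx).2]
  have hsum : ∀ g : Fin n → ℝ, ∑ x ∈ T.children v, q' x * g x = g w := by
    intro g
    rw [Finset.sum_eq_single_of_mem w hw]
    · rw [hq'v w hw, if_pos rfl, one_mul]
    · intro x hx hne
      rw [hq'v x hx, if_neg hne, zero_mul]
  have hq' : T.IsLeader F q' := by
    refine ⟨fun x => ?_, fun y hy hF => ?_⟩
    · simp only [q']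
      split_ifs
      exacts [hq.1 x, zero_le_one, le_rfl, hqp.1 x]
    · by_cases h1 : T.Below w y
      · rw [← hq.2 y hy hF]
        refine Finset.sum_congr rfl fun x hx => hq'w x (h1.trans (below_of_mem_children hx)) ?_
        rintro rfl
        exact not_below_of_mem_children hx h1
      · by_cases h2 : y = v
        · subst h2
          simpa using hsum fun _ => 1
        · rw [← hqp.2 y hy hF]
          refine Finset.sum_congr rfl fun x hx => ?_
          have hpx := (T.mem_children.1 hx).2
          have h3 : ¬ (T.Below w x ∧ x ≠ w) := by
            rintro ⟨h3, h4⟩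
            rcases (below_child_iff hx).1 h3 with h5 | h5
            exacts [h4 h5.symm, h1 h5]
          simp only [q', if_neg h3, hpx, if_neg h2]
  have hc' : T.IsFollower F c' := by
    intro y hy hF
    by_cases h : y = v
    · subst h; simpa [c'] using hw
    · simpa [c', h] using hc y hy hF
  have hval : ∀ u, T.value u (T.entry F q' c') v = T.value u (T.entry F q c) w := by
    intro u
    have h1 : T.value u (T.entry F q' c') w = T.value u (T.entry F q c) w := by
      refine value_congr w (fun _ _ => rfl) hq'w fun x hx => ?_
      have : x ≠ v := by rintro rfl; exact hwv hx
      simp [c', this]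
    by_cases hF : F v
    · have hcv : c' v = w := by simp [c']
      rw [value_follower (by rw [hcv]; exact hw) hF, hcv, h1]
    · rw [value_leader hnv hF, hsum, h1]
  have hresp : T.responseValue F r q' w = T.responseValue F r q w :=
    responseValue_congr w hq'w
  refine ⟨q', c', hq', hc', ?_, hval⟩
  rw [hval, hbr, ← hresp]
  by_cases hF : F v
  · obtain ⟨h1, w', hw', h2⟩ := responseValue_follower (u := r) (q := q') hnv hF
    apply le_antisymm (h1 w hw)
    rw [h2]
    by_cases hww : w' = w
    · rw [hww]
    -- At another child the punishment holds the follower to his security there, which by `hsec` is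
    -- at most his security at `w`, and hence at most what he gets at `w`.
    · have h3 : T.responseValue F r q' w' = T.responseValue F r qp w' := by
        refine responseValue_congr w' fun x hx hne => ?_
        have h4 : ¬ (T.Below w x ∧ x ≠ w) := fun h =>
          hww (eq_of_below_of_mem_children hw' hw hx h.1)
        have h5 : T.parent x ≠ v := by
          intro h5
          rcases below_iff.1 hx with h6 | h6
          · exact hne h6
          · rw [h5] at h6
            exact not_below_of_mem_children hw' h6
        simp only [q', if_neg h4, if_neg h5]
      rw [h3, hresp]
      exact (hpun w').trans ((hsec hF w' hw').trans (security_le_responseValue hq w))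
  · rw [responseValue_leader hnv hF, hsum]

variable (T F) in
/-- The paths to `z` and `z'` part at a node of the leader in the subtree of `v`. -/
def PartAt (v z z' : Fin n) (l : Fin n) : Prop :=
  T.Below v l ∧ ¬ F l ∧ ∃ w ∈ T.children l, ∃ w' ∈ T.children l, w ≠ w' ∧
    T.Below w z ∧ T.Below w' z'

variable (T F) in
/-- On the way from `v` to `l` the follower can move to a subgame whose value is at most `x`. -/
def Threat (u : Fin n → ℝ) (v l : Fin n) (x : ℝ) : Prop :=
  ∃ p, T.Below v p ∧ F p ∧ ∃ a ∈ T.children p, ∃ w ∈ T.children p, w ≠ a ∧ T.Below a l ∧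
    T.maximin F u w ≤ x

omit [DecidablePred F] in
theorem PartAt.mono {v v' z z' l : Fin n} (h : T.PartAt F v z z' l) (hv : T.Below v' v) :
    T.PartAt F v' z z' l :=
  ⟨hv.trans h.1, h.2⟩

theorem Threat.mono {u : Fin n → ℝ} {v v' l : Fin n} {x : ℝ} (h : T.Threat F u v l x)
    (hv : T.Below v' v) : T.Threat F u v' l x := by
  obtain ⟨p, h1, h2⟩ := h
  exact ⟨p, hv.trans h1, h2⟩

/-- One distribution over the leaves below `v` serves all payoff functions. Since the follower moves
deterministically, two leaves of its support can only be separated by a random move of the leader.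
-/
theorem exists_distribution {q : Fin n → ℝ} {c : Fin n → Fin n} (hq : T.IsLeader F q)
    (hc : T.IsFollower F c) (v : Fin n) :
    ∃ ρ : Fin n → ℝ, (∀ z, 0 ≤ ρ z) ∧ ∑ z, ρ z = 1 ∧
      (∀ z, ρ z ≠ 0 → T.children z = ∅ ∧ T.Below v z) ∧
      (∀ z z', ρ z ≠ 0 → ρ z' ≠ 0 → z ≠ z' → ∃ l, T.PartAt F v z z' l) ∧
      ∀ u, T.value u (T.entry F q c) v = ∑ z, ρ z * u z := by
  classical
  induction v using T.induction_children with
  | h v ih =>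
    rcases (T.children v).eq_empty_or_nonempty with h | h
    · refine ⟨fun z => if z = v then 1 else 0, fun z => ?_, ?_, ?_, ?_, ?_⟩
      · dsimp only; split_ifs <;> norm_num
      · simp
      · intro z hz
        have : z = v := by by_contra h; simp [h] at hz
        subst this
        exact ⟨h, Below.refl _⟩
      · intro z z' hz hz' hne
        have h1 : z = v := by by_contra h; simp [h] at hz
        have h2 : z' = v := by by_contra h; simp [h] at hz'
        exact absurd (h1.trans h2.symm) hne
      · intro u
        simp [value_leaf h]
    · by_cases hF : F v
      · have hcv := hc v h hF
        obtain ⟨ρ, h1, h2, h3, h4, h5⟩ := ih _ hcv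
        have hb := below_of_mem_children hcv
        refine ⟨ρ, h1, h2, fun z hz => ⟨(h3 z hz).1, hb.trans (h3 z hz).2⟩, ?_, ?_⟩
        · intro z z' hz hz' hne
          obtain ⟨l, hl⟩ := h4 z z' hz hz' hne
          exact ⟨l, hl.mono hb⟩
        · intro u
          rw [value_follower hcv hF, h5]
      · have ih' : ∀ w, ∃ ρ : Fin n → ℝ, w ∈ T.children v → ((∀ z, 0 ≤ ρ z) ∧ ∑ z, ρ z = 1 ∧
            (∀ z, ρ z ≠ 0 → T.children z = ∅ ∧ T.Below w z) ∧
            (∀ z z', ρ z ≠ 0 → ρ z' ≠ 0 → z ≠ z' → ∃ l, T.PartAt F w z z' l) ∧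
            ∀ u, T.value u (T.entry F q c) w = ∑ z, ρ z * u z) := by
          intro w
          by_cases hw : w ∈ T.children v
          · obtain ⟨ρ, hρ⟩ := ih w hw
            exact ⟨ρ, fun _ => hρ⟩
          · exact ⟨0, fun h => absurd h hw⟩
        choose ρ hρ using ih'
        have hsupp : ∀ z, ∑ w ∈ T.children v, q w * ρ w z ≠ 0 →
            ∃ w ∈ T.children v, ρ w z ≠ 0 := by
          intro z hz
          obtain ⟨w, hw, h1⟩ := Finset.exists_ne_zero_of_sum_ne_zero hz
          exact ⟨w, hw, right_ne_zero_of_mul h1⟩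
        refine ⟨fun z => ∑ w ∈ T.children v, q w * ρ w z, fun z => ?_, ?_, ?_, ?_, ?_⟩
        · exact Finset.sum_nonneg fun w hw => mul_nonneg (hq.1 w) ((hρ w hw).1 z)
        · rw [Finset.sum_comm, ← hq.2 v h hF]
          refine Finset.sum_congr rfl fun w hw => ?_
          rw [← Finset.mul_sum, (hρ w hw).2.1, mul_one]
        · intro z hz
          obtain ⟨w, hw, h1⟩ := hsupp z hz
          have := (hρ w hw).2.2.1 z h1
          exact ⟨this.1, (below_of_mem_children hw).trans this.2⟩
        · intro z z' hz hz' hne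
          obtain ⟨w, hw, h1⟩ := hsupp z hz
          obtain ⟨w', hw', h1'⟩ := hsupp z' hz'
          by_cases hww : w = w'
          · subst hww
            obtain ⟨l, hl⟩ := (hρ w hw).2.2.2.1 z z' h1 h1' hne
            exact ⟨l, hl.mono (below_of_mem_children hw)⟩
          · exact ⟨v, Below.refl v, hF, w, hw, w', hw', hww, ((hρ w hw).2.2.1 z h1).2,
              ((hρ w' hw').2.2.1 z' h1').2⟩
        · intro u
          rw [value_leader h hF]
          simp only [Finset.sum_mul]
          rw [Finset.sum_comm]
          refine Finset.sum_congr rfl fun w hw => ?_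
          rw [(hρ w hw).2.2.2.2, Finset.mul_sum]
          exact Finset.sum_congr rfl fun z _ => by ring

/-- The pair of expected payoffs is a convex combination of the points `(u z, u' z)` over the
support, so planar domination applies. The leaves it selects belong to the support and hence part at
a node of the leader. -/
theorem exists_dominating_pair {q : Fin n → ℝ} {c : Fin n → Fin n} (hq : T.IsLeader F q)
    (hc : T.IsFollower F c) (u u' : Fin n → ℝ) (v : Fin n) :
    ∃ z z' : Fin n, T.children z = ∅ ∧ T.children z' = ∅ ∧ T.Below v z ∧ T.Below v z' ∧
      (z = z' ∨ ∃ l, T.PartAt F v z z' l) ∧ ∃ t : ℝ, 0 ≤ t ∧ t ≤ 1 ∧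
        T.value u (T.entry F q c) v ≤ t * u z + (1 - t) * u z' ∧
        T.value u' (T.entry F q c) v ≤ t * u' z + (1 - t) * u' z' := by
  classical
  obtain ⟨ρ, h1, h2, h3, h4, h5⟩ := exists_distribution hq hc v
  have hs : ∀ g : Fin n → ℝ,
      ∑ z ∈ Finset.univ.filter (fun z => ρ z ≠ 0), ρ z * g z = ∑ z, ρ z * g z := by
    intro g
    refine Finset.sum_filter_of_ne fun z _ hz => left_ne_zero_of_mul hz
  obtain ⟨z, hz, z', hz', t, ht0, ht1, hx, hy⟩ :=
    exists_two_points_dominating (Finset.univ.filter fun z => ρ z ≠ 0) ρ u u'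
      (fun z hz => lt_of_le_of_ne (h1 z) (Ne.symm (Finset.mem_filter.1 hz).2))
      (by simpa [h2] using hs fun _ => 1)
  rw [hs, ← h5] at hx hy
  have hz := (Finset.mem_filter.1 hz).2
  have hz' := (Finset.mem_filter.1 hz').2
  refine ⟨z, z', (h3 z hz).1, (h3 z' hz').1, (h3 z hz).2, (h3 z' hz').2, ?_, t, ht0, ht1, hx, hy⟩
  by_cases hzz : z = z'
  exacts [Or.inl hzz, Or.inr (h4 z z' hz hz' hzz)]

/-- If `(q, c)` is optimal for the leader in the subgame at `v`, then it is dominated by a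
distribution on a single leaf or on two leaves that is supported by a threat. -/
theorem exists_supported_pair {u u' r q : Fin n → ℝ} {c : Fin n → Fin n}
    (hq : T.IsLeader F q) (hc : T.IsFollower F c) (v : Fin n)
    (hbr : T.value r (T.entry F q c) v = T.responseValue F r q v)
    (hopt : ∀ q' c', T.IsLeader F q' → T.IsFollower F c' →
      T.value r (T.entry F q' c') v = T.responseValue F r q' v →
      T.value u (T.entry F q' c') v ≤ T.value u (T.entry F q c) v) :
    ∃ z z' : Fin n, T.children z = ∅ ∧ T.children z' = ∅ ∧
      (z = z' ∨ ∃ l, T.PartAt F v z z' l ∧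
        T.Threat F u v l (T.value u (T.entry F q c) v)) ∧
      ∃ t : ℝ, 0 ≤ t ∧ t ≤ 1 ∧
        T.value u (T.entry F q c) v ≤ t * u z + (1 - t) * u z' ∧
        T.value u' (T.entry F q c) v ≤ t * u' z + (1 - t) * u' z' := by
  induction v using T.induction_children with
  | h v ih =>
    -- The descent from `v` to `w`: commitments in the subgame at `w` extend to `v`, so the
    -- optimality of `(q, c)` at `v` passes to `w` when the leader's value is the same at both.
    have step : ∀ w ∈ T.children v,
        T.value u (T.entry F q c) w = T.value u (T.entry F q c) v →
        T.value u' (T.entry F q c) v ≤ T.value u' (T.entry F q c) w →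
        T.value r (T.entry F q c) w = T.responseValue F r q w →
        (F v → ∀ w' ∈ T.children v, T.security F r w' ≤ T.security F r w) →
        ∃ z z' : Fin n, T.children z = ∅ ∧ T.children z' = ∅ ∧
          (z = z' ∨ ∃ l, T.PartAt F v z z' l ∧
            T.Threat F u v l (T.value u (T.entry F q c) v)) ∧
          ∃ t : ℝ, 0 ≤ t ∧ t ≤ 1 ∧
            T.value u (T.entry F q c) v ≤ t * u z + (1 - t) * u z' ∧
            T.value u' (T.entry F q c) v ≤ t * u' z + (1 - t) * u' z' := by
      intro w hw hu hu' hr hsec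
      have hb := below_of_mem_children hw
      obtain ⟨z, z', h1, h2, h3, t, h4, h5, h6, h7⟩ := ih w hw hr (by
        intro q' c' hq' hc' hbr'
        obtain ⟨q'', c'', hq'', hc'', hbr'', hval⟩ := exists_extension hq' hc' hw hsec hbr'
        rw [hu, ← hval]
        exact hopt q'' c'' hq'' hc'' hbr'')
      rw [hu] at h3 h6
      refine ⟨z, z', h1, h2, h3.imp id ?_, t, h4, h5, h6, hu'.trans h7⟩
      rintro ⟨l, h8, h9⟩
      exact ⟨l, h8.mono hb, h9.mono hb⟩
    rcases (T.children v).eq_empty_or_nonempty with h | h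
    · refine ⟨v, v, h, h, Or.inl rfl, 1, zero_le_one, le_rfl, ?_, ?_⟩ <;>
        rw [value_leaf h] <;> linarith
    · by_cases hF : F v
      · have hcv := hc v h hF
        have hur := value_follower (u := r) (q := q) hcv hF
        -- A sibling of `c v` of value at most the leader's payoff threatens everything below `c v`;
        -- then any dominating pair will do. Otherwise the descent goes on.
        by_cases hth : ∃ w ∈ T.children v, w ≠ c v ∧
            T.maximin F u w ≤ T.value u (T.entry F q c) v
        · obtain ⟨w, hw, hwc, hle⟩ := hth
          obtain ⟨z, z', h1, h2, -, -, h3, t, h4, h5, h6, h7⟩ :=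
            exists_dominating_pair hq hc u u' (c v)
          rw [← value_follower hcv hF] at h6 h7
          refine ⟨z, z', h1, h2, h3.imp id ?_, t, h4, h5, h6, h7⟩
          rintro ⟨l, hl⟩
          exact ⟨l, hl.mono (below_of_mem_children hcv), v, Below.refl v, hF, c v, hcv, w, hw, hwc,
            hl.1, hle⟩
        · push Not at hth
          obtain ⟨hle, -⟩ := responseValue_follower (u := r) (q := q) h hF
          have hval := value_le_responseValue (u := r) hq hc (c v)
          refine step (c v) hcv (value_follower hcv hF).symm (value_follower hcv hF).le
            (le_antisymm hval ?_) fun _ => ?_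
          · rw [← hur, hbr]; exact hle _ hcv
          · obtain ⟨w, hw, hmax⟩ := Finset.exists_max_image _ (T.security F r) h
            by_cases hwc : w = c v
            · exact hwc ▸ hmax
            -- If a child `w` other than `c v` maximizes the security, the leader can lure the
            -- follower to `w`, play maximin there, and get more than the supposed optimum.
            · exfalso
              obtain ⟨q', hq', hmm⟩ := exists_leader_maximin (T := T) (F := F) u
              obtain ⟨c', hc', hb⟩ := exists_value_eq_responseValue (T := T) (F := F) r q'
              obtain ⟨q'', c'', hq'', hc'', hbr'', hval''⟩ :=
                exists_extension hq' hc' hw (fun _ => hmax) (hb w)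
              have h1 := hopt q'' c'' hq'' hc'' hbr''
              rw [hval''] at h1
              exact absurd (h1.trans_lt (hth w hw hwc)) (not_lt.2 (hmm c' hc' w))
      · have hle : ∀ w ∈ T.children v, T.value r (T.entry F q c) w ≤ T.responseValue F r q w :=
          fun w _ => value_le_responseValue hq hc w
        -- The gaps to the best response are nonnegative and their average is zero, so they vanish
        -- on the support of `q`.
        have hr : ∀ w ∈ T.children v, q w ≠ 0 →
            T.value r (T.entry F q c) w = T.responseValue F r q w := by
          rw [value_leader h hF, responseValue_leader h hF,
            Finset.sum_eq_sum_iff_of_le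
              fun w hw => mul_le_mul_of_nonneg_left (hle w hw) (hq.1 w)] at hbr
          exact fun w hw hne => mul_left_cancel₀ hne (hbr w hw)
        -- The leader could move to `w` with certainty. Hence no child of the support beats the
        -- average, and then all of them equal it.
        have hule : ∀ w ∈ T.children v, q w ≠ 0 →
            T.value u (T.entry F q c) w ≤ T.value u (T.entry F q c) v := by
          intro w hw hne
          obtain ⟨q'', c'', hq'', hc'', hbr'', hval''⟩ :=
            exists_extension hq hc hw (fun h => absurd h hF) (hr w hw hne)
          rw [← hval'']
          exact hopt q'' c'' hq'' hc'' hbr''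
        have hueq : ∀ w ∈ T.children v, q w ≠ 0 →
            T.value u (T.entry F q c) w = T.value u (T.entry F q c) v := by
          have h1 : ∑ w ∈ T.children v, q w * T.value u (T.entry F q c) w =
              ∑ w ∈ T.children v, q w * T.value u (T.entry F q c) v := by
            rw [← Finset.sum_mul, hq.2 v h hF, one_mul, ← value_leader h hF]
          rw [Finset.sum_eq_sum_iff_of_le] at h1
          · exact fun w hw hne => mul_left_cancel₀ hne (h1 w hw)
          · intro w hw
            by_cases hne : q w = 0
            · simp [hne]
            · exact mul_le_mul_of_nonneg_left (hule w hw hne) (hq.1 w)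
        -- Among these children, equally good for the leader, one is no worse than the average for
        -- `u'`.
        have hex : ∃ w ∈ T.children v, q w ≠ 0 ∧
            T.value u' (T.entry F q c) v ≤ T.value u' (T.entry F q c) w := by
          by_contra! hcon
          have h1 : ∑ w ∈ T.children v, q w * (T.value u' (T.entry F q c) w -
              T.value u' (T.entry F q c) v) = 0 := by
            simp only [mul_sub, Finset.sum_sub_distrib]
            rw [← value_leader h hF, ← Finset.sum_mul, hq.2 v h hF]
            ring
          have h2 : ∃ w ∈ T.children v, q w ≠ 0 :=
            Finset.exists_ne_zero_of_sum_ne_zero (by rw [hq.2 v h hF]; exact one_ne_zero)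
          obtain ⟨w, hw, hne⟩ := h2
          refine absurd h1 (ne_of_lt (Finset.sum_neg' (fun x hx => ?_) ⟨w, hw, ?_⟩))
          · by_cases hx0 : q x = 0
            · simp [hx0]
            · exact mul_nonpos_of_nonneg_of_nonpos (hq.1 x)
                (sub_nonpos.2 (hcon x hx hx0).le)
          · exact mul_neg_of_pos_of_neg (lt_of_le_of_ne (hq.1 w) (Ne.symm hne))
              (sub_neg.2 (hcon w hw hne))
        obtain ⟨w, hw, hne, hu'⟩ := hex
        exact step w hw (hueq w hw hne) hu' (hr w hw hne) fun h => absurd h hF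

end RootedTree

namespace RootedTree

variable {n : ℕ} {T : RootedTree n} {F : Fin n → Prop} [DecidablePred F]

/-! ### Reach probabilities -/

variable (T) in
/-- The probability that play arrives at `v`. -/
noncomputable def reach (p : Fin n → ℝ) (v : Fin n) : ℝ := ∏ w ∈ T.path v, p w

theorem mem_path {v w : Fin n} : w ∈ T.path v ↔ w ≠ T.root ∧ T.Below w v := by
  simp [path, Below]

theorem reach_root (p : Fin n → ℝ) : T.reach p T.root = 1 := by
  have : T.path T.root = ∅ := by
    ext w
    simp only [mem_path, below_root_right]
    simp
  simp [reach, this]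

theorem reach_child (p : Fin n → ℝ) {v w : Fin n} (hw : w ∈ T.children v) :
    T.reach p w = T.reach p v * p w := by
  classical
  have h1 : T.path w = insert w (T.path v) := by
    ext y
    simp only [mem_path, Finset.mem_insert, below_child_iff hw]
    constructor
    · rintro ⟨h1, rfl | h2⟩
      exacts [Or.inl rfl, Or.inr ⟨h1, h2⟩]
    · rintro (rfl | ⟨h1, h2⟩)
      exacts [⟨(T.mem_children.1 hw).1, Or.inl rfl⟩, ⟨h1, Or.inr h2⟩]
  have h2 : w ∉ T.path v := fun h => not_below_of_mem_children hw (mem_path.1 h).2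
  rw [reach, h1, Finset.prod_insert h2, mul_comm, reach]

/-- Sum value times reach probability over all nodes. The term of a decision node is the sum of the
terms of its children, so the decision nodes together contribute the terms of all nodes but the
root. What is left equates the leaves with the root. -/
theorem sum_reach_leaf (u p : Fin n → ℝ) :
    ∑ z ∈ Finset.univ.filter (fun z => T.children z = ∅), u z * T.reach p z =
      T.value u p T.root := by
  classical
  have h1 := Finset.sum_filter_add_sum_filter_not Finset.univ (fun z => T.children z = ∅)
    (fun v => T.value u p v * T.reach p v)
  have h2 : ∑ v ∈ Finset.univ.filter (fun z => ¬ T.children z = ∅),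
      T.value u p v * T.reach p v =
      ∑ v, ∑ w ∈ T.children v, T.value u p w * T.reach p w := by
    rw [← Finset.sum_filter_add_sum_filter_not Finset.univ (fun z => T.children z = ∅)
      (fun v => ∑ w ∈ T.children v, T.value u p w * T.reach p w)]
    rw [Finset.sum_eq_zero (s := Finset.univ.filter fun z => T.children z = ∅), zero_add]
    · refine Finset.sum_congr rfl fun v hv => ?_
      rw [value_node (Finset.nonempty_iff_ne_empty.2 (Finset.mem_filter.1 hv).2), Finset.sum_mul]
      exact Finset.sum_congr rfl fun w hw => by rw [reach_child p hw]; ring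
    · intro v hv
      rw [(Finset.mem_filter.1 hv).2, Finset.sum_empty]
  have h3 : ∑ v, ∑ w ∈ T.children v, T.value u p w * T.reach p w =
      ∑ w ∈ Finset.univ.filter (fun w => w ≠ T.root), T.value u p w * T.reach p w := by
    rw [← Finset.sum_fiberwise (Finset.univ.filter fun w => w ≠ T.root) T.parent]
    refine Finset.sum_congr rfl fun v _ => Finset.sum_congr ?_ fun _ _ => rfl
    ext w
    simp [children]
  have h4 := Finset.sum_filter_add_sum_filter_not Finset.univ (fun w => w = T.root)
    (fun v => T.value u p v * T.reach p v)
  rw [h2, h3] at h1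
  rw [Finset.filter_eq' Finset.univ, if_pos (Finset.mem_univ _), Finset.sum_singleton,
    reach_root, mul_one] at h4
  have h5 : ∑ z ∈ Finset.univ.filter (fun z => T.children z = ∅), u z * T.reach p z =
      ∑ z ∈ Finset.univ.filter (fun z => T.children z = ∅), T.value u p z * T.reach p z :=
    Finset.sum_congr rfl fun z hz => by rw [value_leaf (Finset.mem_filter.1 hz).2]
  linarith

theorem entry_nonneg {q : Fin n → ℝ} {c : Fin n → Fin n} (hq : T.IsLeader F q) (w : Fin n) :
    0 ≤ T.entry F q c w := by
  rw [entry]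
  split_ifs
  exacts [zero_le_one, le_rfl, hq.1 w]

theorem value_one {q : Fin n → ℝ} {c : Fin n → Fin n} (hq : T.IsLeader F q)
    (hc : T.IsFollower F c) (v : Fin n) : T.value (fun _ => 1) (T.entry F q c) v = 1 := by
  induction v using T.induction_children with
  | h v ih =>
    rcases (T.children v).eq_empty_or_nonempty with h | h
    · rw [value_leaf h]
    · by_cases hF : F v
      · rw [value_follower (hc v h hF) hF, ih _ (hc v h hF)]
      · rw [value_leader h hF]
        exact (Finset.sum_congr rfl fun w hw => by rw [ih w hw, mul_one]).trans (hq.2 v h hF)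

theorem reach_nonneg {q : Fin n → ℝ} {c : Fin n → Fin n} (hq : T.IsLeader F q) (v : Fin n) :
    0 ≤ T.reach (T.entry F q c) v :=
  Finset.prod_nonneg fun w _ => entry_nonneg hq w

/-! ### Candidates and the payoff functions that induce them -/

/-- The distribution with weight `t` on `z` and `1 - t` on `z'`. -/
def twoPoint (z z' : Fin n) (t : ℝ) (y : Fin n) : ℝ :=
  if y = z then t else if y = z' then 1 - t else 0

variable (T F) in
/-- The distribution with weight `t` on `z` and `1 - t` on `z'` has leader's payoff `x`, at least
her maximin value, and is concentrated on one leaf or parts at `l` and is supported by a threat. -/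
structure IsCandidate (u : Fin n → ℝ) (z z' l : Fin n) (x t : ℝ) : Prop where
  leaf : T.children z = ∅
  leaf' : T.children z' = ∅
  nonneg : 0 ≤ t
  le_one : t ≤ 1
  payoff : t * u z + (1 - t) * u z' = x
  maximin_le : T.maximin F u T.root ≤ x
  single_or_pair : (z = z' ∧ l = z ∧ t = 1) ∨
    (T.PartAt F T.root z z' l ∧ T.Threat F u T.root l x)

variable (T F) in
/-- The payoff function reported by the follower for a candidate. -/
noncomputable def report (u : Fin n → ℝ) (B : ℝ) (z z' l : Fin n) (x : ℝ) (y : Fin n) : ℝ :=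
  if y = z ∨ y = z' then x - u y
  else if T.junction l y = l ∨ x < T.maximin F u (T.branch l y) then x - B
  else T.maximin F u (T.branch l y) - u y

variable {u : Fin n → ℝ} {B : ℝ} {z z' l : Fin n} {x t : ℝ}

omit [DecidablePred F] in
theorem PartAt.branch_eq (h : T.PartAt F T.root z z' l) :
    T.junction l z = l ∧ T.junction l z' = l ∧ T.branch l z ∈ T.children l ∧
      T.branch l z' ∈ T.children l ∧ T.branch l z ≠ T.branch l z' ∧
      T.Below (T.branch l z) z ∧ T.Below (T.branch l z') z' := by
  obtain ⟨-, -, w, hw, w', hw', hne, h1, h2⟩ := h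
  obtain ⟨h3, h4⟩ := branch_unique (Below.refl l) hw (not_below_of_mem_children hw) h1
  obtain ⟨h5, h6⟩ := branch_unique (Below.refl l) hw' (not_below_of_mem_children hw') h2
  rw [h4, h6]
  exact ⟨h3, h5, hw, hw', hne, h1, h2⟩

/-- A choice of children that leads to `z` along its path and preserves the maximin value where no
child leads to `z`. It is made at the nodes of both players. -/
theorem exists_toward (u : Fin n → ℝ) (z : Fin n) : ∃ s : Fin n → Fin n, ∀ v,
    (T.children v).Nonempty → s v ∈ T.children v ∧
      (∀ w ∈ T.children v, T.Below w z → s v = w) ∧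
      ((∀ w ∈ T.children v, ¬ T.Below w z) → T.maximin F u (s v) = T.maximin F u v) := by
  have hex : ∀ v, ∃ y, (T.children v).Nonempty → y ∈ T.children v ∧
      (∀ w ∈ T.children v, T.Below w z → y = w) ∧
      ((∀ w ∈ T.children v, ¬ T.Below w z) → T.maximin F u y = T.maximin F u v) := by
    intro v
    by_cases h : (T.children v).Nonempty
    · by_cases h2 : ∃ w ∈ T.children v, T.Below w z
      · obtain ⟨w, hw, hwz⟩ := h2
        exact ⟨w, fun _ => ⟨hw, fun w' hw' h' => eq_of_below_of_mem_children hw hw' hwz h',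
          fun h' => absurd hwz (h' w hw)⟩⟩
      · push Not at h2
        have : ∃ w ∈ T.children v, T.maximin F u v = T.maximin F u w := by
          by_cases hF : F v
          exacts [(maximin_follower h hF).2, (maximin_leader h hF).2]
        obtain ⟨w, hw, h3⟩ := this
        exact ⟨w, fun _ => ⟨hw, fun w' hw' h' => absurd h' (h2 w' hw'), fun _ => h3.symm⟩⟩
    · exact ⟨v, fun h' => absurd h' h⟩
  choose s hs using hex
  exact ⟨s, hs⟩

variable (T F) in
/-- The profile `(q, c)` realizes a candidate, and off the path `q` is optimal for the leader in
the zero-sum game. -/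
structure Realizes (u : Fin n → ℝ) (z z' l : Fin n) (t : ℝ) (q : Fin n → ℝ) (c : Fin n → Fin n) :
    Prop where
  leader : T.IsLeader F q
  follower : T.IsFollower F c
  at_part : (T.children l).Nonempty → ∀ g : Fin n → ℝ,
    ∑ w ∈ T.children l, q w * g w = t * g (T.branch l z) + (1 - t) * g (T.branch l z')
  off_path : ∀ v, (T.children v).Nonempty → ¬ F v → ¬ T.Below v l → ¬ T.Below l v →
    ∀ w ∈ T.children v, q w ≠ 0 → T.maximin F u w = T.maximin F u v
  reach_eq : ∀ y, T.children y = ∅ → T.reach (T.entry F q c) y = twoPoint z z' t y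

omit [DecidablePred F] in
theorem single_or_pair_below (h : (z = z' ∧ l = z ∧ t = 1) ∨ T.PartAt F T.root z z' l) :
    T.Below l z ∧ T.Below l z' := by
  rcases h with ⟨rfl, rfl, -⟩ | ⟨-, -, w, hw, w', hw', -, h1, h2⟩
  · exact ⟨Below.refl _, Below.refl _⟩
  · exact ⟨(below_of_mem_children hw).trans h1, (below_of_mem_children hw').trans h2⟩

/-- The play heads for `l`, splits there with weights `t` and `1 - t`, and goes on to `z` and `z'`.
Elsewhere the choices preserve the maximin value. -/
theorem exists_realizes (u : Fin n → ℝ) (hz : T.children z = ∅) (hz' : T.children z' = ∅)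
    (ht0 : 0 ≤ t) (ht1 : t ≤ 1)
    (h : (z = z' ∧ l = z ∧ t = 1) ∨ T.PartAt F T.root z z' l) :
    ∃ q c, T.Realizes F u z z' l t q c := by
  classical
  obtain ⟨hlz, hlz'⟩ := single_or_pair_below h
  obtain ⟨s, hs⟩ := exists_toward (T := T) (F := F) u z
  obtain ⟨s', hs'⟩ := exists_toward (T := T) (F := F) u z'
  have hpair : (T.children l).Nonempty → T.PartAt F T.root z z' l := by
    intro hne
    rcases h with ⟨rfl, rfl, -⟩ | h
    · rw [hz] at hne; simp at hne
    · exact h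
  -- The target is `z'` only inside the branch from `l` to `z'`. Above `l` the paths to both leaves
  -- agree, so `z` can serve as the target there.
  let σ : Fin n → Fin n := fun v => if T.Below (T.branch l z') v then s' v else s v
  let q : Fin n → ℝ := fun w => if T.parent w = l then
      (if w = T.branch l z then t else if w = T.branch l z' then 1 - t else 0)
    else if σ (T.parent w) = w then 1 else 0
  have hσ : ∀ v, (T.children v).Nonempty → σ v ∈ T.children v := by
    intro v hv
    simp only [σ]
    split_ifs
    exacts [(hs' v hv).1, (hs v hv).1]
  have hql : ∀ w ∈ T.children l,
      q w = if w = T.branch l z then t else if w = T.branch l z' then 1 - t else 0 :=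
    fun w hw => if_pos (T.mem_children.1 hw).2
  have hqv : ∀ v, v ≠ l → ∀ w ∈ T.children v, q w = if σ v = w then 1 else 0 := by
    intro v hv w hw
    have := (T.mem_children.1 hw).2
    simp only [q, this, if_neg hv]
  have hpart : (T.children l).Nonempty → ∀ g : Fin n → ℝ,
      ∑ w ∈ T.children l, q w * g w = t * g (T.branch l z) + (1 - t) * g (T.branch l z') := by
    intro hne g
    obtain ⟨-, -, h1, h2, h3, -, -⟩ := (hpair hne).branch_eq
    rw [Finset.sum_eq_add_of_mem _ _ h1 h2 h3, hql _ h1, hql _ h2, if_pos rfl, if_neg h3.symm,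
      if_pos rfl]
    rintro w hw ⟨h4, h5⟩
    rw [hql w hw, if_neg h4, if_neg h5, zero_mul]
  have hsumv : ∀ v, v ≠ l → (T.children v).Nonempty → ∑ w ∈ T.children v, q w = 1 := by
    intro v hv hne
    rw [Finset.sum_congr rfl (hqv v hv), Finset.sum_ite_eq, if_pos (hσ v hne)]
  have hleader : T.IsLeader F q := by
    refine ⟨fun w => ?_, fun v hv hF => ?_⟩
    · simp only [q]
      split_ifs <;> linarith
    · by_cases hvl : v = l
      · subst hvl
        have := hpart hv fun _ => 1
        simp only [mul_one] at this
        linarith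
      · exact hsumv v hvl hv
  have hfollower : T.IsFollower F σ := fun v hv _ => hσ v hv
  have hentry : ∀ v w, w ∈ T.children v → v ≠ l →
      T.entry F q σ w = if σ v = w then 1 else 0 := by
    intro v w hw hv
    rw [entry, (T.mem_children.1 hw).2, hqv v hv w hw]
    split_ifs <;> rfl
  have hentryl : ∀ w ∈ T.children l, T.entry F q σ w = q w := by
    intro w hw
    rw [entry, (T.mem_children.1 hw).2, if_neg (hpair ⟨w, hw⟩).2.1]
  have hpath : ∀ w, w ∈ T.path z → T.parent w ≠ l → T.entry F q σ w = 1 := by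
    intro w hw hp
    obtain ⟨h1, h2⟩ := mem_path.1 hw
    have hw' := T.mem_children_parent h1
    rw [hentry _ w hw' hp, if_pos]
    have h3 := hs _ ⟨w, hw'⟩
    have h3' := hs' _ ⟨w, hw'⟩
    simp only [σ]
    split_ifs with h4
    · rcases h with ⟨rfl, -, -⟩ | h
      · exact h3'.2.1 w hw' h2
      · obtain ⟨-, -, h5, h6, h7, h8, h9⟩ := h.branch_eq
        exact absurd (eq_of_below_of_mem_children h5 h6 h8
          ((h4.trans (below_parent w)).trans h2)) h7
    · exact h3.2.1 w hw' h2
  have hpath' : ∀ w, w ∈ T.path z' → T.parent w ≠ l → T.PartAt F T.root z z' l →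
      T.entry F q σ w = 1 := by
    intro w hw hp h
    obtain ⟨h1, h2⟩ := mem_path.1 hw
    have hw' := T.mem_children_parent h1
    have h3 := hs _ ⟨w, hw'⟩
    have h3' := hs' _ ⟨w, hw'⟩
    rw [hentry _ w hw' hp, if_pos]
    simp only [σ]
    split_ifs with h4
    · exact h3'.2.1 w hw' h2
    · obtain ⟨-, -, h5, h6, h7, h8, h9⟩ := h.branch_eq
      rcases ((below_parent w).trans h2).total h9 with h10 | h10
      · rcases (below_child_iff h6).1 h10 with h11 | h11
        · exact absurd (h11 ▸ Below.refl _) h4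
        · obtain ⟨a, ha, hal⟩ := h11.exists_child (Ne.symm hp)
          have := eq_of_below_of_mem_children ha hw' (hal.trans hlz') h2
          rw [this] at hal
          exact h3.2.1 w hw' (hal.trans hlz)
      · exact absurd h10 h4
  have hreachz : T.reach (T.entry F q σ) z = t := by
    rw [reach]
    rcases h with ⟨h1, h2, h3⟩ | h
    · rw [h3]
      refine Finset.prod_eq_one fun w hw => hpath w hw fun hp => ?_
      have := T.mem_children_parent (mem_path.1 hw).1
      rw [hp, h2, hz] at this
      simp at this
    · obtain ⟨-, -, h5, h6, h7, h8, h9⟩ := h.branch_eq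
      rw [Finset.prod_eq_single_of_mem (T.branch l z)
        (mem_path.2 ⟨(T.mem_children.1 h5).1, h8⟩)]
      · rw [hentryl _ h5, hql _ h5, if_pos rfl]
      · intro w hw hne
        refine hpath w hw fun hp => hne ?_
        have := T.mem_children_parent (mem_path.1 hw).1
        rw [hp] at this
        exact eq_of_below_of_mem_children this h5 (mem_path.1 hw).2 h8
  have hreachz' : T.PartAt F T.root z z' l → T.reach (T.entry F q σ) z' = 1 - t := by
    intro h
    obtain ⟨-, -, h5, h6, h7, h8, h9⟩ := h.branch_eq
    rw [reach, Finset.prod_eq_single_of_mem (T.branch l z')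
      (mem_path.2 ⟨(T.mem_children.1 h6).1, h9⟩)]
    · rw [hentryl _ h6, hql _ h6, if_neg h7.symm, if_pos rfl]
    · intro w hw hne
      refine hpath' w hw (fun hp => hne ?_) h
      have := T.mem_children_parent (mem_path.1 hw).1
      rw [hp] at this
      exact eq_of_below_of_mem_children this h6 (mem_path.1 hw).2 h9
  have htotal := sum_reach_leaf (T := T) (fun _ => 1) (T.entry F q σ)
  rw [value_one hleader hfollower] at htotal
  simp only [one_mul] at htotal
  refine ⟨q, σ, hleader, hfollower, hpart, ?_, ?_⟩
  · intro v hv hF hvl hlv w hw hqw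
    have hne : v ≠ l := by rintro rfl; exact hlv (Below.refl _)
    rw [hqv v hne w hw] at hqw
    have hσw : σ v = w := by by_contra h; simp [h] at hqw
    have hoff : ∀ y, T.Below l y → ∀ w ∈ T.children v, ¬ T.Below w y := by
      intro y hy w hw hwy
      rcases hy.total hwy with h | h
      · rcases (below_child_iff hw).1 h with h | h
        · subst h; exact hvl (below_of_mem_children hw)
        · exact hlv h
      · exact hvl ((below_of_mem_children hw).trans h)
    rw [← hσw]
    simp only [σ]
    split_ifs
    exacts [(hs' v hv).2.2 (hoff z' hlz'), (hs v hv).2.2 (hoff z hlz)]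
  · intro y hy
    have hmem : ∀ y, T.children y = ∅ →
        y ∈ Finset.univ.filter (fun z => T.children z = ∅) := by simp
    rw [twoPoint]
    split_ifs with h1 h2
    · rw [h1, hreachz]
    · rcases h with ⟨h3, -⟩ | h
      · exact absurd (h2.trans h3.symm) h1
      · rw [h2, hreachz' h]
    -- The leaves `z` and `z'` already carry the total mass `1`, so nothing remains for `y`.
    · have hnn : ∀ y ∈ Finset.univ.filter (fun z => T.children z = ∅),
          0 ≤ T.reach (T.entry F q σ) y := fun y _ => reach_nonneg hleader y
      apply le_antisymm _ (hnn y (hmem y hy))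
      have hsub : ∀ s : Finset (Fin n), (∀ y ∈ s, T.children y = ∅) →
          ∑ y ∈ s, T.reach (T.entry F q σ) y ≤ 1 := by
        intro s hs
        rw [← htotal]
        exact Finset.sum_le_sum_of_subset_of_nonneg (fun y hy => hmem y (hs y hy))
          fun y hy _ => hnn y hy
      rcases h with ⟨h3, -, h4⟩ | h
      · have := hsub {y, z} (by simp [hy, hz])
        rw [Finset.sum_pair h1, hreachz, h4] at this
        linarith
      · have h3 : z ≠ z' := by
          intro h3
          obtain ⟨-, -, h5, h6, h7, h8, h9⟩ := h.branch_eq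
          exact h7 (by rw [h3])
        have := hsub {y, z, z'} (by simp [hy, hz, hz'])
        rw [Finset.sum_insert (by simp [h1, h2]), Finset.sum_pair h3, hreachz, hreachz' h] at this
        linarith

end RootedTree

/-! ### The report of a candidate: security and best responses -/

namespace RootedTree

variable {n : ℕ} {T : RootedTree n} {F : Fin n → Prop} [DecidablePred F]
  {u : Fin n → ℝ} {B : ℝ} {z z' l : Fin n} {x t : ℝ}

theorem IsCandidate.single_or_part (h : T.IsCandidate F u z z' l x t) :
    (z = z' ∧ l = z ∧ t = 1) ∨ T.PartAt F T.root z z' l :=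
  h.single_or_pair.imp id And.left

theorem IsCandidate.payoff_le (h : T.IsCandidate F u z z' l x t)
    (hB : ∀ y, T.children y = ∅ → u y ≤ B) : x ≤ B := by
  rw [← h.payoff]
  have h1 := mul_le_mul_of_nonneg_left (hB z h.leaf) h.nonneg
  have h2 := mul_le_mul_of_nonneg_left (hB z' h.leaf') (sub_nonneg.2 h.le_one)
  linarith

theorem IsCandidate.eq_of_children (h : T.IsCandidate F u z z' l x t) :
    (T.children l).Nonempty → T.PartAt F T.root z z' l := by
  rintro ⟨w, hw⟩
  rcases h.single_or_part with ⟨-, rfl, -⟩ | h'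
  · rw [h.leaf] at hw
    simp at hw
  · exact h'

/-- This cap drives the construction: when the follower gets at least `0` under the report, at most
`x` is left for the leader, whatever she commits to. -/
theorem report_add_le (hB : ∀ y, T.children y = ∅ → u y ≤ B) {y : Fin n} (hy : T.children y = ∅) :
    T.report F u B z z' l x y + u y ≤ x := by
  rw [report]
  split_ifs with h1 h2
  · linarith
  · linarith [hB y hy]
  · push Not at h2
    linarith [h2.2]

/-- In a hanging subtree of value at most `x`, the report is the negative of the leader's payoff,
shifted by the value of the subtree. By minimizing her payoff the follower therefore secures `0` at
the top of the subtree. -/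
theorem maximin_neg_report_off_path (h : T.IsCandidate F u z z' l x t) (v : Fin n)
    (hv : ¬ T.Below v l) (hj : T.junction l v ≠ l)
    (hx : T.maximin F u (T.branch l v) ≤ x) :
    T.maximin F (fun y => -T.report F u B z z' l x y) v ≤
      T.maximin F u v - T.maximin F u (T.branch l v) := by
  induction v using T.induction_children with
  | h v ih =>
    rcases (T.children v).eq_empty_or_nonempty with hc | hc
    · rw [maximin_leaf hc, maximin_leaf hc]
      have hne : ¬ (v = z ∨ v = z') := by
        rcases h.single_or_part with ⟨h1, h2, -⟩ | h'
        · rintro (h3 | h3)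
          · exact hv (by rw [h3, ← h2]; exact Below.refl _)
          · exact hv (by rw [h3, ← h1, ← h2]; exact Below.refl _)
        · obtain ⟨h1, h2, -⟩ := h'.branch_eq
          rintro (h3 | h3)
          · exact hj (h3 ▸ h1)
          · exact hj (h3 ▸ h2)
      rw [report, if_neg hne, if_neg (not_or.2 ⟨hj, not_lt.2 hx⟩)]
      linarith
    · have key : ∀ w ∈ T.children v, T.maximin F (fun y => -T.report F u B z z' l x y) w ≤
          T.maximin F u w - T.maximin F u (T.branch l v) := by
        intro w hw
        obtain ⟨h1, h2, h3⟩ := branch_child hv hw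
        rw [← h3]
        exact ih w hw h1 (h2 ▸ hj) (h3 ▸ hx)
      by_cases hF : F v
      · obtain ⟨w, hw, hvw⟩ := (maximin_follower (u := u) hc hF).2
        rw [hvw]
        exact ((maximin_follower hc hF).1 w hw).trans (key w hw)
      · obtain ⟨w, hw, hvw⟩ :=
          (maximin_leader (u := fun y => -T.report F u B z z' l x y) hc hF).2
        rw [hvw]
        exact (key w hw).trans (sub_le_sub_right ((maximin_leader hc hF).1 w hw) _)

/-- Follow the path to `l`. At a follower's node he enters a sibling of value at most `x`, if there
is one; if not, the child on the path attains the minimum and still has value at most `x`. At a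
leader's node all children have value at most `x`. The descent meets a threat before `l` or ends at
a single leaf, where the report is `0`. -/
theorem maximin_neg_report_on_path (h : T.IsCandidate F u z z' l x t) (v : Fin n)
    (hv : T.Below v l) (hx : T.maximin F u v ≤ x)
    (hth : (z = z' ∧ l = z ∧ t = 1) ∨ T.Threat F u v l x) :
    T.maximin F (fun y => -T.report F u B z z' l x y) v ≤ 0 := by
  induction v using T.induction_children with
  | h v ih =>
    by_cases hvl : v = l
    · subst hvl
      rcases hth with ⟨h1, h2, h3⟩ | ⟨p, h1, -, a, ha, -, -, -, h2, -⟩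
      · have hp := h.payoff
        rw [h3] at hp
        rw [maximin_leaf (h2 ▸ h.leaf), report, if_pos (Or.inl h2), h2]
        linarith
      -- Threats lie strictly above `l`, so none is left at `l` itself.
      · exact absurd (h2.trans h1) (not_below_of_mem_children ha)
    · obtain ⟨a, ha, hal⟩ := hv.exists_child (Ne.symm hvl)
      have hc : (T.children v).Nonempty := ⟨a, ha⟩
      have hpath : ∀ w ∈ T.children v, T.Below w l → w = a := fun w hw hwl =>
        eq_of_below_of_mem_children hw ha hwl hal
      have hoff : ∀ w ∈ T.children v, ¬ T.Below w l → T.maximin F u w ≤ x →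
          T.maximin F (fun y => -T.report F u B z z' l x y) w ≤ 0 := by
        intro w hw hwl hwx
        obtain ⟨h1, h2⟩ := branch_child_of_below hv hw hwl
        have := maximin_neg_report_off_path (B := B) h w hwl (h1 ▸ hvl) (h2.symm ▸ hwx)
        rwa [h2, sub_self] at this
      -- A threat that is not available at `v` is found further down the path.
      have hthreat : (∀ w ∈ T.children v, w ≠ a → F v → x < T.maximin F u w) →
          (z = z' ∧ l = z ∧ t = 1) ∨ T.Threat F u a l x := by
        intro hno
        refine hth.imp id ?_
        rintro ⟨p, h1, h2, b, hb, w, hw, hwb, hbl, hle⟩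
        have hpl : T.Below p l := (below_of_mem_children hb).trans hbl
        refine ⟨p, ?_, h2, b, hb, w, hw, hwb, hbl, hle⟩
        rcases hal.total hpl with h3 | h3
        · exact h3
        · rcases (below_child_iff ha).1 h3 with h4 | h4
          · rw [h4]; exact Below.refl a
          · have hvp := h1.antisymm h4
            subst hvp
            have hba := hpath b hb hbl
            subst hba
            exact absurd hle (not_le.2 (hno w hw hwb h2))
      by_cases hF : F v
      · by_cases hex : ∃ w ∈ T.children v, w ≠ a ∧ T.maximin F u w ≤ x
        · obtain ⟨w, hw, hwa, hwx⟩ := hex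
          exact ((maximin_follower hc hF).1 w hw).trans
            (hoff w hw (fun hwl => hwa (hpath w hw hwl)) hwx)
        · push Not at hex
          obtain ⟨w, hw, hvw⟩ := (maximin_follower (u := u) hc hF).2
          have hwa : w = a := by
            by_contra hwa
            exact absurd (hex w hw hwa) (not_lt.2 (hvw ▸ hx))
          subst hwa
          exact ((maximin_follower hc hF).1 w hw).trans
            (ih w hw hal (hvw ▸ hx) (hthreat fun w hw hne _ => hex w hw hne))
      · obtain ⟨w, hw, hvw⟩ :=
          (maximin_leader (u := fun y => -T.report F u B z z' l x y) hc hF).2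
        have hwx := ((maximin_leader hc hF).1 w hw).trans hx
        rw [hvw]
        by_cases hwl : T.Below w l
        · have hwa := hpath w hw hwl
          subst hwa
          exact ih w hw hwl hwx (hthreat fun _ _ _ h' => absurd h' hF)
        · exact hoff w hw hwl hwx

/-- With the reported payoffs the follower can secure `0`. -/
theorem security_report_nonneg (h : T.IsCandidate F u z z' l x t) :
    0 ≤ T.security F (T.report F u B z z' l x) T.root := by
  have := maximin_neg_report_on_path (B := B) h T.root (below_root l) h.maximin_le
    (h.single_or_pair.imp id And.right)
  rw [security]
  linarith

/-- Against a leader who realizes the candidate, the follower gets at most `0`. -/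
theorem value_report_le (h : T.IsCandidate F u z z' l x t)
    (hB : ∀ y, T.children y = ∅ → u y ≤ B) {q : Fin n → ℝ} {c c' : Fin n → Fin n}
    (hr : T.Realizes F u z z' l t q c) (hc' : T.IsFollower F c') :
    T.value (T.report F u B z z' l x) (T.entry F q c') T.root ≤ 0 := by
  classical
  have hxB := h.payoff_le hB
  -- An upper bound for the follower's value in every subgame. It dominates the report at the
  -- leaves, does not grow under his moves, and at a leader's node is at least its average over her
  -- moves. It is zero on the path to `l`, constant towards `z` and towards `z'`, and in a subtree
  -- of value at most `x` it measures how far the leader's maximin value has dropped since the top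
  -- of the subtree.
  let f : Fin n → ℝ := fun v =>
    if T.Below v l then 0
    else if T.junction l v = l then
      (if T.branch l v = T.branch l z then x - u z
        else if T.branch l v = T.branch l z' then x - u z' else 0)
    else if x < T.maximin F u (T.branch l v) then 0
    else T.maximin F u (T.branch l v) - T.maximin F u v
  have f_below : ∀ v, T.Below v l → f v = 0 := fun v hv => if_pos hv
  have f_part : ∀ v, ¬ T.Below v l → T.junction l v = l → f v =
      if T.branch l v = T.branch l z then x - u z
        else if T.branch l v = T.branch l z' then x - u z' else 0 := by
    intro v h1 h2
    simp only [f, if_neg h1, if_pos h2]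
  have f_off : ∀ v, ¬ T.Below v l → T.junction l v ≠ l → f v =
      if x < T.maximin F u (T.branch l v) then 0
    else T.maximin F u (T.branch l v) - T.maximin F u v := by
    intro v h1 h2
    simp only [f, if_neg h1, if_neg h2]
  have hpartne : ∀ v, ¬ T.Below v l → T.junction l v = l → T.PartAt F T.root z z' l := by
    intro v h1 h2
    have := (branch_spec h1).1
    rw [h2] at this
    exact h.eq_of_children ⟨_, this⟩
  have hleaf : ∀ y, T.children y = ∅ → T.report F u B z z' l x y ≤ f y := by
    intro y hy
    by_cases h1 : T.Below y l
    · have h2 := eq_of_below_leaf hy h1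
      subst h2
      rw [f_below _ h1]
      rcases h.single_or_part with ⟨-, h3, h4⟩ | ⟨-, -, w, hw, -⟩
      · have hp := h.payoff
        rw [h4] at hp
        rw [report, if_pos (Or.inl h3), h3]
        linarith
      · rw [hy] at hw; simp at hw
    · by_cases h2 : T.junction l y = l
      · obtain ⟨-, -, h5, h6, h7, h8, h9⟩ := (hpartne y h1 h2).branch_eq
        rw [f_part y h1 h2, report]
        by_cases h3 : y = z
        · rw [if_pos (Or.inl h3), h3, if_pos rfl]
        · by_cases h4 : y = z'
          · rw [if_pos (Or.inr h4), h4, if_neg h7.symm, if_pos rfl]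
          · rw [if_neg (not_or.2 ⟨h3, h4⟩), if_pos (Or.inl h2)]
            have := hB z h.leaf
            have := hB z' h.leaf'
            split_ifs <;> linarith
      · have hne : ¬ (y = z ∨ y = z') := by
          rcases h.single_or_part with ⟨h3, h4, -⟩ | h'
          · rintro (h5 | h5)
            · exact h1 (by rw [h5, ← h4]; exact Below.refl _)
            · exact h1 (by rw [h5, ← h3, ← h4]; exact Below.refl _)
          · obtain ⟨h3, h4, -⟩ := h'.branch_eq
            rintro (h5 | h5)
            · exact h2 (h5 ▸ h3)
            · exact h2 (h5 ▸ h4)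
        rw [f_off y h1 h2, report, if_neg hne, maximin_leaf hy]
        simp only [h2, false_or]
        split_ifs <;> linarith
  -- Off the path a move of the follower can only raise the maximin value, while `hr.off_path` makes
  -- the leader preserve it.
  have hfollower : ∀ v, F v → ∀ w ∈ T.children v, f w ≤ f v := by
    intro v hF w hw
    by_cases hv : T.Below v l
    · rw [f_below v hv]
      by_cases hwl : T.Below w l
      · rw [f_below w hwl]
      · obtain ⟨h1, h2⟩ := branch_child_of_below hv hw hwl
        have hne : v ≠ l := by
          rintro rfl
          exact (h.eq_of_children ⟨w, hw⟩).2.1 hF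
        rw [f_off w hwl (h1 ▸ hne), h2, sub_self, ite_self]
    · obtain ⟨h1, h2, h3⟩ := branch_child hv hw
      by_cases h4 : T.junction l v = l
      · rw [f_part v hv h4, f_part w h1 (h2 ▸ h4), h3]
      · rw [f_off v hv h4, f_off w h1 (h2 ▸ h4), h3]
        split_ifs
        · exact le_rfl
        · exact sub_le_sub_left ((maximin_follower ⟨w, hw⟩ hF).1 w hw) _
  have hleader : ∀ v, (T.children v).Nonempty → ¬ F v →
      ∑ w ∈ T.children v, q w * f w ≤ f v := by
    intro v hne hF
    have hconst : (∀ w ∈ T.children v, q w ≠ 0 → f w = f v) →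
        ∑ w ∈ T.children v, q w * f w ≤ f v := by
      intro hf
      rw [← one_mul (f v), ← hr.leader.2 v hne hF, Finset.sum_mul]
      refine Finset.sum_le_sum fun w hw => ?_
      by_cases hq0 : q w = 0
      · simp [hq0]
      · rw [hf w hw hq0]
    by_cases hv : T.Below v l
    · by_cases hvl : v = l
      · subst hvl
        obtain ⟨h3, h4, h5, h6, h7, h8, h9⟩ := (h.eq_of_children hne).branch_eq
        have hb : ∀ w ∈ T.children v, ¬ T.Below w v ∧ T.junction v w = v ∧ T.branch v w = w :=
          fun w hw => ⟨not_below_of_mem_children hw,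
            branch_child_of_below hv hw (not_below_of_mem_children hw)⟩
        obtain ⟨b1, b2, b3⟩ := hb _ h5
        obtain ⟨c1, c2, c3⟩ := hb _ h6
        rw [hr.at_part hne, f_below v hv, f_part _ b1 b2, f_part _ c1 c2, b3, c3, if_pos rfl,
          if_neg h7.symm, if_pos rfl]
        have := h.payoff
        linarith
      · refine hconst fun w hw _ => ?_
        rw [f_below v hv]
        by_cases hwl : T.Below w l
        · rw [f_below w hwl]
        · obtain ⟨h1, h2⟩ := branch_child_of_below hv hw hwl
          rw [f_off w hwl (h1 ▸ hvl), h2, sub_self, ite_self]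
    · refine hconst fun w hw hqw => ?_
      obtain ⟨h1, h2, h3⟩ := branch_child hv hw
      by_cases h4 : T.junction l v = l
      · rw [f_part v hv h4, f_part w h1 (h2 ▸ h4), h3]
      · have hlv : ¬ T.Below l v := by
          intro hlv
          have hne : v ≠ l := by rintro rfl; exact hv (Below.refl _)
          obtain ⟨a, ha, hav⟩ := hlv.exists_child hne
          exact h4 (branch_unique (Below.refl l) ha (not_below_of_mem_children ha) hav).1
        rw [f_off v hv h4, f_off w h1 (h2 ▸ h4), h3, hr.off_path v hne hF hv hlv w hw hqw]
  have key : ∀ v, T.value (T.report F u B z z' l x) (T.entry F q c') v ≤ f v := by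
    intro v
    induction v using T.induction_children with
    | h v ih =>
      rcases (T.children v).eq_empty_or_nonempty with hv | hv
      · rw [value_leaf hv]
        exact hleaf v hv
      · by_cases hF : F v
        · have hcv := hc' v hv hF
          rw [value_follower hcv hF]
          exact (ih _ hcv).trans (hfollower v hF _ hcv)
        · rw [value_leader hv hF]
          exact (Finset.sum_le_sum fun w hw =>
            mul_le_mul_of_nonneg_left (ih w hw) (hr.leader.1 w)).trans (hleader v hv hF)
  exact (key T.root).trans_eq (f_below _ (below_root l))

theorem value_add_le {r p : Fin n → ℝ} {q : Fin n → ℝ} {c : Fin n → Fin n}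
    (hq : T.IsLeader F q) (hc : T.IsFollower F c)
    (hr : ∀ y, T.children y = ∅ → r y + p y ≤ x) (v : Fin n) :
    T.value r (T.entry F q c) v + T.value p (T.entry F q c) v ≤ x := by
  induction v using T.induction_children with
  | h v ih =>
    rcases (T.children v).eq_empty_or_nonempty with hv | hv
    · rw [value_leaf hv, value_leaf hv]
      exact hr v hv
    · by_cases hF : F v
      · have hcv := hc v hv hF
        rw [value_follower hcv hF, value_follower hcv hF]
        exact ih _ hcv
      · rw [value_leader hv hF, value_leader hv hF, ← Finset.sum_add_distrib]
        calc ∑ w ∈ T.children v, (q w * T.value r (T.entry F q c) w +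
              q w * T.value p (T.entry F q c) w)
            ≤ ∑ w ∈ T.children v, q w * x := Finset.sum_le_sum fun w hw => by
              rw [← mul_add]
              exact mul_le_mul_of_nonneg_left (ih w hw) (hq.1 w)
          _ = x := by rw [← Finset.sum_mul, hq.2 v hv hF, one_mul]

theorem sum_mul_twoPoint (g : Fin n → ℝ) (h : T.IsCandidate F u z z' l x t) :
    ∑ y ∈ Finset.univ.filter (fun y => T.children y = ∅), g y * twoPoint z z' t y =
      t * g z + (1 - t) * g z' := by
  have hz : z ∈ Finset.univ.filter (fun y => T.children y = ∅) := by simp [h.leaf]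
  have hz' : z' ∈ Finset.univ.filter (fun y => T.children y = ∅) := by simp [h.leaf']
  rcases h.single_or_part with ⟨h1, -, h2⟩ | h'
  · rw [Finset.sum_eq_single_of_mem z hz]
    · simp [twoPoint, h2]
    · intro y _ hne
      simp [twoPoint, hne, ← h1]
  · have hne : z ≠ z' := by
      intro h3
      obtain ⟨-, -, -, -, h7, -⟩ := h'.branch_eq
      exact h7 (by rw [h3])
    rw [Finset.sum_eq_add_of_mem z z' hz hz' hne]
    · simp only [twoPoint, if_true, if_neg hne.symm]
      ring
    · rintro y - ⟨h1, h2⟩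
      simp [twoPoint, h1, h2]

end RootedTree

/-! ### Games -/

namespace GameTree

open Stackelberg.RootedTree

variable {n : ℕ} {G : GameTree n}

/-- The nodes of the follower. -/
abbrev IsF (G : GameTree n) (v : Fin n) : Prop := G.ownerCode v = 1

theorem isF_iff (v : G.Decision) : G.IsF v.1 ↔ G.owner v = Player.follower := by
  obtain ⟨v, hv⟩ := v
  rw [IsF, ownerCode, dif_pos hv]
  cases G.owner ⟨v, hv⟩ <;> simp

theorem not_isF_iff (v : G.Decision) : ¬ G.IsF v.1 ↔ G.owner v = Player.leader := by
  rw [isF_iff]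
  cases G.owner v <;> simp

theorem payoffCode_leaf (U : G.Leaf → ℝ) (z : G.Leaf) : payoffCode U z.1 = U z :=
  dif_pos z.2

theorem outcome_eq_reach {δ : G.LeaderStrategy} {π : G.FollowerStrategy} {p : Fin n → ℝ}
    (h : ∀ w (hw : w ≠ G.root), moveProb δ π w hw = p w) (z : G.Leaf) :
    outcome δ π z = G.reach p z.1 := by
  refine Finset.prod_congr rfl fun w hw => ?_
  have := (mem_path.1 hw).1
  rw [dif_pos this, h]

theorem sum_leaf (g : Fin n → ℝ) :
    ∑ z : G.Leaf, g z.1 = ∑ z ∈ Finset.univ.filter (fun z => G.children z = ∅), g z :=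
  (Finset.sum_subtype (Finset.univ.filter fun z => G.children z = ∅) (by simp) g).symm

theorem utility_outcome {δ : G.LeaderStrategy} {π : G.FollowerStrategy} {p : Fin n → ℝ}
    (h : ∀ w (hw : w ≠ G.root), moveProb δ π w hw = p w) (U : G.Leaf → ℝ) :
    utility U (outcome δ π) = G.value (payoffCode U) p G.root := by
  rw [← sum_reach_leaf, ← sum_leaf, utility]
  exact Finset.sum_congr rfl fun z _ => by rw [outcome_eq_reach h, payoffCode_leaf]

/-- Every leader's strategy is represented by entry probabilities. -/
theorem exists_isLeader (δ : G.LeaderStrategy) : ∃ q, G.IsLeader G.IsF q ∧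
    ∀ w (hw : w ≠ G.root) (h : G.owner (G.parentDecision w hw) = Player.leader),
      (δ ⟨G.parentDecision w hw, h⟩).1 ⟨w, G.mem_children_parent hw⟩ = q w := by
  classical
  let q : Fin n → ℝ := fun w =>
    if h : ∃ hw : w ≠ G.root, G.owner (G.parentDecision w hw) = Player.leader then
      (δ ⟨G.parentDecision w h.1, h.2⟩).1 ⟨w, G.mem_children_parent h.1⟩ else 0
  have hq : ∀ w (hw : w ≠ G.root) (h : G.owner (G.parentDecision w hw) = Player.leader),
      (δ ⟨G.parentDecision w hw, h⟩).1 ⟨w, G.mem_children_parent hw⟩ = q w := by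
    intro w hw h
    simp only [q]
    rw [dif_pos ⟨hw, h⟩]
  refine ⟨q, ⟨fun w => ?_, fun v hv hF => ?_⟩, hq⟩
  · simp only [q]
    split_ifs with h
    · exact (δ ⟨G.parentDecision w h.1, h.2⟩).2.1 _
    · exact le_rfl
  · have hown := (not_isF_iff ⟨v, hv⟩).1 hF
    rw [← (δ ⟨⟨v, hv⟩, hown⟩).2.2, Finset.sum_subtype (G.children v) (fun x => Iff.rfl)]
    refine Finset.sum_congr rfl fun w _ => ?_
    obtain ⟨w, hw⟩ := w
    obtain ⟨hwr, rfl⟩ := G.mem_children.1 hw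
    exact (hq w hwr hown).symm

theorem exists_leaderStrategy {q : Fin n → ℝ} (hq : G.IsLeader G.IsF q) :
    ∃ δ : G.LeaderStrategy,
      ∀ w (hw : w ≠ G.root) (h : G.owner (G.parentDecision w hw) = Player.leader),
        (δ ⟨G.parentDecision w hw, h⟩).1 ⟨w, G.mem_children_parent hw⟩ = q w := by
  refine ⟨fun v => ⟨fun w => q w.1, fun w => hq.1 _, ?_⟩, fun _ _ _ => rfl⟩
  rw [← hq.2 v.1.1 v.1.2 ((not_isF_iff v.1).2 v.2)]
  exact (Finset.sum_subtype (G.children v.1.1) (fun x => Iff.rfl) q).symm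

theorem exists_isFollower (π : G.FollowerStrategy) : ∃ c, G.IsFollower G.IsF c ∧
    ∀ w (hw : w ≠ G.root) (h : G.owner (G.parentDecision w hw) = Player.follower),
      (π ⟨G.parentDecision w hw, h⟩).1 = c (G.parent w) := by
  classical
  let c : Fin n → Fin n := fun v =>
    if h : ∃ hv : (G.children v).Nonempty, G.owner ⟨v, hv⟩ = Player.follower then
      (π ⟨⟨v, h.1⟩, h.2⟩).1 else v
  have hc : ∀ v (hv : (G.children v).Nonempty) (h : G.owner ⟨v, hv⟩ = Player.follower),
      (π ⟨⟨v, hv⟩, h⟩).1 = c v := by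
    intro v hv h
    simp only [c]
    rw [dif_pos ⟨hv, h⟩]
  refine ⟨c, fun v hv hF => ?_, fun w hw h => hc _ _ h⟩
  have hown := (isF_iff ⟨v, hv⟩).1 hF
  rw [← hc v hv hown]
  exact (π ⟨⟨v, hv⟩, hown⟩).2

theorem exists_followerStrategy {c : Fin n → Fin n} (hc : G.IsFollower G.IsF c) :
    ∃ π : G.FollowerStrategy,
      ∀ w (hw : w ≠ G.root) (h : G.owner (G.parentDecision w hw) = Player.follower),
        (π ⟨G.parentDecision w hw, h⟩).1 = c (G.parent w) :=
  ⟨fun v => ⟨c v.1.1, hc _ v.1.2 ((isF_iff v.1).2 v.2)⟩, fun _ _ _ => rfl⟩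

theorem moveProb_eq_entry {δ : G.LeaderStrategy} {π : G.FollowerStrategy} {q : Fin n → ℝ}
    {c : Fin n → Fin n}
    (hδ : ∀ w (hw : w ≠ G.root) (h : G.owner (G.parentDecision w hw) = Player.leader),
      (δ ⟨G.parentDecision w hw, h⟩).1 ⟨w, G.mem_children_parent hw⟩ = q w)
    (hπ : ∀ w (hw : w ≠ G.root) (h : G.owner (G.parentDecision w hw) = Player.follower),
      (π ⟨G.parentDecision w hw, h⟩).1 = c (G.parent w)) (w : Fin n) (hw : w ≠ G.root) :
    moveProb δ π w hw = G.entry G.IsF q c w := by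
  rw [moveProb, entry]
  split
  · next h =>
    have hF : ¬ G.IsF (G.parent w) := (not_isF_iff (G.parentDecision w hw)).2 h
    rw [if_neg hF]
    exact hδ w hw h
  · next h =>
    have hF : G.IsF (G.parent w) := (isF_iff (G.parentDecision w hw)).2 h
    rw [if_pos hF, hπ w hw h]

/-- The reported payoffs induce the distribution of the candidate. -/
theorem induces_report {UL : G.Leaf → ℝ} {B : ℝ} {z z' l : Fin n} {x t : ℝ}
    (h : G.IsCandidate G.IsF (payoffCode UL) z z' l x t) (hB : ∀ y, UL y ≤ B) :
    Induces UL (fun y => G.report G.IsF (payoffCode UL) B z z' l x y.1)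
      (fun y => twoPoint z z' t y.1) := by
  have hB' : ∀ y, G.children y = ∅ → payoffCode UL y ≤ B := by
    intro y hy
    rw [payoffCode_leaf UL ⟨y, hy⟩]
    exact hB _
  set R : G.Leaf → ℝ := fun y => G.report G.IsF (payoffCode UL) B z z' l x y.1 with hR
  -- The two payoff functions may differ at decision nodes, but values read them at leaves only.
  have hcode : ∀ p v, G.value (payoffCode R) p v =
      G.value (G.report G.IsF (payoffCode UL) B z z' l x) p v := by
    intro p v
    induction v using G.induction_children with
    | h v ih =>
      rcases (G.children v).eq_empty_or_nonempty with hv | hv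
      · rw [value_leaf hv, value_leaf hv, payoffCode_leaf R ⟨v, hv⟩]
      · rw [value_node hv, value_node hv]
        exact Finset.sum_congr rfl fun w hw => by rw [ih w hw]
  obtain ⟨q, c, hr⟩ := exists_realizes (payoffCode UL) h.leaf h.leaf' h.nonneg h.le_one
    h.single_or_part
  obtain ⟨δ, hδ⟩ := exists_leaderStrategy hr.leader
  obtain ⟨π, hπ⟩ := exists_followerStrategy hr.follower
  have hprob := moveProb_eq_entry hδ hπ
  have hval : ∀ g : Fin n → ℝ, G.value g (G.entry G.IsF q c) G.root =
      t * g z + (1 - t) * g z' := by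
    intro g
    rw [← sum_reach_leaf, ← sum_mul_twoPoint g h]
    exact Finset.sum_congr rfl fun y hy => by rw [hr.reach_eq y (Finset.mem_filter.1 hy).2]
  have hUL : utility UL (outcome δ π) = x := by
    rw [utility_outcome hprob, hval, h.payoff]
  have hUR : utility R (outcome δ π) = 0 := by
    rw [utility_outcome hprob, hcode, hval, report, report, if_pos (Or.inl rfl),
      if_pos (Or.inr rfl), ← h.payoff]
    ring
  refine ⟨δ, π, ?_, ?_, ?_⟩
  · funext y
    rw [outcome_eq_reach hprob]
    exact hr.reach_eq y.1 y.2
  · intro π'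
    obtain ⟨c', hc', hπ'⟩ := exists_isFollower π'
    rw [hUR, utility_outcome (moveProb_eq_entry hδ hπ'), hcode]
    exact value_report_le h hB' hr hc'
  · intro δ' π' hbr
    obtain ⟨q', hq', hδ'⟩ := exists_isLeader δ'
    obtain ⟨c', hc', hπ'⟩ := exists_isFollower π'
    obtain ⟨c₀, hc₀, hv₀⟩ := exists_value_eq_responseValue (T := G.toRootedTree) (F := G.IsF)
      (G.report G.IsF (payoffCode UL) B z z' l x) q'
    obtain ⟨π₀, hπ₀⟩ := exists_followerStrategy hc₀
    have h1 := hbr π₀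
    rw [utility_outcome (moveProb_eq_entry hδ' hπ₀), utility_outcome (moveProb_eq_entry hδ' hπ'),
      hcode, hcode, hv₀] at h1
    -- A best response gives the follower at least his security, hence at least `0`; by the cap on
    -- the sum of both payoffs the leader gets at most `x`.
    have h2 := security_le_responseValue (r := G.report G.IsF (payoffCode UL) B z z' l x) hq'
      G.root
    have h3 := security_report_nonneg (B := B) h
    have h4 := value_add_le (r := G.report G.IsF (payoffCode UL) B z z' l x) hq' hc' (fun y hy => report_add_le hB' hy) G.root
    rw [hUL, utility_outcome (moveProb_eq_entry hδ' hπ')]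
    linarith

/-- An inducible distribution gives the leader at least her maximin value and is dominated by a
distribution on one leaf or on two leaves that is supported by a threat. -/
theorem Inducible.exists_supported_pair {UL p : G.Leaf → ℝ} (hp : Inducible UL p)
    (UF : G.Leaf → ℝ) : ∃ x, G.maximin G.IsF (payoffCode UL) G.root ≤ x ∧
      ∃ z z' : Fin n, G.children z = ∅ ∧ G.children z' = ∅ ∧
        (z = z' ∨ ∃ l, G.PartAt G.IsF G.root z z' l ∧
          G.Threat G.IsF (payoffCode UL) G.root l x) ∧
        ∃ t : ℝ, 0 ≤ t ∧ t ≤ 1 ∧ x ≤ t * payoffCode UL z + (1 - t) * payoffCode UL z' ∧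
          utility UF p ≤ t * payoffCode UF z + (1 - t) * payoffCode UF z' := by
  obtain ⟨R, δ, π, rfl, hbr, hopt⟩ := hp
  obtain ⟨q, hq, hδ⟩ := exists_isLeader δ
  obtain ⟨c, hc, hπ⟩ := exists_isFollower π
  have hprob := moveProb_eq_entry hδ hπ
  -- Best responses are the responses that attain `responseValue` at the root.
  have hbest : ∀ {δ' : G.LeaderStrategy} {q' : Fin n → ℝ} {π' : G.FollowerStrategy}
      {c' : Fin n → Fin n}, G.IsLeader G.IsF q' → G.IsFollower G.IsF c' →
      (∀ w (hw : w ≠ G.root) (h : G.owner (G.parentDecision w hw) = Player.leader),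
        (δ' ⟨G.parentDecision w hw, h⟩).1 ⟨w, G.mem_children_parent hw⟩ = q' w) →
      (∀ w (hw : w ≠ G.root) (h : G.owner (G.parentDecision w hw) = Player.follower),
        (π' ⟨G.parentDecision w hw, h⟩).1 = c' (G.parent w)) →
      (IsBestResponse R δ' π' ↔ G.value (payoffCode R) (G.entry G.IsF q' c') G.root =
        G.responseValue G.IsF (payoffCode R) q' G.root) := by
    intro δ' q' π' c' hq' hc' hδ' hπ'
    constructor
    · intro hb
      obtain ⟨c₀, hc₀, hv₀⟩ := exists_value_eq_responseValue (T := G.toRootedTree) (F := G.IsF)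
        (payoffCode R) q'
      obtain ⟨π₀, hπ₀⟩ := exists_followerStrategy hc₀
      have h1 := hb π₀
      rw [utility_outcome (moveProb_eq_entry hδ' hπ₀),
        utility_outcome (moveProb_eq_entry hδ' hπ'), hv₀] at h1
      exact le_antisymm (value_le_responseValue hq' hc' _) h1
    · intro heq π₀
      obtain ⟨c₀, hc₀, hπ₀⟩ := exists_isFollower π₀
      rw [utility_outcome (moveProb_eq_entry hδ' hπ₀),
        utility_outcome (moveProb_eq_entry hδ' hπ'), heq]
      exact value_le_responseValue hq' hc₀ _
  have hopt' : ∀ q' c', G.IsLeader G.IsF q' → G.IsFollower G.IsF c' →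
      G.value (payoffCode R) (G.entry G.IsF q' c') G.root =
        G.responseValue G.IsF (payoffCode R) q' G.root →
      G.value (payoffCode UL) (G.entry G.IsF q' c') G.root ≤
        G.value (payoffCode UL) (G.entry G.IsF q c) G.root := by
    intro q' c' hq' hc' heq
    obtain ⟨δ', hδ'⟩ := exists_leaderStrategy hq'
    obtain ⟨π', hπ'⟩ := exists_followerStrategy hc'
    have := hopt δ' π' ((hbest hq' hc' hδ' hπ').2 heq)
    rwa [utility_outcome (moveProb_eq_entry hδ' hπ'), utility_outcome hprob] at this
  refine ⟨G.value (payoffCode UL) (G.entry G.IsF q c) G.root, ?_, ?_⟩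
  -- A maximin commitment guarantees its value against every response, in particular against a best
  -- one for `R`; the equilibrium payoff cannot be lower.
  · obtain ⟨q', hq', hmm⟩ := exists_leader_maximin (T := G.toRootedTree) (F := G.IsF)
      (payoffCode UL)
    obtain ⟨c', hc', hv'⟩ := exists_value_eq_responseValue (T := G.toRootedTree) (F := G.IsF)
      (payoffCode R) q'
    exact (hmm c' hc' G.root).trans (hopt' q' c' hq' hc' (hv' G.root))
  · rw [utility_outcome hprob]
    exact RootedTree.exists_supported_pair hq hc G.root ((hbest hq hc hδ hπ).1 hbr) hopt'

end GameTree

/-! ### Reasoning about programs -/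

/-- Started in `s`, the program `P` halts within `T` steps in a state that satisfies `Q`. -/
def WP (P : Prog) (s : State) (T : ℕ) (Q : State → Prop) : Prop :=
  ∃ t s', Exec P s t s' ∧ t ≤ T ∧ Q s'

namespace Prog

/-- The index registers written by a program. -/
def ireg : Prog → List ℕ
  | skip => []
  | op (.iconst d _) => [d]
  | op (.imove d _) => [d]
  | op (.iadd d _ _) => [d]
  | op (.isub d _ _) => [d]
  | op (.iload d _ _) => [d]
  | op _ => []
  | seq P Q => P.ireg ++ Q.ireg
  | ite _ P Q => P.ireg ++ Q.ireg
  | loop _ P => P.ireg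

/-- The data registers written by a program. -/
def rreg : Prog → List ℕ
  | skip => []
  | op (.rconst d _) => [d]
  | op (.rmove d _) => [d]
  | op (.radd d _ _) => [d]
  | op (.rsub d _ _) => [d]
  | op (.rmul d _ _) => [d]
  | op (.rdiv d _ _) => [d]
  | op (.rload d _ _) => [d]
  | op _ => []
  | seq P Q => P.rreg ++ Q.rreg
  | ite _ P Q => P.rreg ++ Q.rreg
  | loop _ P => P.rreg

/-- The banks of the index memory written by a program. -/
def imem : Prog → List ℕ
  | skip => []
  | op (.istore k _ _) => [k]
  | op _ => []
  | seq P Q => P.imem ++ Q.imem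
  | ite _ P Q => P.imem ++ Q.imem
  | loop _ P => P.imem

/-- The banks of the data memory written by a program. -/
def rmem : Prog → List ℕ
  | skip => []
  | op (.rstore k _ _) => [k]
  | op _ => []
  | seq P Q => P.rmem ++ Q.rmem
  | ite _ P Q => P.rmem ++ Q.rmem
  | loop _ P => P.rmem

/-- A bound on the running time of a program without loops. -/
def cost : Prog → ℕ
  | skip => 1
  | op _ => 1
  | seq P Q => P.cost + Q.cost
  | ite _ P Q => max P.cost Q.cost + 1
  | loop _ _ => 0

def LoopFree : Prog → Bool
  | skip => true
  | op _ => true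
  | seq P Q => P.LoopFree && Q.LoopFree
  | ite _ P Q => P.LoopFree && Q.LoopFree
  | loop _ _ => false

/-- The weakest precondition of a program without loops. -/
def Pre : Prog → (State → Prop) → State → Prop
  | skip, Q, s => Q s
  | op c, Q, s => Q (c.apply s)
  | seq P R, Q, s => P.Pre (R.Pre Q) s
  | ite b P R, Q, s => (b.Holds s → P.Pre Q s) ∧ (¬ b.Holds s → R.Pre Q s)
  | loop _ _, _, _ => False

end Prog

/-- `s'` agrees with `s` except for what `P` may write. -/
structure SameOn (P : Prog) (s s' : State) : Prop where
  ireg : ∀ r ∉ P.ireg, s'.ireg r = s.ireg r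
  rreg : ∀ r ∉ P.rreg, s'.rreg r = s.rreg r
  imem : ∀ k ∉ P.imem, s'.imem k = s.imem k
  rmem : ∀ k ∉ P.rmem, s'.rmem k = s.rmem k

theorem SameOn.refl (P : Prog) (s : State) : SameOn P s s :=
  ⟨fun _ _ => rfl, fun _ _ => rfl, fun _ _ => rfl, fun _ _ => rfl⟩

theorem SameOn.trans {P : Prog} {s s' s'' : State} (h : SameOn P s s') (h' : SameOn P s' s'') :
    SameOn P s s'' :=
  ⟨fun r hr => (h'.ireg r hr).trans (h.ireg r hr), fun r hr => (h'.rreg r hr).trans (h.rreg r hr),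
    fun r hr => (h'.imem r hr).trans (h.imem r hr), fun r hr => (h'.rmem r hr).trans (h.rmem r hr)⟩

theorem SameOn.mono {P Q : Prog} {s s' : State} (h : SameOn P s s') (hi : P.ireg ⊆ Q.ireg)
    (hr : P.rreg ⊆ Q.rreg) (him : P.imem ⊆ Q.imem) (hrm : P.rmem ⊆ Q.rmem) : SameOn Q s s' :=
  ⟨fun r hn => h.ireg r fun h' => hn (hi h'), fun r hn => h.rreg r fun h' => hn (hr h'),
    fun r hn => h.imem r fun h' => hn (him h'), fun r hn => h.rmem r fun h' => hn (hrm h')⟩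

/-- A frame rule read off the syntax: what the text of a program does not write stays unchanged. For
concrete programs, preservation becomes a decidable question of list membership. -/
theorem Exec.sameOn {P : Prog} {s s' : State} {t : ℕ} (h : Exec P s t s') : SameOn P s s' := by
  induction h with
  | skip s => exact SameOn.refl _ _
  | op c s =>
    refine ⟨fun r hr => ?_, fun r hr => ?_, fun r hr => ?_, fun r hr => ?_⟩ <;>
      cases c <;>
      simp_all [Prog.ireg, Prog.rreg, Prog.imem, Prog.rmem, Instr.apply, State.setI, State.setR,
        State.writeI, State.writeR]
  | seq _ _ ih1 ih2 =>
    refine (ih1.mono ?_ ?_ ?_ ?_).trans (ih2.mono ?_ ?_ ?_ ?_) <;>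
      simp [Prog.ireg, Prog.rreg, Prog.imem, Prog.rmem]
  | ite_true _ _ ih =>
    refine ih.mono ?_ ?_ ?_ ?_ <;> simp [Prog.ireg, Prog.rreg, Prog.imem, Prog.rmem]
  | ite_false _ _ ih =>
    refine ih.mono ?_ ?_ ?_ ?_ <;> simp [Prog.ireg, Prog.rreg, Prog.imem, Prog.rmem]
  | loop_done _ => exact SameOn.refl _ _
  | loop_step _ _ _ ih1 ih2 =>
    refine SameOn.trans (ih1.mono ?_ ?_ ?_ ?_) ih2 <;> exact List.Subset.refl _

namespace WP

variable {P R : Prog} {s : State} {T T' : ℕ} {Q Q' : State → Prop}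

/-- The frame rule is handed to the postcondition, so specifications only need to say what a program
computes. -/
theorem mono (h : WP P s T Q) (hT : T ≤ T') (hQ : ∀ s', SameOn P s s' → Q s' → Q' s') :
    WP P s T' Q' := by
  obtain ⟨t, s', h1, h2, h3⟩ := h
  exact ⟨t, s', h1, h2.trans hT, hQ s' h1.sameOn h3⟩

theorem skip (h : Q s) (hT : 1 ≤ T) : WP Prog.skip s T Q := ⟨1, s, Exec.skip s, hT, h⟩

theorem op {c : Instr} (h : Q (c.apply s)) (hT : 1 ≤ T) : WP (Prog.op c) s T Q :=
  ⟨1, _, Exec.op c s, hT, h⟩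

theorem seq {T₁ T₂ : ℕ} (h : WP P s T₁ fun s' => SameOn P s s' → WP R s' T₂ Q)
    (hT : T₁ + T₂ ≤ T) : WP (Prog.seq P R) s T Q := by
  obtain ⟨t, s', h1, h2, h3⟩ := h
  obtain ⟨t', s'', h4, h5, h6⟩ := h3 h1.sameOn
  exact ⟨t + t', s'', Exec.seq h1 h4, by omega, h6⟩

theorem ite {b : Test} (h1 : b.Holds s → WP P s T Q) (h2 : ¬ b.Holds s → WP R s T Q)
    (hT : T + 1 ≤ T') : WP (Prog.ite b P R) s T' Q := by
  by_cases hb : b.Holds s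
  · obtain ⟨t, s', h3, h4, h5⟩ := h1 hb
    exact ⟨t + 1, s', Exec.ite_true hb h3, by omega, h5⟩
  · obtain ⟨t, s', h3, h4, h5⟩ := h2 hb
    exact ⟨t + 1, s', Exec.ite_false hb h3, by omega, h5⟩

/-- Code without loops is verified by unfolding `Pre`; in `cost` the dearer branch of a conditional
counts. -/
theorem of_pre (hP : P.LoopFree = true) (h : P.Pre Q s) : WP P s P.cost Q := by
  induction P generalizing s Q with
  | skip => exact skip h le_rfl
  | op c => exact op h le_rfl
  | seq P R ih1 ih2 =>
    simp only [Prog.LoopFree, Bool.and_eq_true] at hP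
    exact seq ((ih1 hP.1 h).mono le_rfl fun s' _ h' _ => ih2 hP.2 h') le_rfl
  | ite b P R ih1 ih2 =>
    simp only [Prog.LoopFree, Bool.and_eq_true] at hP
    exact ite (fun hb => (ih1 hP.1 (h.1 hb)).mono (le_max_left _ _) fun _ _ h => h)
      (fun hb => (ih2 hP.2 (h.2 hb)).mono (le_max_right _ _) fun _ _ h => h) le_rfl
  | loop b P => simp [Prog.LoopFree] at hP

/-- A loop whose number of iterations is known. -/
theorem loop_count {b : Test} (N : ℕ) (I : ℕ → State → Prop) (c : ℕ → ℕ) (h0 : I 0 s)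
    (hstep : ∀ k < N, ∀ s', SameOn P s s' → I k s' → b.Holds s' ∧ WP P s' (c k) (I (k + 1)))
    (hend : ∀ s', SameOn P s s' → I N s' → ¬ b.Holds s') :
    WP (Prog.loop b P) s (∑ k ∈ Finset.range N, (c k + 1) + 1) (I N) := by
  -- Induction on the number `j` of rounds still to come.
  have key : ∀ j ≤ N, ∀ s', SameOn P s s' → I (N - j) s' →
      WP (Prog.loop b P) s' (∑ k ∈ Finset.Ico (N - j) N, (c k + 1) + 1) (I N) := by
    intro j
    induction j with
    | zero =>
      intro _ s' hs hI
      exact ⟨1, s', Exec.loop_done (hend s' hs hI), by simp, hI⟩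
    | succ j ih =>
      intro hj s' hs hI
      obtain ⟨hb, t, s'', h1, h2, h3⟩ := hstep (N - (j + 1)) (by omega) s' hs hI
      rw [show N - (j + 1) + 1 = N - j by omega] at h3
      obtain ⟨t', s₃, h4, h5, h6⟩ := ih (by omega) s'' (hs.trans h1.sameOn) h3
      refine ⟨t + t' + 1, s₃, Exec.loop_step hb h1 h4, ?_, h6⟩
      rw [Finset.sum_eq_sum_Ico_succ_bot (by omega), show N - (j + 1) + 1 = N - j by omega]
      omega
  simpa using key N le_rfl s (SameOn.refl _ _) (by simpa using h0)

/-- A loop whose number of iterations is bounded by a variant `μ`. -/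
theorem loop_variant {b : Test} (I : State → Prop) (μ : State → ℕ) (c : ℕ) (h0 : I s)
    (hstep : ∀ s', SameOn P s s' → I s' → b.Holds s' → WP P s' c fun s'' => I s'' ∧ μ s'' < μ s') :
    WP (Prog.loop b P) s (μ s * (c + 1) + 1) fun s' => I s' ∧ ¬ b.Holds s' := by
  have key : ∀ m, ∀ s', SameOn P s s' → I s' → μ s' ≤ m →
      WP (Prog.loop b P) s' (m * (c + 1) + 1) fun s' => I s' ∧ ¬ b.Holds s' := by
    intro m
    induction m with
    | zero =>
      intro s' hs hI hm
      by_cases hb : b.Holds s'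
      · obtain ⟨t, s'', -, -, -, h⟩ := hstep s' hs hI hb
        omega
      · exact ⟨1, s', Exec.loop_done hb, by simp, hI, hb⟩
    | succ m ih =>
      intro s' hs hI hm
      by_cases hb : b.Holds s'
      · obtain ⟨t, s'', h1, h2, h3, h4⟩ := hstep s' hs hI hb
        obtain ⟨t', s₃, h5, h6, h7⟩ := ih s'' (hs.trans h1.sameOn) h3 (by omega)
        exact ⟨t + t' + 1, s₃, Exec.loop_step hb h1 h5, by rw [Nat.succ_mul]; omega, h7⟩
      · exact ⟨1, s', Exec.loop_done hb, by simp, hI, hb⟩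
  exact key _ s (SameOn.refl _ _) h0 le_rfl

end WP

infixr:60 " ;; " => Prog.seq

/-- `for i = 0, …, n - 1`, where the index registers `0` and `2` hold `n` and `1`. -/
def forNodes (i : ℕ) (P : Prog) : Prog :=
  .op (.iconst i 0) ;; .loop (.ilt i 0) (P ;; .op (.iadd i i 2))

/-- Each round pays for the body, the increment and the test; the initial assignment and the last
test give the final `2`. By `hI` the invariant must not depend on the counter register, which the
increment overwrites. -/
theorem WP.forNodes {i n : ℕ} {P : Prog} {s : State} (I : ℕ → State → Prop) (c : ℕ → ℕ)
    (hi0 : i ≠ 0) (hi2 : i ≠ 2) (hP : ∀ r ∈ [i, 0, 2], r ∉ P.ireg) (hn : s.ireg 0 = n)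
    (h1 : s.ireg 2 = 1) (hI : ∀ k s' x, I k s' → I k (s'.setI i x)) (h0 : I 0 s)
    (hstep : ∀ k < n, ∀ s', SameOn (Stackelberg.forNodes i P) s s' → s'.ireg i = k → I k s' →
      WP P s' (c k) (I (k + 1))) :
    WP (Stackelberg.forNodes i P) s (∑ k ∈ Finset.range n, (c k + 2) + 2) (I n) := by
  have hset : SameOn (Stackelberg.forNodes i P) s (s.setI i 0) :=
    (Exec.op (.iconst i 0) s).sameOn.mono (by simp [Prog.ireg, Stackelberg.forNodes])
      (by simp [Prog.rreg]) (by simp [Prog.imem]) (by simp [Prog.rmem])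
  have hsub : ∀ {s₁ s₂ : State}, SameOn (P ;; .op (.iadd i i 2)) s₁ s₂ →
      SameOn (Stackelberg.forNodes i P) s₁ s₂ := fun h =>
    h.mono (by simp [Prog.ireg, Stackelberg.forNodes]) (by simp [Prog.rreg, Stackelberg.forNodes])
      (by simp [Prog.imem, Stackelberg.forNodes]) (by simp [Prog.rmem, Stackelberg.forNodes])
  have hp : ∀ r, r = 0 ∨ r = 2 → r ∉ (P ;; .op (.iadd i i 2)).ireg := by
    intro r hr
    have : r ∉ P.ireg := hP r (by rcases hr with rfl | rfl <;> simp)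
    have : r ≠ i := by rcases hr with rfl | rfl <;> exact Ne.symm ‹_›
    simp [Prog.ireg, *]
  have h0' : (s.setI i 0).ireg 0 = n := by
    simp [State.setI, Function.update_of_ne hi0.symm, hn]
  have h2' : (s.setI i 0).ireg 2 = 1 := by
    simp [State.setI, Function.update_of_ne hi2.symm, h1]
  refine WP.seq (T₁ := 1) (WP.op (fun _ => ?_) le_rfl)
    (T₂ := ∑ k ∈ Finset.range n, (c k + 2) + 1) (by omega)
  refine (WP.loop_count n (fun k s' => s'.ireg i = k ∧ I k s') (fun k => c k + 1)
    ⟨by simp [State.setI], hI _ _ _ h0⟩ ?_ ?_).mono le_rfl fun s' _ h => h.2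
  · rintro k hk s' hs ⟨hik, hIk⟩
    have e0 := (hs.ireg 0 (hp 0 (Or.inl rfl))).trans h0'
    have e2 := (hs.ireg 2 (hp 2 (Or.inr rfl))).trans h2'
    refine ⟨by simp only [Test.Holds]; omega, ?_⟩
    refine WP.seq ((hstep k hk s' (hset.trans (hsub hs)) hik hIk).mono le_rfl fun s'' hs'' h'' hsm =>
      WP.op ?_ le_rfl) le_rfl
    have f1 := hs''.ireg i (hP i (by simp))
    have f2 := hs''.ireg 2 (hP 2 (by simp))
    refine ⟨?_, hI _ _ _ h''⟩
    simp only [Instr.apply, State.setI, Function.update_self]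
    omega
  · rintro s' hs ⟨hik, -⟩
    have e0 := (hs.ireg 0 (hp 0 (Or.inl rfl))).trans h0'
    simp only [Test.Holds]
    omega

open GameTree

/-! ### The tables

Index registers `0`, `1`, `2`, `7` hold the number of nodes, the root, `1` and `0`. Data registers
`0`, `1` hold bounds for the leader's payoffs. The index memory banks are `0` parent, `1` owner,
`2` number of children not yet processed, `3` queue, `4` leaf flag, `5` a worst child for the
leader, `6` marks; the data memory banks are `0`, `1` payoffs, `2`, `3` output, `4` maximin values,
`5` the least value of a child other than the worst one, `6` the least value of a sibling. -/

/-- The part of the state that no phase of the program changes. -/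
structure Env {n : ℕ} (G : GameTree n) (UL UF : G.Leaf → ℝ) (s : State) : Prop where
  card : s.ireg 0 = n
  root : s.ireg 1 = G.root
  one : s.ireg 2 = 1
  zero : s.ireg 7 = 0
  parent : ∀ v : Fin n, s.imem 0 v = G.parent v
  owner : ∀ v : Fin n, s.imem 1 v = G.ownerCode v
  payoff : ∀ v : Fin n, s.rmem 0 v = payoffCode UL v
  payoff' : ∀ v : Fin n, s.rmem 1 v = payoffCode UF v

variable {n : ℕ} {G : GameTree n} {UL UF : G.Leaf → ℝ} {s s' : State}

theorem Env.same (h : Env G UL UF s) {P : Prog} (hs : SameOn P s s')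
    (hi : ∀ r ∈ [0, 1, 2, 7], r ∉ P.ireg) (hm : ∀ k ∈ [0, 1], k ∉ P.imem ∧ k ∉ P.rmem) :
    Env G UL UF s' where
  card := (hs.ireg 0 (hi 0 (by simp))).trans h.card
  root := (hs.ireg 1 (hi 1 (by simp))).trans h.root
  one := (hs.ireg 2 (hi 2 (by simp))).trans h.one
  zero := (hs.ireg 7 (hi 7 (by simp))).trans h.zero
  parent v := by rw [hs.imem 0 (hm 0 (by simp)).1, h.parent]
  owner v := by rw [hs.imem 1 (hm 1 (by simp)).1, h.owner]
  payoff v := by rw [hs.rmem 0 (hm 0 (by simp)).2, h.payoff]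
  payoff' v := by rw [hs.rmem 1 (hm 1 (by simp)).2, h.payoff']

attribute [local simp] Prog.Pre Instr.apply Test.Holds State.setI State.setR State.writeI
  State.writeR Function.update_apply

theorem sum_const_range (n c : ℕ) : ∑ _k ∈ Finset.range n, c = n * c := by simp

theorem card_filter_lt_succ (A : Finset (Fin n)) (w : Fin n) :
    (A.filter fun x => x.1 < w.1 + 1).card =
      (A.filter fun x => x.1 < w.1).card + if w ∈ A then 1 else 0 := by
  have : A.filter (fun x => x.1 < w.1 + 1) =
      A.filter (fun x => x.1 < w.1) ∪ A.filter (fun x => x = w) := by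
    ext x
    simp only [Finset.mem_filter, Finset.mem_union, Fin.ext_iff]
    constructor
    · rintro ⟨h1, h2⟩
      rcases Nat.lt_succ_iff_lt_or_eq.1 h2 with h | h
      exacts [Or.inl ⟨h1, h⟩, Or.inr ⟨h1, h⟩]
    · rintro (⟨h1, h2⟩ | ⟨h1, h2⟩)
      exacts [⟨h1, by omega⟩, ⟨h1, by omega⟩]
  rw [this, Finset.card_union_of_disjoint, Finset.filter_eq']
  · split_ifs <;> simp
  · rw [Finset.disjoint_filter]
    rintro x _ h1 rfl
    exact lt_irrefl _ h1

/-- Counts the children of all nodes. -/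
def countChildren : Prog := forNodes 3 (
  .ite (.ieq 3 1) .skip (
    .op (.iload 4 0 3) ;; .op (.iload 5 2 4) ;; .op (.iadd 5 5 2) ;; .op (.istore 2 4 5)))

/-- The root has to be skipped: it is its own parent without being a child of itself. -/
theorem countChildren_spec (h : Env G UL UF s) (hc : ∀ v : Fin n, s.imem 2 v = 0) :
    WP countChildren s (7 * n + 2) fun s' => ∀ v : Fin n, s'.imem 2 v = (G.children v).card := by
  let I : ℕ → State → Prop := fun k s' =>
    ∀ v : Fin n, s'.imem 2 v = ((G.children v).filter fun w => w.1 < k).card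
  refine (WP.forNodes (n := n) I (fun _ => 5) (by decide) (by decide) (by decide) h.card h.one
    (fun _ _ _ h => h) (by simp [I, hc]) ?_).mono ?_ ?_
  · rintro k hk s' hs hi hI
    have e := h.same hs (by decide) (by decide)
    obtain ⟨w, rfl⟩ : ∃ w : Fin n, w.1 = k := ⟨⟨k, hk⟩, rfl⟩
    refine (WP.of_pre (by decide) ?_).mono (by decide) fun _ _ h => h
    simp only [Prog.Pre, Test.Holds, hi, e.root, Fin.val_inj]
    refine ⟨fun hr v => ?_, fun hr v => ?_⟩
    · rw [card_filter_lt_succ, hI v, if_neg (hr ▸ G.root_notMem_children v), add_zero]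
    · rw [card_filter_lt_succ, ← hI v]
      simp only [G.mem_children]
      simp [hi, e.one, e.parent, hr, Fin.val_inj, eq_comm]
      split_ifs with h <;> simp [h]
  · rw [sum_const_range]; omega
  · intro s' hs hI v
    rw [hI, Finset.filter_true_of_mem fun w _ => w.2]

/-- Computes bounds for the payoffs of the leader. -/
def boundPayoffs : Prog := forNodes 3 (
  .op (.rload 2 0 3) ;;
  .ite (.rlt 2 0) (.op (.rmove 0 2)) .skip ;;
  .ite (.rlt 1 2) (.op (.rmove 1 2)) .skip)

/-- Nothing is asked of the initial contents of the two registers: updates only widen the interval,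
and any interval containing the payoffs will do. -/
theorem boundPayoffs_spec (h : Env G UL UF s) :
    WP boundPayoffs s (7 * n + 2) fun s' =>
      ∀ v : Fin n, s'.rreg 0 ≤ payoffCode UL v ∧ payoffCode UL v ≤ s'.rreg 1 := by
  let I : ℕ → State → Prop := fun k s' =>
    ∀ v : Fin n, v.1 < k → s'.rreg 0 ≤ payoffCode UL v ∧ payoffCode UL v ≤ s'.rreg 1
  refine (WP.forNodes (n := n) I (fun _ => 5) (by decide) (by decide) (by decide) h.card h.one
    (fun _ _ _ h => h) (by simp [I]) ?_).mono ?_ fun s' _ hI v => hI v v.2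
  · rintro k hk s' hs hi hI
    have e := h.same hs (by decide) (by decide)
    obtain ⟨w, rfl⟩ : ∃ w : Fin n, w.1 = k := ⟨⟨k, hk⟩, rfl⟩
    refine (WP.of_pre (by decide) ?_).mono (by decide) fun _ _ h => h
    simp only [Prog.Pre, I, Nat.lt_succ_iff_lt_or_eq, Fin.val_inj]
    simp [hi, e.payoff]
    grind
  · rw [sum_const_range]; omega

/-- The first `m` cells of `q` hold the nodes with property `E`, each of them once. -/
structure Queue (q : ℕ → ℕ) (m : ℕ) (E : Fin n → Prop) : Prop where
  node : ∀ j < m, ∃ v : Fin n, q j = v ∧ E v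
  index : ∀ v, E v → ∃ j < m, q j = v
  inj : ∀ i < m, ∀ j < m, q i = q j → i = j

theorem Queue.congr {q : ℕ → ℕ} {m : ℕ} {E E' : Fin n → Prop} (h : Queue q m E)
    (hE : ∀ v, E v ↔ E' v) : Queue q m E' := by
  have : E = E' := funext fun v => propext (hE v)
  exact this ▸ h

theorem Queue.push {q : ℕ → ℕ} {m : ℕ} {E : Fin n → Prop} (h : Queue q m E) {v : Fin n}
    (hv : ¬ E v) : Queue (Function.update q m v) (m + 1) fun w => E w ∨ w = v := by
  have hold : ∀ j < m, Function.update q m v j = q j := fun j hj =>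
    Function.update_of_ne hj.ne _ _
  have hnew : ∀ j < m, q j ≠ v := by
    intro j hj hq
    obtain ⟨w, h1, h2⟩ := h.node j hj
    have : w = v := Fin.ext (h1.symm.trans hq)
    exact hv (this ▸ h2)
  constructor
  · intro j hj
    rcases Nat.lt_succ_iff_lt_or_eq.1 hj with hj | rfl
    · obtain ⟨w, h1, h2⟩ := h.node j hj
      exact ⟨w, (hold j hj).trans h1, Or.inl h2⟩
    · exact ⟨v, Function.update_self _ _ _, Or.inr rfl⟩
  · rintro w (hw | rfl)
    · obtain ⟨j, hj, h1⟩ := h.index w hw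
      exact ⟨j, by omega, (hold j hj).trans h1⟩
    · exact ⟨m, by omega, Function.update_self _ _ _⟩
  · intro i hi j hj hij
    rcases Nat.lt_succ_iff_lt_or_eq.1 hi with hi | rfl <;>
      rcases Nat.lt_succ_iff_lt_or_eq.1 hj with hj | rfl
    · rw [hold i hi, hold j hj] at hij
      exact h.inj i hi j hj hij
    · rw [hold i hi, Function.update_self] at hij
      exact absurd hij (hnew i hi)
    · rw [hold j hj, Function.update_self] at hij
      exact absurd hij.symm (hnew j hj)
    · rfl

/-- The entries are distinct nodes. This bounds the number of rounds of `peel`. -/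
theorem Queue.le_card {q : ℕ → ℕ} {m : ℕ} {E : Fin n → Prop} (h : Queue q m E) : m ≤ n := by
  choose f hf using fun j : Fin m => h.node j.1 j.2
  have hinj : Function.Injective f := by
    intro i j hij
    refine Fin.ext (h.inj i i.2 j j.2 ?_)
    rw [(hf i).1, (hf j).1, hij]
  simpa using Fintype.card_le_of_injective f hinj

/-- Initializes the tables and puts the leaves into the queue. -/
def initTables : Prog :=
  .op (.iconst 6 0) ;; forNodes 3 (
    .op (.iload 4 2 3) ;; .op (.rstore 5 3 1) ;;
    .ite (.ieq 4 7) (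
      .op (.rload 2 0 3) ;; .op (.rstore 4 3 2) ;; .op (.istore 4 3 2) ;;
      .op (.istore 3 6 3) ;; .op (.iadd 6 6 2)) (
      .op (.istore 4 3 7) ;; .op (.iload 5 1 3) ;;
      .ite (.ieq 5 2) (.op (.rstore 4 3 1)) (.op (.rstore 4 3 0))))

/-- The tables when the nodes below `k` have been initialized. -/
structure InitInv (G : GameTree n) (UL : G.Leaf → ℝ) (A B : ℝ) (k : ℕ) (s : State) : Prop where
  queue : Queue (s.imem 3) (s.ireg 6) fun v : Fin n => G.children v = ∅ ∧ v.1 < k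
  flag : ∀ v : Fin n, v.1 < k → s.imem 4 v = if G.children v = ∅ then 1 else 0
  value : ∀ v : Fin n, v.1 < k → s.rmem 4 v =
    if G.children v = ∅ then payoffCode UL v else if G.IsF v then B else A
  second : ∀ v : Fin n, v.1 < k → s.rmem 5 v = B

/-- Running minima at the follower's nodes start from the upper bound `B`, running maxima at the
leader's nodes from the lower bound `A`. -/
theorem initTables_spec (h : Env G UL UF s)
    (hc : ∀ v : Fin n, s.imem 2 v = (G.children v).card) :
    WP initTables s (12 * n + 3) (InitInv G UL (s.rreg 0) (s.rreg 1) n) := by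
  refine WP.seq (T₁ := 1) (WP.op (fun hs₀ => ?_) le_rfl) (T₂ := 12 * n + 2) (by omega)
  have h' := h.same hs₀ (by decide) (by decide)
  refine (WP.forNodes (n := n) (InitInv G UL (s.rreg 0) (s.rreg 1)) (fun _ => 10)
    (by decide) (by decide) (by decide) h'.card h'.one ?_ ?_ ?_).mono ?_ fun _ _ h => h
  · rintro k s' x ⟨h1, h2, h3, h4⟩
    exact ⟨by simpa using h1, h2, h3, h4⟩
  · constructor
    · constructor <;> simp
    all_goals simp
  · rintro k hk s' hs hi hI
    have e := h'.same hs (by decide) (by decide)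
    have hA : s'.rreg 0 = s.rreg 0 := hs.rreg 0 (by decide)
    have hB : s'.rreg 1 = s.rreg 1 := hs.rreg 1 (by decide)
    have hc' : ∀ v : Fin n, s'.imem 2 v = (G.children v).card := by
      rw [hs.imem 2 (by decide)]; exact hc
    obtain ⟨w, rfl⟩ : ∃ w : Fin n, w.1 = k := ⟨⟨k, hk⟩, rfl⟩
    refine (WP.of_pre (by decide) ?_).mono (by decide) fun _ _ h => h
    simp only [Prog.Pre, Test.Holds]
    have hsplit : ∀ v : Fin n, v.1 < w.1 + 1 → (v.1 < w.1 ∧ v ≠ w) ∨ v = w := by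
      intro v hv
      rcases Nat.lt_succ_iff_lt_or_eq.1 hv with h | h
      exacts [Or.inl ⟨h, fun h' => h.ne (congrArg Fin.val h')⟩, Or.inr (Fin.ext h)]
    have hsame : G.children w ≠ ∅ →
        Queue (s'.imem 3) (s'.ireg 6) fun v : Fin n => G.children v = ∅ ∧ v.1 < w.1 + 1 := by
      intro hw
      refine hI.queue.congr fun v => and_congr_right fun hv => ⟨fun h => by omega, fun h => ?_⟩
      rcases hsplit v h with h | rfl
      exacts [h.1, absurd hv hw]
    refine ⟨fun hz => ?_, fun hz => ⟨fun hF => ?_, fun hF => ?_⟩⟩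
    · have hw : G.children w = ∅ := by simpa [hi, hc', e.zero] using hz
      constructor
      · have hq : Queue (Function.update (s'.imem 3) (s'.ireg 6) w) (s'.ireg 6 + 1)
            fun v : Fin n => G.children v = ∅ ∧ v.1 < w.1 + 1 := by
          refine (hI.queue.push (v := w) (by simp)).congr fun v => ⟨?_, ?_⟩
          · rintro (⟨h1, h2⟩ | rfl)
            exacts [⟨h1, by omega⟩, ⟨hw, by omega⟩]
          · rintro ⟨h1, h2⟩
            exact (hsplit v h2).imp (fun h => ⟨h1, h.1⟩) id
        simpa [hi, e.one] using hq
      all_goals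
        intro v hv
        rcases hsplit v hv with ⟨hlt, hne⟩ | rfl
      · simp [hi, Fin.val_inj, hne, hI.flag v hlt]
      · simp [hi, hw, e.one]
      · simp [hi, Fin.val_inj, hne, hI.value v hlt]
      · simp [hi, hw, e.payoff]
      · simp [hi, Fin.val_inj, hne, hI.second v hlt]
      · simp [hi, hB]
    all_goals
      have hw : G.children w ≠ ∅ := by simpa [hi, hc', e.zero] using hz
      have hF' := hF
      simp [hi, e.one, e.owner] at hF'
      constructor
      · simpa using hsame hw
      all_goals
        intro v hv
        rcases hsplit v hv with ⟨hlt, hne⟩ | rfl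
      · simp [hi, Fin.val_inj, hne, hI.flag v hlt]
      · simp [hi, hw, e.zero]
      · simp [hi, Fin.val_inj, hne, hI.value v hlt]
      · simp [hi, hw, hF', hA, hB]
      · simp [hi, Fin.val_inj, hne, hI.second v hlt]
      · simp [hi, hB]
  · rw [sum_const_range]; omega

namespace RootedTree

variable {T : RootedTree n} {F : Fin n → Prop} [DecidablePred F]

/-- Bounds on the payoffs bound all maximin values, so these starting values cannot distort the
result. -/
theorem maximin_mem_Icc {u : Fin n → ℝ} {A B : ℝ} (h : ∀ v, A ≤ u v ∧ u v ≤ B) (v : Fin n) :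
    A ≤ T.maximin F u v ∧ T.maximin F u v ≤ B := by
  induction v using T.induction_children with
  | h v ih =>
    rcases (T.children v).eq_empty_or_nonempty with hv | hv
    · rw [maximin_leaf hv]
      exact h v
    · have : ∃ w ∈ T.children v, T.maximin F u v = T.maximin F u w := by
        by_cases hF : F v
        exacts [(maximin_follower hv hF).2, (maximin_leader hv hF).2]
      obtain ⟨w, hw, he⟩ := this
      rw [he]
      exact ih w hw

end RootedTree

/-- Takes the next node from the queue and updates the tables at its parent. -/
def peelStep : Prog :=
  .op (.iload 4 3 3) ;;
  .ite (.ieq 4 1) .skip (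
    .op (.iload 5 0 4) ;; .op (.rload 2 4 4) ;; .op (.rload 3 4 5) ;; .op (.iload 8 1 5) ;;
    .ite (.ieq 8 2) (.ite (.rlt 2 3) (.op (.rstore 4 5 2)) .skip)
      (.ite (.rlt 3 2) (.op (.rstore 4 5 2)) .skip) ;;
    .op (.iload 9 2 5) ;; .op (.isub 9 9 2) ;; .op (.istore 2 5 9) ;;
    .ite (.ieq 9 7) (.op (.istore 3 6 5) ;; .op (.iadd 6 6 2)) .skip) ;;
  .op (.iadd 3 3 2)

/-- Backward induction along the queue. -/
def peel : Prog := .op (.iconst 3 0) ;; .loop (.ilt 3 6) peelStep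

theorem peelStep_spec (e : Env G UL UF s) {v : Fin n} (hv : s.imem 3 (s.ireg 3) = v) :
    WP peelStep s 20 fun s' => s'.ireg 3 = s.ireg 3 + 1 ∧
      (v = G.root → s'.ireg 6 = s.ireg 6 ∧ s'.imem 2 = s.imem 2 ∧ s'.imem 3 = s.imem 3 ∧
        s'.rmem 4 = s.rmem 4) ∧
      (v ≠ G.root →
        (∀ w : Fin n, s'.imem 2 w = s.imem 2 w - if w = G.parent v then 1 else 0) ∧
        (∀ w : Fin n, s'.rmem 4 w = if w = G.parent v then
          (if G.IsF w then min (s.rmem 4 w) (s.rmem 4 v) else max (s.rmem 4 w) (s.rmem 4 v))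
          else s.rmem 4 w) ∧
        (s.imem 2 (G.parent v) - 1 = 0 → s'.ireg 6 = s.ireg 6 + 1 ∧
          s'.imem 3 = Function.update (s.imem 3) (s.ireg 6) (G.parent v)) ∧
        (s.imem 2 (G.parent v) - 1 ≠ 0 → s'.ireg 6 = s.ireg 6 ∧ s'.imem 3 = s.imem 3)) := by
  refine (WP.of_pre (by decide) ?_).mono (by decide) fun _ _ h => h
  by_cases hr : v = G.root
  · simp [peelStep, hv, e.root, hr, e.one]
  · by_cases hF : G.ownerCode (G.parent v) = 1 <;>
      by_cases hz : s.imem 2 (G.parent v) - 1 = 0 <;>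
      simp [peelStep, hv, e.root, hr, e.one, e.zero, e.parent, e.owner, hF, Fin.val_inj, hz]
    all_goals
      refine ⟨fun hl => ⟨fun w => ?_, ?_⟩, fun hl => ⟨fun w => ?_, ?_⟩⟩ <;>
        grind

/-- The tables when the nodes in `D` have been processed. -/
structure PeelInv (G : GameTree n) (UL : G.Leaf → ℝ) (A B : ℝ) (D : Fin n → Prop)
    [DecidablePred D] (s : State) : Prop where
  le : s.ireg 3 ≤ s.ireg 6
  processed : ∀ v, D v ↔ ∃ j < s.ireg 3, s.imem 3 j = v
  queue : Queue (s.imem 3) (s.ireg 6) fun v : Fin n => ∀ w ∈ G.children v, D w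
  count : ∀ v : Fin n, s.imem 2 v = ((G.children v).filter fun w => ¬ D w).card
  leaf : ∀ v : Fin n, G.children v = ∅ → s.rmem 4 v = payoffCode UL v
  follower : ∀ v : Fin n, (G.children v).Nonempty → G.IsF v →
    (∀ w ∈ G.children v, D w → s.rmem 4 v ≤ G.maximin G.IsF (payoffCode UL) w) ∧
    (s.rmem 4 v = B ∨
      ∃ w ∈ G.children v, D w ∧ s.rmem 4 v = G.maximin G.IsF (payoffCode UL) w)
  leader : ∀ v : Fin n, (G.children v).Nonempty → ¬ G.IsF v →
    (∀ w ∈ G.children v, D w → G.maximin G.IsF (payoffCode UL) w ≤ s.rmem 4 v) ∧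
    (s.rmem 4 v = A ∨
      ∃ w ∈ G.children v, D w ∧ s.rmem 4 v = G.maximin G.IsF (payoffCode UL) w)
  done : ∀ v : Fin n, D v → s.rmem 4 v = G.maximin G.IsF (payoffCode UL) v

section

variable {A B : ℝ} {D : Fin n → Prop} [DecidablePred D]

open Stackelberg.RootedTree in
theorem PeelInv.value_eq (h : PeelInv G UL A B D s)
    (hAB : ∀ v, A ≤ payoffCode UL v ∧ payoffCode UL v ≤ B) {v : Fin n}
    (hv : ∀ w ∈ G.children v, D w) : s.rmem 4 v = G.maximin G.IsF (payoffCode UL) v := by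
  rcases (G.children v).eq_empty_or_nonempty with hc | hc
  · rw [h.leaf v hc, maximin_leaf hc]
  · have hb := maximin_mem_Icc (T := G.toRootedTree) (F := G.IsF) hAB v
    by_cases hF : G.IsF v
    · obtain ⟨h1, h2⟩ := h.follower v hc hF
      obtain ⟨h3, w, hw, h4⟩ := maximin_follower (u := payoffCode UL) hc hF
      apply le_antisymm
      · rw [h4]; exact h1 w hw (hv w hw)
      · rcases h2 with h2 | ⟨w', hw', -, h2⟩
        · rw [h2]; exact hb.2
        · rw [h2]; exact h3 w' hw'
    · obtain ⟨h1, h2⟩ := h.leader v hc hF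
      obtain ⟨h3, w, hw, h4⟩ := maximin_leader (u := payoffCode UL) hc hF
      apply le_antisymm
      · rcases h2 with h2 | ⟨w', hw', -, h2⟩
        · rw [h2]; exact hb.1
        · rw [h2]; exact h3 w' hw'
      · rw [h4]; exact h1 w hw (hv w hw)

/-- Processing the head `v` of the queue affects at most the entries of its parent. The parent is
enqueued exactly when `v` was its last unprocessed child, so the queue keeps listing the nodes all
of whose children are processed. -/
theorem PeelInv.step (h : PeelInv G UL A B D s)
    (hAB : ∀ v, A ≤ payoffCode UL v ∧ payoffCode UL v ≤ B) (e : Env G UL UF s)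
    (hlt : s.ireg 3 < s.ireg 6) :
    WP peelStep s 20 fun s' => ∃ (D' : Fin n → Prop) (_ : DecidablePred D'),
      PeelInv G UL A B D' s' ∧ s'.ireg 3 = s.ireg 3 + 1 := by
  obtain ⟨v, hqv, hv⟩ := h.queue.node _ hlt
  have hDv : ¬ D v := by
    intro hD
    obtain ⟨j, hj, hqj⟩ := (h.processed v).1 hD
    have := h.queue.inj j (by omega) _ hlt (hqj.trans hqv.symm)
    omega
  have hval := h.value_eq hAB hv
  refine (peelStep_spec e hqv).mono le_rfl ?_
  rintro s' - ⟨h3, hroot, hnroot⟩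
  refine ⟨fun w => D w ∨ w = v, inferInstance, ?_, h3⟩
  have hproc : s'.imem 3 = s.imem 3 ∨
      (∃ p : Fin n, s'.imem 3 = Function.update (s.imem 3) (s.ireg 6) p) →
      ∀ w, (D w ∨ w = v) ↔ ∃ j < s'.ireg 3, s'.imem 3 j = w := by
    intro hm w
    have hold : ∀ j < s.ireg 6, s'.imem 3 j = s.imem 3 j := by
      intro j hj
      rcases hm with hm | ⟨p, hm⟩
      · rw [hm]
      · rw [hm, Function.update_of_ne hj.ne]
    rw [h3]
    constructor
    · rintro (hD | rfl)
      · obtain ⟨j, hj, hq⟩ := (h.processed w).1 hD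
        exact ⟨j, by omega, by rw [hold j (by omega), hq]⟩
      · exact ⟨s.ireg 3, by omega, by rw [hold _ hlt, hqv]⟩
    · rintro ⟨j, hj, hq⟩
      rcases Nat.lt_succ_iff_lt_or_eq.1 hj with hj | rfl
      · rw [hold j (by omega)] at hq
        exact Or.inl ((h.processed w).2 ⟨j, hj, hq⟩)
      · rw [hold _ hlt, hqv] at hq
        exact Or.inr (Fin.ext hq.symm)
  have hor : ∀ y : Fin n, v ∉ G.children y → ∀ w ∈ G.children y, ((D w ∨ w = v) ↔ D w) := by
    intro y hy w hw
    refine ⟨?_, Or.inl⟩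
    rintro (hD | rfl)
    exacts [hD, absurd hw hy]
  have hcount : ∀ y : Fin n, v ∉ G.children y →
      (G.children y).filter (fun w => ¬ (D w ∨ w = v)) = (G.children y).filter fun w => ¬ D w :=
    fun y hy => Finset.filter_congr fun w hw => not_congr (hor y hy w hw)
  by_cases hr : v = G.root
  · obtain ⟨h6, hm2, hm3, hm4⟩ := hroot hr
    have hnc : ∀ y, v ∉ G.children y := fun y => hr ▸ G.root_notMem_children y
    constructor
    · omega
    · exact hproc (Or.inl hm3)
    · rw [hm3, h6]
      exact h.queue.congr fun y => forall₂_congr fun w hw => (hor y (hnc y) w hw).symm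
    · intro y
      rw [hm2, h.count, hcount y (hnc y)]
    · rw [hm4]; exact h.leaf
    · intro y hy hF
      rw [hm4]
      obtain ⟨h1, h2⟩ := h.follower y hy hF
      refine ⟨fun w hw hD => h1 w hw ((hor y (hnc y) w hw).1 hD), h2.imp id ?_⟩
      rintro ⟨w, hw, hD, h3⟩
      exact ⟨w, hw, Or.inl hD, h3⟩
    · intro y hy hF
      rw [hm4]
      obtain ⟨h1, h2⟩ := h.leader y hy hF
      refine ⟨fun w hw hD => h1 w hw ((hor y (hnc y) w hw).1 hD), h2.imp id ?_⟩
      rintro ⟨w, hw, hD, h3⟩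
      exact ⟨w, hw, Or.inl hD, h3⟩
    · rintro y (hD | rfl)
      · rw [hm4, h.done y hD]
      · rw [hm4, hval]
  · obtain ⟨hm2, hm4, hq0, hq1⟩ := hnroot hr
    have hvp := G.mem_children_parent hr
    have hnc : ∀ y, y ≠ G.parent v → v ∉ G.children y := fun y hy hm =>
      hy (G.mem_children.1 hm).2.symm
    have hnp : ¬ ∀ w ∈ G.children (G.parent v), D w := fun hall => hDv (hall v hvp)
    have hDE : ∀ y, D y → ∀ w ∈ G.children y, D w := by
      intro y hy
      obtain ⟨j, hj, hq⟩ := (h.processed y).1 hy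
      obtain ⟨y', h1, h2⟩ := h.queue.node j (by omega)
      have : y' = y := Fin.ext (h1.symm.trans hq)
      exact this ▸ h2
    have hpv : G.parent v ≠ v := by
      intro hp
      rw [hp] at hvp
      exact RootedTree.not_below_of_mem_children hvp (RootedTree.Below.refl _)
    have hcp : ((G.children (G.parent v)).filter fun w => ¬ (D w ∨ w = v)).card =
        s.imem 2 (G.parent v) - 1 := by
      rw [h.count, ← Finset.card_erase_of_mem (Finset.mem_filter.2 ⟨hvp, hDv⟩)]
      congr 1
      ext w
      simp only [Finset.mem_filter, Finset.mem_erase]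
      tauto
    have hm4' : ∀ y : Fin n, y ≠ G.parent v → s'.rmem 4 y = s.rmem 4 y := fun y hy => by
      rw [hm4, if_neg hy]
    constructor
    · by_cases hz : s.imem 2 (G.parent v) - 1 = 0
      · have := (hq0 hz).1; omega
      · have := (hq1 hz).1; omega
    · apply hproc
      by_cases hz : s.imem 2 (G.parent v) - 1 = 0
      exacts [Or.inr ⟨_, (hq0 hz).2⟩, Or.inl (hq1 hz).2]
    · by_cases hz : s.imem 2 (G.parent v) - 1 = 0
      · rw [(hq0 hz).1, (hq0 hz).2]
        refine (h.queue.push hnp).congr fun y => ?_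
        by_cases hy : y = G.parent v
        · subst hy
          rw [← hcp, Finset.card_eq_zero, Finset.filter_eq_empty_iff] at hz
          exact ⟨fun _ w hw => not_not.1 (hz hw), fun _ => Or.inr rfl⟩
        · simp only [hy, or_false]
          exact forall₂_congr fun w hw => (hor y (hnc y hy) w hw).symm
      · rw [(hq1 hz).1, (hq1 hz).2]
        refine h.queue.congr fun y => ?_
        by_cases hy : y = G.parent v
        · subst hy
          rw [← hcp, Finset.card_eq_zero, Finset.filter_eq_empty_iff] at hz
          refine ⟨fun hall => absurd hall hnp, fun hall => absurd ?_ hz⟩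
          exact fun w hw => not_not.2 (hall w hw)
        · exact forall₂_congr fun w hw => (hor y (hnc y hy) w hw).symm
    · intro y
      by_cases hy : y = G.parent v
      · subst hy
        rw [hm2, if_pos rfl, hcp]
      · rw [hm2, if_neg hy, hcount y (hnc y hy), h.count, Nat.sub_zero]
    · intro y hy
      have : y ≠ G.parent v := by rintro rfl; rw [hy] at hvp; simp at hvp
      rw [hm4' y this, h.leaf y hy]
    · intro y hy hF
      obtain ⟨h1, h2⟩ := h.follower y hy hF
      by_cases hyp : y = G.parent v
      · subst hyp
        rw [hm4, if_pos rfl, if_pos hF, hval]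
        refine ⟨?_, ?_⟩
        · rintro w hw (hD | rfl)
          exacts [(min_le_left _ _).trans (h1 w hw hD), min_le_right _ _]
        · rcases min_choice (s.rmem 4 (G.parent v)) (G.maximin G.IsF (payoffCode UL) v) with h4 | h4
          · rw [h4]
            refine h2.imp id ?_
            rintro ⟨w, hw, hD, h5⟩
            exact ⟨w, hw, Or.inl hD, h5⟩
          · exact Or.inr ⟨v, hvp, Or.inr rfl, h4⟩
      · rw [hm4' y hyp]
        refine ⟨fun w hw hD => h1 w hw ((hor y (hnc y hyp) w hw).1 hD), h2.imp id ?_⟩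
        rintro ⟨w, hw, hD, h5⟩
        exact ⟨w, hw, Or.inl hD, h5⟩
    · intro y hy hF
      obtain ⟨h1, h2⟩ := h.leader y hy hF
      by_cases hyp : y = G.parent v
      · subst hyp
        rw [hm4, if_pos rfl, if_neg hF, hval]
        refine ⟨?_, ?_⟩
        · rintro w hw (hD | rfl)
          exacts [(h1 w hw hD).trans (le_max_left _ _), le_max_right _ _]
        · rcases max_choice (s.rmem 4 (G.parent v)) (G.maximin G.IsF (payoffCode UL) v) with h4 | h4
          · rw [h4]
            refine h2.imp id ?_
            rintro ⟨w, hw, hD, h5⟩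
            exact ⟨w, hw, Or.inl hD, h5⟩
          · exact Or.inr ⟨v, hvp, Or.inr rfl, h4⟩
      · rw [hm4' y hyp]
        refine ⟨fun w hw hD => h1 w hw ((hor y (hnc y hyp) w hw).1 hD), h2.imp id ?_⟩
        rintro ⟨w, hw, hD, h5⟩
        exact ⟨w, hw, Or.inl hD, h5⟩
    · rintro y (hD | rfl)
      · have : y ≠ G.parent v := fun hy => hnp (hy ▸ hDE y hD)
        rw [hm4' y this, h.done y hD]
      · rw [hm4' y hpv.symm, hval]

end

theorem peel_spec (e : Env G UL UF s) {A B : ℝ}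
    (hAB : ∀ v, A ≤ payoffCode UL v ∧ payoffCode UL v ≤ B)
    (hc : ∀ v : Fin n, s.imem 2 v = (G.children v).card) (hI : InitInv G UL A B n s) :
    WP peel s (21 * n + 2) fun s' =>
      ∀ v : Fin n, s'.rmem 4 v = G.maximin G.IsF (payoffCode UL) v := by
  refine WP.seq (T₁ := 1) (WP.op (fun hs₀ => ?_) le_rfl) (T₂ := 21 * n + 1) (by omega)
  have e' := e.same hs₀ (by decide) (by decide)
  have hinit : PeelInv G UL A B (fun _ => False) ((Instr.iconst 3 0).apply s) := by
    constructor
    · simp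
    · simp
    · refine (hI.queue.congr fun v => ?_ : Queue (s.imem 3) (s.ireg 6) _)
      rw [Finset.eq_empty_iff_forall_notMem]
      simp
    · intro v
      simpa using hc v
    · intro v hv
      exact (hI.value v v.2).trans (if_pos hv)
    · intro v hv hF
      refine ⟨fun _ _ h => h.elim, Or.inl ?_⟩
      refine (hI.value v v.2).trans ?_
      rw [if_neg hv.ne_empty, if_pos hF]
    · intro v hv hF
      refine ⟨fun _ _ h => h.elim, Or.inl ?_⟩
      refine (hI.value v v.2).trans ?_
      rw [if_neg hv.ne_empty, if_neg hF]
    · exact fun _ h => h.elim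
  refine (WP.loop_variant (fun s' => ∃ (D : Fin n → Prop) (_ : DecidablePred D),
    PeelInv G UL A B D s') (fun s' => n - s'.ireg 3) 20 ⟨_, inferInstance, hinit⟩ ?_).mono ?_ ?_
  · rintro s' hs ⟨D, _, h⟩ hlt
    have e'' := e'.same hs (by decide) (by decide)
    refine (h.step hAB e'' hlt).mono le_rfl ?_
    rintro s'' - ⟨D', _, h', h3⟩
    -- The queue has at most `n` entries, so the position of its head is below `n` and the variant
    -- decreases.
    have := h.queue.le_card
    simp only [Test.Holds] at hlt
    exact ⟨⟨D', _, h'⟩, by omega⟩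
  · simp only [Instr.apply, State.setI, Function.update_self]
    omega
  · rintro s' - ⟨⟨D, _, h⟩, hlt⟩ v
    simp only [Test.Holds, not_lt] at hlt
    have heq : s'.ireg 3 = s'.ireg 6 := le_antisymm h.le hlt
    refine h.done v ?_
    -- In an exhausted queue every node whose children are processed is itself processed; induction
    -- from the leaves reaches all nodes.
    induction v using G.induction_children with
    | h v ih =>
      obtain ⟨j, hj, hq⟩ := h.queue.index v ih
      exact (h.processed v).2 ⟨j, by omega, hq⟩

/-- Finds for each decision node a child with the same maximin value, if there is one. -/
def findWorst : Prog := forNodes 3 (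
  .ite (.ieq 3 1) .skip (
    .op (.iload 4 0 3) ;; .op (.rload 2 4 3) ;; .op (.rload 3 4 4) ;;
    .ite (.req 2 3) (.op (.istore 5 4 3)) .skip))

/-- A later child may overwrite an earlier one, which is harmless: any child attaining the value
will do. -/
theorem findWorst_spec (h : Env G UL UF s)
    (hM : ∀ v : Fin n, s.rmem 4 v = G.maximin G.IsF (payoffCode UL) v) :
    WP findWorst s (8 * n + 2) fun s' => ∀ v : Fin n, (G.children v).Nonempty →
      ∃ w ∈ G.children v, s'.imem 5 v = w ∧
        G.maximin G.IsF (payoffCode UL) w = G.maximin G.IsF (payoffCode UL) v := by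
  let I : ℕ → State → Prop := fun k s' => ∀ v : Fin n,
    (∃ w ∈ G.children v, w.1 < k ∧
      G.maximin G.IsF (payoffCode UL) w = G.maximin G.IsF (payoffCode UL) v) →
    ∃ w ∈ G.children v, s'.imem 5 v = w ∧
      G.maximin G.IsF (payoffCode UL) w = G.maximin G.IsF (payoffCode UL) v
  refine (WP.forNodes (n := n) I (fun _ => 6) (by decide) (by decide) (by decide) h.card h.one
    (fun _ _ _ h => h) (by simp [I]) ?_).mono ?_ ?_
  · rintro k hk s' hs hi hI
    have e := h.same hs (by decide) (by decide)
    have hM' : ∀ v : Fin n, s'.rmem 4 v = G.maximin G.IsF (payoffCode UL) v := by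
      rw [hs.rmem 4 (by decide)]; exact hM
    obtain ⟨w, rfl⟩ : ∃ w : Fin n, w.1 = k := ⟨⟨k, hk⟩, rfl⟩
    refine (WP.of_pre (by decide) ?_).mono (by decide) fun _ _ h => h
    have hold : (¬ ∃ v, w ∈ G.children v ∧
        G.maximin G.IsF (payoffCode UL) w = G.maximin G.IsF (payoffCode UL) v) →
        I (w.1 + 1) s' := by
      rintro hno v ⟨x, hx, hlt, heq⟩
      rcases Nat.lt_succ_iff_lt_or_eq.1 hlt with hlt | hxw
      · exact hI v ⟨x, hx, hlt, heq⟩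
      · have := Fin.ext hxw
        subst this
        exact absurd ⟨v, hx, heq⟩ hno
    simp only [Prog.Pre, Test.Holds]
    refine ⟨fun hr => hold ?_, fun hr => ⟨fun heq => ?_, fun hne => hold ?_⟩⟩
    · have hr' : w = G.root := Fin.ext (by simpa [hi, e.root] using hr)
      rintro ⟨v, hv, -⟩
      exact G.root_notMem_children v (hr' ▸ hv)
    · have hr' : w ≠ G.root := fun h => hr (by simp [hi, e.root, h])
      have hw := G.mem_children_parent hr'
      simp [hi, e.parent, hM'] at heq
      rintro v ⟨x, hx, hlt, hxv⟩
      by_cases hv : v = G.parent w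
      · subst hv
        exact ⟨w, hw, by simp [hi, e.parent], heq⟩
      · obtain ⟨y, hy, h1, h2⟩ := hI v ⟨x, hx, by
          rcases Nat.lt_succ_iff_lt_or_eq.1 hlt with hlt | hxw
          · exact hlt
          · exact absurd ((G.mem_children.1 hx).2.symm.trans
              (congrArg G.parent (Fin.ext hxw))) hv, hxv⟩
        exact ⟨y, hy, by simpa [hi, e.parent, Fin.val_inj, hv] using h1, h2⟩
    · rintro ⟨v, hv, heq⟩
      obtain ⟨-, rfl⟩ := G.mem_children.1 hv
      simp [hi, e.parent, hM'] at hne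
      exact hne heq
  · rw [sum_const_range]; omega
  · intro s' _ hI v hv
    have : ∃ w ∈ G.children v,
        G.maximin G.IsF (payoffCode UL) v = G.maximin G.IsF (payoffCode UL) w := by
      by_cases hF : G.IsF v
      exacts [(RootedTree.maximin_follower hv hF).2, (RootedTree.maximin_leader hv hF).2]
    obtain ⟨w, hw, heq⟩ := this
    exact hI v ⟨w, hw, w.2, heq.symm⟩

/-- Finds for each decision node the least value of a child other than the selected one. -/
def findSecond : Prog := forNodes 3 (
  .ite (.ieq 3 1) .skip (
    .op (.iload 4 0 3) ;; .op (.iload 5 5 4) ;;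
    .ite (.ieq 5 3) .skip (
      .op (.rload 2 4 3) ;; .op (.rload 3 5 4) ;;
      .ite (.rlt 2 3) (.op (.rstore 5 4 2)) .skip)))

theorem findSecond_spec (h : Env G UL UF s) {B : ℝ}
    (hM : ∀ v : Fin n, s.rmem 4 v = G.maximin G.IsF (payoffCode UL) v)
    (hS : ∀ v : Fin n, s.rmem 5 v = B) :
    WP findSecond s (10 * n + 2) fun s' => ∀ v : Fin n,
      (∀ w ∈ G.children v, s.imem 5 v ≠ w →
        s'.rmem 5 v ≤ G.maximin G.IsF (payoffCode UL) w) ∧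
      (s'.rmem 5 v = B ∨ ∃ w ∈ G.children v, s.imem 5 v ≠ w ∧
        s'.rmem 5 v = G.maximin G.IsF (payoffCode UL) w) := by
  let I : ℕ → State → Prop := fun k s' => ∀ v : Fin n,
      (∀ w ∈ G.children v, w.1 < k → s.imem 5 v ≠ w →
        s'.rmem 5 v ≤ G.maximin G.IsF (payoffCode UL) w) ∧
      (s'.rmem 5 v = B ∨ ∃ w ∈ G.children v, s.imem 5 v ≠ w ∧
        s'.rmem 5 v = G.maximin G.IsF (payoffCode UL) w)
  refine (WP.forNodes (n := n) I (fun _ => 8) (by decide) (by decide) (by decide) h.card h.one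
    (fun _ _ _ h => h) (by simp [I, hS]) ?_).mono ?_ fun s' _ hI v =>
      ⟨fun w hw => (hI v).1 w hw w.2, (hI v).2⟩
  · rintro k hk s' hs hi hI
    have e := h.same hs (by decide) (by decide)
    have hM' : ∀ v : Fin n, s'.rmem 4 v = G.maximin G.IsF (payoffCode UL) v := by
      rw [hs.rmem 4 (by decide)]; exact hM
    have hA := hs.imem 5 (by decide)
    obtain ⟨w, rfl⟩ : ∃ w : Fin n, w.1 = k := ⟨⟨k, hk⟩, rfl⟩
    refine (WP.of_pre (by decide) ?_).mono (by decide) fun _ _ h => h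
    have hold : (∀ v, w ∈ G.children v → s.imem 5 v ≠ w →
        s'.rmem 5 v ≤ G.maximin G.IsF (payoffCode UL) w) → I (w.1 + 1) s' := by
      intro hno v
      refine ⟨fun x hx hlt hxa => ?_, (hI v).2⟩
      rcases Nat.lt_succ_iff_lt_or_eq.1 hlt with hlt | hxw
      · exact (hI v).1 x hx hlt hxa
      · have := Fin.ext hxw
        subst this
        exact hno v hx hxa
    simp only [Prog.Pre, Test.Holds]
    refine ⟨fun hr => hold ?_, fun hr => ⟨fun ha => hold ?_, fun ha => ⟨fun hlt => ?_,
      fun hlt => hold ?_⟩⟩⟩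
    · have hr' : w = G.root := Fin.ext (by simpa [hi, e.root] using hr)
      intro v hv
      exact absurd (hr' ▸ hv) (G.root_notMem_children v)
    · intro v hv hne
      obtain ⟨-, rfl⟩ := G.mem_children.1 hv
      simp [hi, e.parent, hA] at ha
      exact absurd ha hne
    · have hr' : w ≠ G.root := fun h => hr (by simp [hi, e.root, h])
      have hw := G.mem_children_parent hr'
      simp [hi, e.parent, hA] at ha
      simp [hi, e.parent, hM'] at hlt
      intro v
      by_cases hv : v = G.parent w
      · subst hv
        refine ⟨fun x hx hxk hxa => ?_, Or.inr ⟨w, hw, ha, by simp [hi, e.parent, hM']⟩⟩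
        suffices G.maximin G.IsF (payoffCode UL) w ≤ G.maximin G.IsF (payoffCode UL) x by
          simpa [hi, e.parent, hM'] using this
        rcases Nat.lt_succ_iff_lt_or_eq.1 hxk with hxk | hxw
        · exact hlt.le.trans ((hI _).1 x hx hxk hxa)
        · rw [Fin.ext hxw]
      · have hwv : w ∉ G.children v := fun hm => hv (G.mem_children.1 hm).2.symm
        refine ⟨fun x hx hxk hxa => ?_, ?_⟩
        · have := (hI v).1 x hx (by
            rcases Nat.lt_succ_iff_lt_or_eq.1 hxk with hxk | hxw
            · exact hxk
            · exact absurd (Fin.ext hxw ▸ hx) hwv) hxa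
          simpa [hi, e.parent, Fin.val_inj, hv] using this
        · simpa [hi, e.parent, Fin.val_inj, hv] using (hI v).2
    · intro v hv hne
      obtain ⟨-, rfl⟩ := G.mem_children.1 hv
      simpa [hi, e.parent, hM'] using hlt
  · rw [sum_const_range]; omega

/-- `th w` is the least value of a sibling of `w`, if the follower moves at their parent, and `B`
if there is no such node. -/
def IsThreatTable (G : GameTree n) (UL : G.Leaf → ℝ) (B : ℝ) (th : ℕ → ℝ) : Prop :=
  ∀ w : Fin n, (∀ v, w ∈ G.children v → G.IsF v → ∀ x ∈ G.children v, x ≠ w →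
      th w ≤ G.maximin G.IsF (payoffCode UL) x) ∧
    (th w = B ∨ ∃ v, G.IsF v ∧ w ∈ G.children v ∧ ∃ x ∈ G.children v, x ≠ w ∧
      th w = G.maximin G.IsF (payoffCode UL) x)

/-- Finds for each node the least value of a sibling. -/
def findThreats : Prog := forNodes 3 (
  .op (.rstore 6 3 1) ;;
  .ite (.ieq 3 1) .skip (
    .op (.iload 4 0 3) ;; .op (.iload 5 1 4) ;;
    .ite (.ieq 5 2) (
      .op (.iload 5 5 4) ;;
      .ite (.ieq 5 3) (.op (.rload 2 5 4)) (.op (.rload 2 4 4)) ;;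
      .op (.rstore 6 3 2)) .skip))

/-- For the selected child, the least value of a sibling is the stored second value. For any other
child the selected one is itself a sibling and attains the minimum, so the value of the parent is
used. Each entry thus costs constant time. -/
theorem findThreats_spec (h : Env G UL UF s)
    (hM : ∀ v : Fin n, s.rmem 4 v = G.maximin G.IsF (payoffCode UL) v)
    (hW : ∀ v : Fin n, (G.children v).Nonempty →
      ∃ w ∈ G.children v, s.imem 5 v = w ∧
        G.maximin G.IsF (payoffCode UL) w = G.maximin G.IsF (payoffCode UL) v)
    (hS : ∀ v : Fin n, (∀ w ∈ G.children v, s.imem 5 v ≠ w →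
        s.rmem 5 v ≤ G.maximin G.IsF (payoffCode UL) w) ∧
      (s.rmem 5 v = s.rreg 1 ∨ ∃ w ∈ G.children v, s.imem 5 v ≠ w ∧
        s.rmem 5 v = G.maximin G.IsF (payoffCode UL) w)) :
    WP findThreats s (12 * n + 2) fun s' => IsThreatTable G UL (s.rreg 1) (s'.rmem 6) := by
  let p : ℝ → Fin n → Prop := fun y w =>
    (∀ v, w ∈ G.children v → G.IsF v → ∀ x ∈ G.children v, x ≠ w →
      y ≤ G.maximin G.IsF (payoffCode UL) x) ∧
    (y = s.rreg 1 ∨ ∃ v, G.IsF v ∧ w ∈ G.children v ∧ ∃ x ∈ G.children v, x ≠ w ∧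
      y = G.maximin G.IsF (payoffCode UL) x)
  let I : ℕ → State → Prop := fun k s' => ∀ w : Fin n, w.1 < k → p (s'.rmem 6 w) w
  refine (WP.forNodes (n := n) I (fun _ => 10) (by decide) (by decide) (by decide) h.card h.one
    (fun _ _ _ h => h) (by simp [I]) ?_).mono ?_ fun s' _ hI w => hI w w.2
  · rintro k hk s' hs hi hI
    have e := h.same hs (by decide) (by decide)
    have hM' := hs.rmem 4 (by decide)
    have hA := hs.imem 5 (by decide)
    have hS' := hs.rmem 5 (by decide)
    have hB := hs.rreg 1 (by decide)
    obtain ⟨w, rfl⟩ : ∃ w : Fin n, w.1 = k := ⟨⟨k, hk⟩, rfl⟩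
    refine (WP.of_pre (by decide) ?_).mono (by decide) fun _ _ h => h
    have hnew : ∀ s'' : State, (∀ a, s''.rmem 6 a = if a = w.1 then s''.rmem 6 w.1 else
        s'.rmem 6 a) → p (s''.rmem 6 w.1) w → I (w.1 + 1) s'' := by
      intro s'' h1 h2 x hx
      rcases Nat.lt_succ_iff_lt_or_eq.1 hx with hx | hx
      · have := h1 x.1
        rw [if_neg hx.ne] at this
        rw [this]
        exact hI x hx
      · rw [Fin.ext hx]
        exact h2
    have hpB : (∀ v, w ∈ G.children v → ¬ G.IsF v) → p (s.rreg 1) w :=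
      fun hno => ⟨fun v hv hF => absurd hF (hno v hv), Or.inl rfl⟩
    simp only [Prog.Pre, Test.Holds]
    refine ⟨fun hr => hnew _ ?_ ?_, fun hr => ⟨fun hF => ⟨fun ha => hnew _ ?_ ?_,
      fun ha => hnew _ ?_ ?_⟩, fun hF => hnew _ ?_ ?_⟩⟩
    · intro a; simp [hi]
    · have hr' : w = G.root := Fin.ext (by simpa [hi, e.root] using hr)
      have := hpB fun v hv => absurd (hr' ▸ hv) (G.root_notMem_children v)
      simpa [hi, hB] using this
    · intro a; simp [hi]
    · have hr' : w ≠ G.root := fun h => hr (by simp [hi, e.root, h])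
      have hw := G.mem_children_parent hr'
      simp [hi, e.parent, hA] at ha
      simp [hi, e.parent, e.owner, e.one] at hF
      suffices p (s.rmem 5 (G.parent w)) w by simpa [hi, e.parent, hS'] using this
      obtain ⟨h1, h2⟩ := hS (G.parent w)
      refine ⟨fun v hv _ x hx hne => ?_, h2.imp id ?_⟩
      · obtain ⟨-, rfl⟩ := G.mem_children.1 hv
        exact h1 x hx (by rw [ha]; exact fun h => hne (Fin.ext h.symm))
      · rintro ⟨x, hx, hne, heq⟩
        exact ⟨_, hF, hw, x, hx, fun h => hne (by rw [ha, h]), heq⟩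
    · intro a; simp [hi]
    · have hr' : w ≠ G.root := fun h => hr (by simp [hi, e.root, h])
      have hw := G.mem_children_parent hr'
      simp [hi, e.parent, hA] at ha
      simp [hi, e.parent, e.owner, e.one] at hF
      suffices p (G.maximin G.IsF (payoffCode UL) (G.parent w)) w by
        simpa [hi, e.parent, hM', hM] using this
      obtain ⟨x, hx, hax, heq⟩ := hW _ ⟨w, hw⟩
      refine ⟨fun v hv hF' y hy _ => ?_, Or.inr ⟨_, hF, hw, x, hx, ?_, heq.symm⟩⟩
      · obtain ⟨-, rfl⟩ := G.mem_children.1 hv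
        exact (RootedTree.maximin_follower ⟨_, hy⟩ hF').1 y hy
      · rintro rfl
        exact ha hax
    · intro a; simp [hi]
    · simp [hi, e.parent, e.owner, e.one] at hF
      have := hpB fun v hv => by
        obtain ⟨-, rfl⟩ := G.mem_children.1 hv
        exact hF
      simpa [hi, hB] using this
  · rw [sum_const_range]; omega

/-- Computes all tables. -/
def prepare : Prog :=
  .op (.iconst 2 1) ;; countChildren ;; boundPayoffs ;; initTables ;; peel ;; findWorst ;;
  findSecond ;; findThreats ;; .op (.rload 7 4 1)

/-- All tables have been computed. -/
structure Ready (G : GameTree n) (UL UF : G.Leaf → ℝ) (s : State) : Prop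
    extends Env G UL UF s where
  flag : ∀ v : Fin n, s.imem 4 v = if G.children v = ∅ then 1 else 0
  value : ∀ v : Fin n, s.rmem 4 v = G.maximin G.IsF (payoffCode UL) v
  bound : ∀ v : Fin n, payoffCode UL v ≤ s.rreg 1
  threat : IsThreatTable G UL (s.rreg 1) (s.rmem 6)
  security : s.rreg 7 = G.maximin G.IsF (payoffCode UL) G.root

theorem Ready.same (h : Ready G UL UF s) {P : Prog} (hs : SameOn P s s')
    (hi : ∀ r ∈ [0, 1, 2, 7], r ∉ P.ireg) (hr : ∀ r ∈ [1, 7], r ∉ P.rreg)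
    (him : ∀ k ∈ [0, 1, 4], k ∉ P.imem) (hrm : ∀ k ∈ [0, 1, 4, 6], k ∉ P.rmem) :
    Ready G UL UF s' where
  toEnv := h.toEnv.same hs hi fun k hk =>
    ⟨him k (by simp at hk ⊢; omega), hrm k (by simp at hk ⊢; omega)⟩
  flag v := by rw [hs.imem 4 (him 4 (by simp)), h.flag]
  value v := by rw [hs.rmem 4 (hrm 4 (by simp)), h.value]
  bound v := by rw [hs.rreg 1 (hr 1 (by simp))]; exact h.bound v
  threat := by
    rw [hs.rreg 1 (hr 1 (by simp)), hs.rmem 6 (hrm 6 (by simp))]; exact h.threat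
  security := by rw [hs.rreg 7 (hr 7 (by simp))]; exact h.security

theorem prepare_spec (G : GameTree n) (UL UF : G.Leaf → ℝ) :
    WP prepare (G.input UL UF) (89 * n + 19) fun s => Ready G UL UF s ∧ s.ireg 13 = 0 ∧
      (∀ v : Fin n, s.imem 6 v = 0) ∧ ∀ v : Fin n, s.rmem 2 v = 0 := by
  suffices h : WP prepare (G.input UL UF) (89 * n + 19) (Ready G UL UF) by
    refine h.mono le_rfl fun s hs h => ⟨h, ?_, ?_, ?_⟩
    · rw [hs.ireg 13 (by decide)]; simp [input]
    · rw [hs.imem 6 (by decide)]; simp [input]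
    · rw [hs.rmem 2 (by decide)]; simp [input]
  refine WP.seq (T₁ := 1) (T₂ := 89 * n + 18) (WP.op (fun hs₀ => ?_) le_rfl) (by omega)
  have e₀ : Env G UL UF ((Instr.iconst 2 1).apply (G.input UL UF)) := by
    constructor <;> simp [input]
  have hc₀ : ∀ v : Fin n, ((Instr.iconst 2 1).apply (G.input UL UF)).imem 2 v = 0 := by
    simp [input]
  refine WP.seq (T₂ := 82 * n + 16) ((countChildren_spec e₀ hc₀).mono le_rfl
    fun s₁ hs₁ hc₁ _ => ?_) (by omega)
  have e₁ := e₀.same hs₁ (by decide) (by decide)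
  refine WP.seq (T₂ := 75 * n + 14) ((boundPayoffs_spec e₁).mono le_rfl
    fun s₂ hs₂ hb₂ _ => ?_) (by omega)
  have e₂ := e₁.same hs₂ (by decide) (by decide)
  have hc₂ : ∀ v : Fin n, s₂.imem 2 v = (G.children v).card := by
    rw [hs₂.imem 2 (by decide)]; exact hc₁
  refine WP.seq (T₂ := 63 * n + 11) ((initTables_spec e₂ hc₂).mono le_rfl
    fun s₃ hs₃ hI₃ _ => ?_) (by omega)
  have e₃ := e₂.same hs₃ (by decide) (by decide)
  have hc₃ : ∀ v : Fin n, s₃.imem 2 v = (G.children v).card := by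
    rw [hs₃.imem 2 (by decide)]; exact hc₂
  refine WP.seq (T₂ := 42 * n + 9) ((peel_spec e₃ hb₂ hc₃ hI₃).mono le_rfl
    fun s₄ hs₄ hM₄ _ => ?_) (by omega)
  have e₄ := e₃.same hs₄ (by decide) (by decide)
  refine WP.seq (T₂ := 34 * n + 7) ((findWorst_spec e₄ hM₄).mono le_rfl
    fun s₅ hs₅ hW₅ _ => ?_) (by omega)
  have e₅ := e₄.same hs₅ (by decide) (by decide)
  have hM₅ : ∀ v : Fin n, s₅.rmem 4 v = G.maximin G.IsF (payoffCode UL) v := by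
    rw [hs₅.rmem 4 (by decide)]; exact hM₄
  have hS₅ : ∀ v : Fin n, s₅.rmem 5 v = s₂.rreg 1 := by
    rw [hs₅.rmem 5 (by decide), hs₄.rmem 5 (by decide)]
    exact fun v => hI₃.second v v.2
  refine WP.seq (T₂ := 24 * n + 5) ((findSecond_spec e₅ hM₅ hS₅).mono le_rfl
    fun s₆ hs₆ hS₆ _ => ?_) (by omega)
  have e₆ := e₅.same hs₆ (by decide) (by decide)
  have hM₆ : ∀ v : Fin n, s₆.rmem 4 v = G.maximin G.IsF (payoffCode UL) v := by
    rw [hs₆.rmem 4 (by decide)]; exact hM₅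
  have hB₆ : s₆.rreg 1 = s₂.rreg 1 := by
    rw [hs₆.rreg 1 (by decide), hs₅.rreg 1 (by decide), hs₄.rreg 1 (by decide),
      hs₃.rreg 1 (by decide)]
  refine WP.seq (T₂ := 1) ((findThreats_spec e₆ hM₆ (by rw [hs₆.imem 5 (by decide)]; exact hW₅)
    (by rw [hs₆.imem 5 (by decide), hB₆]; exact hS₆)).mono le_rfl
    fun s₇ hs₇ hT₇ _ => ?_) (by omega)
  have e₇ := e₆.same hs₇ (by decide) (by decide)
  have hM₇ : ∀ v : Fin n, s₇.rmem 4 v = G.maximin G.IsF (payoffCode UL) v := by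
    rw [hs₇.rmem 4 (by decide)]; exact hM₆
  have hB₇ : s₇.rreg 1 = s₂.rreg 1 := by rw [hs₇.rreg 1 (by decide), hB₆]
  have h4 : s₇.imem 4 = s₃.imem 4 := by
    rw [hs₇.imem 4 (by decide), hs₆.imem 4 (by decide), hs₅.imem 4 (by decide),
      hs₄.imem 4 (by decide)]
  refine WP.op ?_ le_rfl
  constructor
  · constructor
    exacts [e₇.card, e₇.root, e₇.one, e₇.zero, e₇.parent, e₇.owner, e₇.payoff, e₇.payoff']
  · intro v
    exact (congrFun h4 v).trans (hI₃.flag v v.2)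
  · exact hM₇
  · intro v
    simpa [hB₇] using (hb₂ v).2
  · simpa [hB₇, hB₆] using hT₇
  · simp [e₇.root, hM₇]

/-! ### Walks to the root -/

/-- Sets the index register `d` to `0` or `1` according to whether `a` and `b` are equal. -/
def neq (d a b : ℕ) : Prog := .ite (.ieq a b) (.op (.imove d 7)) (.op (.imove d 2))

/-- Marks the ancestors of the node in the index register `a` with the stamp in register `16`. -/
def markPath (a : ℕ) : Prog :=
  (.op (.imove 17 a) ;; .op (.istore 6 17 16) ;; neq 20 17 1) ;;
  .loop (.ilt 7 20) (.op (.iload 17 0 17) ;; .op (.istore 6 17 16) ;; neq 20 17 1)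

open Classical in
-- After `j` rounds the node and its first `j` ancestors are stamped. The tests can express equality
-- and order but not inequality of nodes, so register `20` carries the answer as a flag.
theorem markPath_spec {a : ℕ} (h : Env G UL UF s) {v : Fin n} (hv : s.ireg a = v) :
    WP (markPath a) s (6 * G.depth v + 6) fun s' =>
      ∀ w : Fin n, s'.imem 6 w = if G.Below w v then s.ireg 16 else s.imem 6 w := by
  let I : ℕ → State → Prop := fun j s' => s'.ireg 17 = G.parent^[j] v ∧
    s'.ireg 16 = s.ireg 16 ∧ (s'.ireg 20 = if G.parent^[j] v = G.root then 0 else 1) ∧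
    ∀ w : Fin n, s'.imem 6 w = if ∃ i ≤ j, G.parent^[i] v = w then s.ireg 16 else s.imem 6 w
  have hpre : (Prog.op (.imove 17 a) ;; .op (.istore 6 17 16) ;; neq 20 17 1).Pre (I 0) s := by
    simp only [neq, Prog.Pre, Test.Holds]
    have hI4 : ∀ w : Fin n, (if (w : ℕ) = v then s.ireg 16 else s.imem 6 w) =
        if ∃ i ≤ 0, G.parent^[i] v = w then s.ireg 16 else s.imem 6 w := by
      intro w
      simp [Fin.val_inj, eq_comm]
    refine ⟨fun hr => ⟨?_, ?_, ?_, ?_⟩, fun hr => ⟨?_, ?_, ?_, ?_⟩⟩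
    · simp [hv]
    · simp
    · have : v = G.root := by simpa [hv, h.root, Fin.val_inj] using hr
      simp [h.zero, this]
    · simpa [hv] using hI4
    · simp [hv]
    · simp
    · have : v ≠ G.root := by simpa [hv, h.root, Fin.val_inj] using hr
      simp [h.one, this]
    · simpa [hv] using hI4
  refine WP.seq ((WP.of_pre rfl hpre).mono (T' := 4) (by simp [neq, Prog.cost]) ?_)
    (T₂ := 6 * G.depth v + 1) (by omega)
  · intro s₁ _ hI₁ hs₁
    have e₁ := h.same hs₁ (by simp [neq, Prog.ireg]) (by simp [neq, Prog.imem, Prog.rmem])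
    refine (WP.loop_count (G.depth v) I (fun _ => 4) hI₁ ?_ ?_).mono ?_ ?_
    · rintro k hk s' hs ⟨i17, i16, i20, im⟩
      have e := e₁.same hs (by decide) (by decide)
      have hne := RootedTree.iterate_ne_root hk
      rw [if_neg hne] at i20
      refine ⟨by simp [e.zero, i20], (WP.of_pre (by decide) ?_).mono (by decide) fun _ _ h => h⟩
      simp only [neq, Prog.Pre, Test.Holds]
      have hI4 : ∀ w : Fin n, (if (w : ℕ) = G.parent (G.parent^[k] v) then s.ireg 16 else
          s'.imem 6 w) =
          if ∃ i ≤ k + 1, G.parent^[i] v = w then s.ireg 16 else s.imem 6 w := by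
        intro w
        rw [im, ← Function.iterate_succ_apply' G.parent]
        have : (∃ i ≤ k + 1, G.parent^[i] v = w) ↔
            w = G.parent^[k + 1] v ∨ ∃ i ≤ k, G.parent^[i] v = w := by
          constructor
          · rintro ⟨i, hi, rfl⟩
            rcases Nat.le_succ_iff.1 hi with hi | rfl
            exacts [Or.inr ⟨i, hi, rfl⟩, Or.inl rfl]
          · rintro (rfl | ⟨i, hi, rfl⟩)
            exacts [⟨k + 1, le_rfl, rfl⟩, ⟨i, by omega, rfl⟩]
        simp only [this, Fin.val_inj]
        grind
      refine ⟨fun hr => ⟨?_, ?_, ?_, ?_⟩, fun hr => ⟨?_, ?_, ?_, ?_⟩⟩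
      · simp [i17, e.parent, Function.iterate_succ_apply']
      · simp [i16]
      · have : G.parent (G.parent^[k] v) = G.root := by
          simpa [i17, e.root, e.parent, Fin.val_inj] using hr
        rw [Function.iterate_succ_apply', if_pos this]
        simp [e.zero]
      · simpa [i17, e.parent, i16] using hI4
      · simp [i17, e.parent, Function.iterate_succ_apply']
      · simp [i16]
      · have : G.parent (G.parent^[k] v) ≠ G.root := by
          simpa [i17, e.root, e.parent, Fin.val_inj] using hr
        rw [Function.iterate_succ_apply', if_neg this]
        simp [e.one]
      · simpa [i17, e.parent, i16] using hI4
    · rintro s' hs ⟨-, -, i20, -⟩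
      have e := e₁.same hs (by decide) (by decide)
      rw [if_pos (G.iterate_depth v)] at i20
      simp [e.zero, i20]
    · rw [sum_const_range]; omega
    · rintro s' - ⟨-, -, -, im⟩ w
      rw [im]
      have : (∃ i ≤ G.depth v, G.parent^[i] v = w) ↔ G.Below w v := by
        constructor
        · rintro ⟨i, -, hi⟩
          exact ⟨i, hi⟩
        · rintro ⟨i, rfl⟩
          -- Beyond the depth the iterates stay at the root, which is already stamped.
          rcases le_total i (G.depth v) with hi | hi
          · exact ⟨i, hi, rfl⟩
          · refine ⟨G.depth v, le_rfl, ?_⟩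
            obtain ⟨j, rfl⟩ := Nat.exists_eq_add_of_le' hi
            rw [Function.iterate_add_apply, G.iterate_depth,
              Function.iterate_fixed G.parent_root]
      simp only [this]

/-- Moves from the node in the index register `a` to its first ancestor with the stamp in register
`16`, and keeps the last node without this stamp in register `19`. -/
def findJunction (a : ℕ) : Prog :=
  (.op (.imove 17 a) ;; .op (.imove 19 a) ;; .op (.iload 18 6 17)) ;;
  .loop (.ilt 18 16) (.op (.imove 19 17) ;; .op (.iload 17 0 17) ;; .op (.iload 18 6 17))

/-- The stamped nodes are the ancestors of `l`, so the loop runs `hit` times. Register `19` lags one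
step behind; the truncated `j - 1` reflects that at the start both registers hold `v`. -/
theorem findJunction_spec {a : ℕ} (ha : a ≠ 17) (h : Env G UL UF s) {v l : Fin n}
    (hv : s.ireg a = v) (hm : ∀ w : Fin n, s.imem 6 w < s.ireg 16 ↔ ¬ G.Below w l) :
    WP (findJunction a) s (4 * G.depth v + 4) fun s' =>
      s'.ireg 17 = G.junction l v ∧ s'.ireg 19 = G.branch l v := by
  let I : ℕ → State → Prop := fun j s' => s'.ireg 17 = G.parent^[j] v ∧
    s'.ireg 19 = G.parent^[j - 1] v ∧ s'.ireg 18 = s.imem 6 (G.parent^[j] v)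
  refine WP.seq (T₁ := 3) (T₂ := 4 * G.depth v + 1)
    ((WP.of_pre (Q := I 0) rfl (by simp [I, hv, ha])).mono le_rfl ?_) (by omega)
  intro s₁ _ hI₁ hs₁
  have e₁ := h.same hs₁ (by simp [Prog.ireg]) (by simp [Prog.imem, Prog.rmem])
  have i16 : s₁.ireg 16 = s.ireg 16 := hs₁.ireg 16 (by simp [Prog.ireg])
  have im : s₁.imem 6 = s.imem 6 := hs₁.imem 6 (by simp [Prog.imem])
  have hle : RootedTree.hit (T := G.toRootedTree) l v ≤ G.depth v := RootedTree.hit_le_depth l v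
  refine (WP.loop_count (RootedTree.hit (T := G.toRootedTree) l v) I (fun _ => 3) hI₁
    ?_ ?_).mono ?_ fun s' _ h => ⟨h.1, h.2.1⟩
  · rintro k hk s' hs ⟨i17, i19, i18⟩
    have e := e₁.same hs (by decide) (by decide)
    have j16 := (hs.ireg 16 (by decide)).trans i16
    have jm := (hs.imem 6 (by decide)).trans im
    refine ⟨?_, (WP.of_pre (by decide) ?_).mono (by decide) fun _ _ h => h⟩
    · simp only [Test.Holds, i18, j16, hm]
      exact RootedTree.not_below_of_lt_hit hk
    · simp [I, i17, e.parent, jm, Function.iterate_succ_apply']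
  · rintro s' hs ⟨-, -, i18⟩
    have j16 := (hs.ireg 16 (by decide)).trans i16
    simp only [Test.Holds, i18, j16, hm, not_not]
    exact RootedTree.junction_below l v
  · rw [sum_const_range]; omega

/-- Computes the least entry of the table of threats on the path to the node in register `17`. -/
def minThreat : Prog :=
  (.op (.rmove 11 1) ;; .op (.imove 19 17) ;; neq 20 19 1) ;;
  .loop (.ilt 7 20) (.op (.rload 2 6 19) ;; .ite (.rlt 2 11) (.op (.rmove 11 2)) .skip ;;
    .op (.iload 19 0 19) ;; neq 20 19 1)

/-- The root has no siblings and is left out of the walk. A minimum equal to the default bound need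
not come from a threat, hence the strict inequality in the second clause. -/
theorem minThreat_spec (h : Ready G UL UF s) {l : Fin n} (hl : s.ireg 17 = l) :
    WP minThreat s (7 * G.depth l + 5) fun s' =>
      (∀ x, G.Threat G.IsF (payoffCode UL) G.root l x → s'.rreg 11 ≤ x) ∧
      (s'.rreg 11 < s.rreg 1 → ∀ x, s'.rreg 11 ≤ x →
        G.Threat G.IsF (payoffCode UL) G.root l x) := by
  let I : ℕ → State → Prop := fun j s' => s'.ireg 19 = G.parent^[j] l ∧
    (s'.ireg 20 = if G.parent^[j] l = G.root then 0 else 1) ∧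
    (∀ i < j, s'.rreg 11 ≤ s.rmem 6 (G.parent^[i] l)) ∧
    (s'.rreg 11 = s.rreg 1 ∨ ∃ i < j, s'.rreg 11 = s.rmem 6 (G.parent^[i] l))
  refine WP.seq (T₁ := 4) (T₂ := 7 * G.depth l + 1)
    ((WP.of_pre (Q := I 0) rfl ?_).mono le_rfl ?_) (by omega)
  · by_cases hr : l = G.root <;>
      simp [I, neq, hl, h.root, hr, h.zero, h.one, Fin.val_inj]
  · intro s₁ _ hI₁ hs₁
    have e₁ := h.toEnv.same hs₁ (by decide) (by decide)
    have hth₁ := hs₁.rmem 6 (by decide)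
    refine (WP.loop_count (G.depth l) I (fun _ => 6) hI₁ ?_ ?_).mono ?_ ?_
    · rintro k hk s' hs ⟨i19, i20, hle, hex⟩
      have e := e₁.same hs (by decide) (by decide)
      have hth := (hs.rmem 6 (by decide)).trans hth₁
      have hne := RootedTree.iterate_ne_root hk
      rw [if_neg hne] at i20
      refine ⟨by simp [e.zero, i20], ?_⟩
      have key : ∀ y, y = min (s'.rreg 11) (s.rmem 6 (G.parent^[k] l)) →
          (∀ i < k + 1, y ≤ s.rmem 6 (G.parent^[i] l)) ∧
          (y = s.rreg 1 ∨ ∃ i < k + 1, y = s.rmem 6 (G.parent^[i] l)) := by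
        rintro y rfl
        constructor
        · intro i hi
          rcases Nat.lt_succ_iff_lt_or_eq.1 hi with hi | rfl
          exacts [(min_le_left _ _).trans (hle i hi), min_le_right _ _]
        · rcases min_choice (s'.rreg 11) (s.rmem 6 (G.parent^[k] l)) with h1 | h1
          · rw [h1]
            refine hex.imp id ?_
            rintro ⟨i, hi, h2⟩
            exact ⟨i, by omega, h2⟩
          · exact Or.inr ⟨k, by omega, h1⟩
      have hJ : ∀ s'' : State, s''.ireg 19 = (G.parent (G.parent^[k] l) : Fin n) →
          (s''.ireg 20 = if G.parent (G.parent^[k] l) = G.root then 0 else 1) →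
          s''.rreg 11 = min (s'.rreg 11) (s.rmem 6 (G.parent^[k] l)) → I (k + 1) s'' := by
        rw [← Function.iterate_succ_apply' G.parent]
        exact fun s'' h1 h2 h3 => ⟨h1, h2, key _ h3⟩
      refine (WP.of_pre (by decide) ?_).mono (by decide) fun _ _ h => h
      have h0 := e.zero
      have h1 := e.one
      by_cases hlt : s.rmem 6 (G.parent^[k] l) < s'.rreg 11 <;>
        by_cases hr : G.parent (G.parent^[k] l) = G.root <;>
        simp only [neq, Prog.Pre, Test.Holds]
      · have hmin := min_eq_right hlt.le
        refine ⟨fun _ => ⟨fun _ => hJ _ ?_ ?_ ?_, fun hn => absurd ?_ hn⟩, fun hn => absurd ?_ hn⟩ <;>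
          simp [i19, e.parent, e.root, hth, hlt, hr, h0, hmin]
      · have hmin := min_eq_right hlt.le
        refine ⟨fun _ => ⟨fun hn => absurd hn ?_, fun _ => hJ _ ?_ ?_ ?_⟩, fun hn => absurd ?_ hn⟩ <;>
          simp [i19, e.parent, e.root, hth, hlt, hr, h1, hmin, Fin.val_inj]
      · refine ⟨fun hn => absurd hn ?_, fun _ => ⟨fun _ => hJ _ ?_ ?_ ?_, fun hn => absurd ?_ hn⟩⟩ <;>
          simp [i19, e.parent, e.root, hth, not_lt.1 hlt, hr, h0]
      · refine ⟨fun hn => absurd hn ?_, fun _ => ⟨fun hn => absurd hn ?_, fun _ => hJ _ ?_ ?_ ?_⟩⟩ <;>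
          simp [i19, e.parent, e.root, hth, not_lt.1 hlt, hr, h1, Fin.val_inj]
    · rintro s' hs ⟨-, i20, -⟩
      have e := e₁.same hs (by decide) (by decide)
      rw [if_pos (G.iterate_depth l)] at i20
      simp [e.zero, i20]
    · rw [sum_const_range]; omega
    · rintro s' - ⟨-, -, hle, hex⟩
      constructor
      · rintro x ⟨p, -, hF, a, ha, w, hw, hne, hal, hx⟩
        obtain ⟨i, rfl⟩ := hal
        have hi : i < G.depth l := by
          by_contra hi
          obtain ⟨j, rfl⟩ := Nat.exists_eq_add_of_le' (not_lt.1 hi)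
          rw [Function.iterate_add_apply, G.iterate_depth,
            Function.iterate_fixed G.parent_root] at ha
          exact G.root_notMem_children p ha
        exact ((hle i hi).trans ((h.threat _).1 p ha hF w hw hne)).trans hx
      · intro hlt x hx
        rcases hex with hB | ⟨i, hi, heq⟩
        · exact absurd hB hlt.ne
        · rcases (h.threat (G.parent^[i] l)).2 with hB | ⟨p, hF, hp, w, hw, hne, hval⟩
          · exact absurd (heq.trans hB) hlt.ne
          · exact ⟨p, RootedTree.below_root p, hF, _, hp, w, hw, hne, ⟨i, rfl⟩,
              by rw [← hval, ← heq]; exact hx⟩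

/-! ### The search for the best candidate -/

/-- If the index register `13` is set, then the index registers `10`, `11`, `12` and the data
registers `5`, `6` hold a candidate, and the data register `4` holds its value for the follower. -/
structure Best (G : GameTree n) (UL UF : G.Leaf → ℝ) (s : State) : Prop where
  flag : s.ireg 13 = 0 ∨ s.ireg 13 = 1
  candidate : s.ireg 13 = 1 → ∃ z z' l : Fin n, s.ireg 10 = z ∧ s.ireg 11 = z' ∧ s.ireg 12 = l ∧
    G.IsCandidate G.IsF (payoffCode UL) z z' l (s.rreg 6) (s.rreg 5) ∧
    s.rreg 4 = s.rreg 5 * payoffCode UF z + (1 - s.rreg 5) * payoffCode UF z'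

/-- The current candidate is at least as good for the follower as the payoff `x`. -/
def Dominates (s : State) (x : ℝ) : Prop := s.ireg 13 = 1 ∧ x ≤ s.rreg 4

theorem Best.same (h : Best G UL UF s) {P : Prog} (hs : SameOn P s s')
    (hi : ∀ r ∈ [10, 11, 12, 13], r ∉ P.ireg) (hr : ∀ r ∈ [4, 5, 6], r ∉ P.rreg) :
    Best G UL UF s' := by
  constructor
  · rw [hs.ireg 13 (hi 13 (by simp))]
    exact h.flag
  · rw [hs.ireg 13 (hi 13 (by simp)), hs.ireg 10 (hi 10 (by simp)), hs.ireg 11 (hi 11 (by simp)),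
      hs.ireg 12 (hi 12 (by simp)), hs.rreg 4 (hr 4 (by simp)), hs.rreg 5 (hr 5 (by simp)),
      hs.rreg 6 (hr 6 (by simp))]
    exact h.candidate

theorem Dominates.same {x : ℝ} (h : Dominates s x) {P : Prog} (hs : SameOn P s s')
    (hi : 13 ∉ P.ireg) (hr : 4 ∉ P.rreg) : Dominates s' x := by
  rw [Dominates, hs.ireg 13 hi, hs.rreg 4 hr]
  exact h

/-- Replaces the current candidate. -/
def update : Prog :=
  .op (.imove 10 14) ;; .op (.imove 11 21) ;; .op (.imove 12 22) ;; .op (.rmove 5 13) ;;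
  .op (.rmove 6 12) ;; .op (.rmove 4 14) ;; .op (.imove 13 2)

/-- Replaces the current candidate if the new one is better or there is none yet. -/
def accept : Prog := .ite (.ieq 13 7) update (.ite (.rlt 4 14) update .skip)

theorem accept_spec (h : Env G UL UF s) (hb : Best G UL UF s) {z z' l : Fin n}
    (hz : s.ireg 14 = z) (hz' : s.ireg 21 = z') (hl : s.ireg 22 = l)
    (hc : G.IsCandidate G.IsF (payoffCode UL) z z' l (s.rreg 12) (s.rreg 13))
    (hv : s.rreg 14 = s.rreg 13 * payoffCode UF z + (1 - s.rreg 13) * payoffCode UF z') :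
    WP accept s 9 fun s' => Best G UL UF s' ∧ (∀ x, Dominates s x → Dominates s' x) ∧
      Dominates s' (s.rreg 14) := by
  have hu : (s.ireg 13 = 1 → s.rreg 4 ≤ s.rreg 14) → WP update s 7 fun s' => Best G UL UF s' ∧
      (∀ x, Dominates s x → Dominates s' x) ∧ Dominates s' (s.rreg 14) := by
    intro hle
    refine (WP.of_pre (by decide) ?_).mono (by decide) fun _ _ h => h
    refine ⟨⟨Or.inr (by simp [h.one]), fun _ => ⟨z, z', l, by simp [hz], by simp [hz'],
      by simp [hl], by simpa using hc, by simpa using hv⟩⟩, fun x hx => ⟨by simp [h.one], ?_⟩,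
      by simp [h.one], ?_⟩
    · simpa using hx.2.trans (hle hx.1)
    · simp
  refine WP.ite (T := 8) (fun h0 => ?_) (fun h0 => WP.ite (T := 7) (fun hlt => ?_) (fun hlt => ?_)
    le_rfl) le_rfl
  · refine (hu fun h1 => ?_).mono (by omega) fun _ _ h => h
    simp [h1, h.zero] at h0
  · exact hu fun _ => le_of_lt hlt
  · exact WP.skip ⟨hb, fun _ h => h, hb.flag.resolve_left (by simpa [h.zero] using h0),
      not_lt.1 hlt⟩ (by omega)

/-- Tries the candidate that consists of the leaf in the index register `14`. -/
def trySingle : Prog :=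
  (.op (.imove 21 14) ;; .op (.imove 22 14) ;; .op (.rmove 12 8) ;; .op (.rconst 13 1) ;;
    .op (.rmove 14 10)) ;; accept

theorem trySingle_spec (h : Ready G UL UF s) (hb : Best G UL UF s) {z : Fin n}
    (hz : G.children z = ∅) (h14 : s.ireg 14 = z) (h8 : s.rreg 8 = payoffCode UL z)
    (h10 : s.rreg 10 = payoffCode UF z)
    (hm : G.maximin G.IsF (payoffCode UL) G.root ≤ payoffCode UL z) :
    WP trySingle s 14 fun s' => Best G UL UF s' ∧ (∀ x, Dominates s x → Dominates s' x) ∧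
      Dominates s' (payoffCode UF z) := by
  refine WP.seq (T₁ := 5) (T₂ := 9) ((WP.of_pre (Q := fun s₁ => s₁.ireg 21 = z ∧ s₁.ireg 22 = z ∧
    s₁.rreg 12 = payoffCode UL z ∧ s₁.rreg 13 = 1 ∧ s₁.rreg 14 = payoffCode UF z) rfl
    (by simp [h14, h8, h10])).mono le_rfl ?_) le_rfl
  rintro s₁ - ⟨h21, h22, h12, h13, h14'⟩ hs
  refine (accept_spec (h.toEnv.same hs (by decide) (by decide)) (hb.same hs (by decide) (by decide))
    (by rw [hs.ireg 14 (by decide), h14]) h21 h22 ?_ (by rw [h13, h14']; ring)).mono le_rfl ?_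
  · rw [h12, h13]
    exact ⟨hz, hz, by simp, le_rfl, by ring, hm, Or.inl ⟨rfl, rfl, rfl⟩⟩
  · rintro s₂ - ⟨h1, h2, h3⟩
    rw [h14'] at h3
    exact ⟨h1, fun x hx => h2 x (hx.same hs (by decide) (by decide)), h3⟩

/-- The current candidate is at least as good for the follower as the pair `z`, `z'`. -/
def Covers (G : GameTree n) (UL UF : G.Leaf → ℝ) (z z' l : Fin n) (s : State) : Prop :=
  ∃ x : ℝ, G.maximin G.IsF (payoffCode UL) G.root ≤ x ∧
    (∀ y, G.maximin G.IsF (payoffCode UL) G.root ≤ y →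
      G.Threat G.IsF (payoffCode UL) G.root l y → x ≤ y) ∧
    (payoffCode UL z' < x → x < payoffCode UL z →
      Dominates s ((x - payoffCode UL z') / (payoffCode UL z - payoffCode UL z') * payoffCode UF z +
        (1 - (x - payoffCode UL z') / (payoffCode UL z - payoffCode UL z')) * payoffCode UF z'))

theorem Covers.mono {z z' l : Fin n} (h : Covers G UL UF z z' l s)
    (hs : ∀ x, Dominates s x → Dominates s' x) : Covers G UL UF z z' l s' := by
  obtain ⟨x, h0, h1, h2⟩ := h
  exact ⟨x, h0, h1, fun h3 h4 => hs _ (h2 h3 h4)⟩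

/-- Computes the leader's payoff that a pair must give. -/
def setPayoff : Prog :=
  .op (.rmove 12 11) ;; .ite (.rlt 12 7) (.op (.rmove 12 7)) .skip ;; .op (.rload 9 0 15)

/-- Computes the probability of the first leaf of a pair and the value of the pair. -/
def setValue : Prog :=
  .op (.rload 15 1 15) ;; .op (.rsub 13 12 9) ;; .op (.rsub 2 8 9) ;; .op (.rdiv 13 13 2) ;;
  .op (.rmul 14 13 10) ;; .op (.rconst 3 1) ;; .op (.rsub 3 3 13) ;; .op (.rmul 3 3 15) ;;
  .op (.radd 14 14 3) ;; .op (.imove 21 15) ;; .op (.imove 22 17)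

/-- Tries the candidate that consists of the leaves in the index registers `14` and `15`, which part
at the node in the index register `17`. -/
def tryPair : Prog :=
  minThreat ;; setPayoff ;; .ite (.rlt 9 12) (.ite (.rlt 12 8) (setValue ;; accept) .skip) .skip

/-- The payoff demanded is the larger of the root's maximin value and the least threat. The pair is
tried only if this lies strictly between the payoffs of its leaves; otherwise a single leaf does as
well. -/
theorem tryPair_spec (h : Ready G UL UF s) (hb : Best G UL UF s) {z z' l : Fin n}
    (hz : G.children z = ∅) (hz' : G.children z' = ∅) (hp : G.PartAt G.IsF G.root z z' l)
    (h14 : s.ireg 14 = z) (h15 : s.ireg 15 = z') (h17 : s.ireg 17 = l)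
    (h8 : s.rreg 8 = payoffCode UL z) (h10 : s.rreg 10 = payoffCode UF z) :
    WP tryPair s (7 * G.depth l + 31) fun s' => Best G UL UF s' ∧
      (∀ x, Dominates s x → Dominates s' x) ∧ Covers G UL UF z z' l s' := by
  refine WP.seq (T₂ := 26) ((minThreat_spec h h17).mono le_rfl ?_) (by omega)
  rintro s₁ hs₁ ⟨hlow, hthreat⟩ -
  have r₁ := h.same hs₁ (by decide) (by decide) (by decide) (by decide)
  refine WP.seq (T₁ := 4) (T₂ := 22) ((WP.of_pre (Q := fun s₂ =>
    s₂.rreg 12 = max (s₁.rreg 11) (s₁.rreg 7) ∧ s₂.rreg 9 = payoffCode UL z')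
    rfl ?_).mono le_rfl ?_) le_rfl
  · have h15' := (hs₁.ireg 15 (by decide)).trans h15
    by_cases hlt : s₁.rreg 11 < s₁.rreg 7
    · simp [setPayoff, hlt, hlt.le, h15', r₁.payoff]
    · simp [setPayoff, hlt, not_lt.1 hlt, h15', r₁.payoff]
  rintro s₂ hs₂ ⟨h12, h9⟩ -
  have r₂ := r₁.same hs₂ (by decide) (by decide) (by decide) (by decide)
  have b₂ := (hb.same hs₁ (by decide) (by decide)).same hs₂ (by decide) (by decide)
  have d₂ : ∀ x, Dominates s x → Dominates s₂ x := fun x hx =>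
    (hx.same hs₁ (by decide) (by decide)).same hs₂ (by decide) (by decide)
  have g8 : s₂.rreg 8 = payoffCode UL z := by
    rw [hs₂.rreg 8 (by decide), hs₁.rreg 8 (by decide), h8]
  have g10 : s₂.rreg 10 = payoffCode UF z := by
    rw [hs₂.rreg 10 (by decide), hs₁.rreg 10 (by decide), h10]
  have g14 : s₂.ireg 14 = z := by rw [hs₂.ireg 14 (by decide), hs₁.ireg 14 (by decide), h14]
  have g15 : s₂.ireg 15 = z' := by rw [hs₂.ireg 15 (by decide), hs₁.ireg 15 (by decide), h15]
  have g17 : s₂.ireg 17 = l := by rw [hs₂.ireg 17 (by decide), hs₁.ireg 17 (by decide), h17]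
  have hmin : ∀ y, G.maximin G.IsF (payoffCode UL) G.root ≤ y →
      G.Threat G.IsF (payoffCode UL) G.root l y → s₂.rreg 12 ≤ y := by
    intro y hy ht
    rw [h12, r₁.security]
    exact max_le (hlow y ht) hy
  have hmax : G.maximin G.IsF (payoffCode UL) G.root ≤ s₂.rreg 12 := by
    rw [h12, r₁.security]
    exact le_max_right _ _
  refine WP.ite (T := 21) (fun hlt₁ => WP.ite (T := 20) (fun hlt₂ => ?_) (fun hlt₂ => ?_) le_rfl)
    (fun hlt₁ => ?_) le_rfl
  · simp only [Test.Holds, h9, g8] at hlt₁ hlt₂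
    have hpos : 0 < payoffCode UL z - payoffCode UL z' := by linarith
    refine WP.seq (T₁ := 11) (T₂ := 9) ((WP.of_pre (Q := fun s₃ => s₃.ireg 21 = z' ∧
      s₃.ireg 22 = l ∧ s₃.rreg 12 = s₂.rreg 12 ∧
      s₃.rreg 13 = (s₂.rreg 12 - payoffCode UL z') / (payoffCode UL z - payoffCode UL z') ∧
      s₃.rreg 14 = s₃.rreg 13 * payoffCode UF z + (1 - s₃.rreg 13) * payoffCode UF z') rfl
      (by simp [setValue, g8, g10, g15, g17, h9, r₂.payoff'])).mono le_rfl ?_) le_rfl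
    rintro s₃ - ⟨h21, h22, g12, g13, h14'⟩ hs₃
    refine (accept_spec (r₂.toEnv.same hs₃ (by decide) (by decide))
      (b₂.same hs₃ (by decide) (by decide)) (by rw [hs₃.ireg 14 (by decide), g14]) h21 h22 ?_
      h14').mono le_rfl ?_
    · rw [g12, g13]
      refine ⟨hz, hz', div_nonneg (by linarith) hpos.le, (div_le_one hpos).2 (by linarith), ?_,
        hmax, Or.inr ⟨hp, ?_⟩⟩
      · field_simp
        ring
      -- The payoff lies below that of `z`, hence below the default bound, so the threat found is
      -- genuine.
      · have hB := h.bound z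
        refine hthreat ?_ _ (by rw [h12]; exact le_max_left _ _)
        exact (le_max_left _ _).trans_lt ((h12 ▸ hlt₂).trans_le hB)
    · rintro s₄ - ⟨h1, h2, h3⟩
      refine ⟨h1, fun x hx => h2 x ((d₂ x hx).same hs₃ (by decide) (by decide)), s₂.rreg 12, hmax, hmin,
        fun _ _ => ?_⟩
      rwa [h14', g13] at h3
  · refine WP.skip ⟨b₂, d₂, s₂.rreg 12, hmax, hmin, fun _ h4 => absurd ?_ hlt₂⟩ (by omega)
    simpa [g8] using h4
  · refine WP.skip ⟨b₂, d₂, s₂.rreg 12, hmax, hmin, fun h4 _ => absurd ?_ hlt₁⟩ (by omega)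
    simpa [h9] using h4

theorem Best.setI (h : Best G UL UF s) {i : ℕ} (hi : 13 < i) (x : ℕ) :
    Best G UL UF (s.setI i x) :=
  h.same (P := .op (.iconst i x)) (Exec.op _ s).sameOn (by simp [Prog.ireg]; omega)
    (by simp [Prog.rreg])

theorem Dominates.setI {y : ℝ} (h : Dominates s y) {i : ℕ} (hi : 13 < i) (x : ℕ) :
    Dominates (s.setI i x) y :=
  h.same (P := .op (.iconst i x)) (Exec.op _ s).sameOn (by simp [Prog.ireg]; omega)
    (by simp [Prog.rreg])

theorem partAt_junction {z z' : Fin n} (hz : G.children z = ∅) (hz' : G.children z' = ∅)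
    (hne : z ≠ z') (hF : ¬ G.IsF (G.junction z z')) :
    G.PartAt G.IsF G.root z z' (G.junction z z') := by
  have hnb : ¬ G.Below z' z := fun h => hne (RootedTree.eq_of_below_leaf hz' h)
  obtain ⟨h1, h2, h3⟩ := RootedTree.branch_spec hnb
  have h4 := RootedTree.junction_below (T := G.toRootedTree) z z'
  obtain ⟨w, hw, hwz⟩ := h4.exists_child (by
    rintro h5
    rw [← h5, hz] at h1
    simp at h1)
  exact ⟨RootedTree.below_root _, hF, w, hw, _, h1, fun h5 => h3 (h5 ▸ hwz), hwz, h2⟩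

/-- `a` at the leaves and `0` elsewhere. -/
def leafCost (G : GameTree n) (a k : ℕ) : ℕ :=
  if ∃ h : k < n, G.children ⟨k, h⟩ = ∅ then a else 0

theorem leafCost_leaf {v : Fin n} (hv : G.children v = ∅) (a : ℕ) : leafCost G a v = a :=
  if_pos ⟨v.2, hv⟩

/-- Charging the expensive branch of a loop to leaves only replaces a factor $|H|+|Z|$ by $|Z|$; the
time bound depends on this. -/
theorem sum_leafCost (a : ℕ) :
    ∑ k ∈ Finset.range n, leafCost G a k = Fintype.card G.Leaf * a := by
  rw [Finset.sum_range, Fintype.card_subtype, ← smul_eq_mul, ← Finset.sum_const,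
    Finset.sum_filter]
  exact Finset.sum_congr rfl fun v _ => by simp [leafCost]

theorem sum_leafCost_add (a b : ℕ) : ∑ k ∈ Finset.range n, (leafCost G a k + b) =
    Fintype.card G.Leaf * a + (Fintype.card G.Decision + Fintype.card G.Leaf) * b := by
  rw [Finset.sum_add_distrib, sum_leafCost, sum_const_range, G.card_decision_add_card_leaf]

/-- Tries all pairs whose first leaf is in the index register `14`. -/
def scanPairs : Prog := forNodes 15 (
  .op (.iload 4 4 15) ;; .ite (.ieq 4 2) (
    .ite (.ieq 14 15) .skip (
      findJunction 15 ;; .op (.iload 5 1 17) ;; .ite (.ieq 5 2) .skip tryPair)) .skip)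

theorem scanPairs_spec (h : Ready G UL UF s) (hb : Best G UL UF s) {z : Fin n}
    (hz : G.children z = ∅) (h14 : s.ireg 14 = z) (h8 : s.rreg 8 = payoffCode UL z)
    (h10 : s.rreg 10 = payoffCode UF z)
    (hm : ∀ w : Fin n, s.imem 6 w < s.ireg 16 ↔ ¬ G.Below w z) :
    WP scanPairs s (Fintype.card G.Leaf * (11 * Fintype.card G.Decision + 38) +
        (Fintype.card G.Decision + Fintype.card G.Leaf) * 5 + 2) fun s' => Best G UL UF s' ∧
      (∀ x, Dominates s x → Dominates s' x) ∧ ∀ z' : Fin n, G.children z' = ∅ → z ≠ z' →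
        ¬ G.IsF (G.junction z z') → Covers G UL UF z z' (G.junction z z') s' := by
  let I : ℕ → State → Prop := fun k s' => Best G UL UF s' ∧
    (∀ x, Dominates s x → Dominates s' x) ∧ ∀ z' : Fin n, z'.1 < k → G.children z' = ∅ → z ≠ z' →
      ¬ G.IsF (G.junction z z') → Covers G UL UF z z' (G.junction z z') s'
  refine (WP.forNodes (n := n) I (fun k => leafCost G (11 * Fintype.card G.Decision + 38) k + 3)
    (by decide) (by decide) (by decide) h.card h.one ?_ ⟨hb, fun _ h => h, by simp⟩ ?_).mono ?_ ?_
  · rintro k s' x ⟨h1, h2, h3⟩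
    exact ⟨h1.setI (by omega) x, fun y hy => (h2 y hy).setI (by omega) x, fun z' a1 a2 a3 a4 =>
      (h3 z' a1 a2 a3 a4).mono fun y hy => hy.setI (by omega) x⟩
  · rintro k hk s₁ hs₁ hi ⟨I1, I2, I3⟩
    have r₁ := h.same hs₁ (by decide) (by decide) (by decide) (by decide)
    obtain ⟨z', rfl⟩ : ∃ w : Fin n, w.1 = k := ⟨⟨k, hk⟩, rfl⟩
    have hnew : ∀ s₂, Best G UL UF s₂ → (∀ x, Dominates s₁ x → Dominates s₂ x) →
        (G.children z' = ∅ → z ≠ z' → ¬ G.IsF (G.junction z z') →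
          Covers G UL UF z z' (G.junction z z') s₂) → I (z'.1 + 1) s₂ := by
      intro s₂ h1 h2 h3
      refine ⟨h1, fun x hx => h2 x (I2 x hx), fun y hy => ?_⟩
      rcases Nat.lt_succ_iff_lt_or_eq.1 hy with hy | hy
      · exact fun a2 a3 a4 => (I3 y hy a2 a3 a4).mono h2
      · rw [Fin.ext hy]
        exact h3
    refine WP.seq (T₁ := 1) (WP.op (fun hs₂ => ?_) le_rfl) le_rfl
      (T₂ := leafCost G (11 * Fintype.card G.Decision + 38) z' + 2) |>.mono (by omega)
      fun _ _ h => h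
    have r₂ := r₁.same hs₂ (by decide) (by decide) (by decide) (by decide)
    have b₂ := I1.same hs₂ (by decide) (by decide)
    have d₂ : ∀ x, Dominates s₁ x → Dominates ((Instr.iload 4 4 15).apply s₁) x :=
      fun x hx => hx.same hs₂ (by decide) (by decide)
    have i4 : ((Instr.iload 4 4 15).apply s₁).ireg 4 = if G.children z' = ∅ then 1 else 0 := by
      simp [hi, r₁.flag]
    have i15 := (hs₂.ireg 15 (by decide)).trans hi
    have i14 := (hs₂.ireg 14 (by decide)).trans ((hs₁.ireg 14 (by decide)).trans h14)
    have i16 := (hs₂.ireg 16 (by decide)).trans (hs₁.ireg 16 (by decide))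
    have m6 := (hs₂.imem 6 (by decide)).trans (hs₁.imem 6 (by decide))
    have g8 := (hs₂.rreg 8 (by decide)).trans ((hs₁.rreg 8 (by decide)).trans h8)
    have g10 := (hs₂.rreg 10 (by decide)).trans ((hs₁.rreg 10 (by decide)).trans h10)
    generalize (Instr.iload 4 4 15).apply s₁ = s₂ at *
    refine WP.ite (T := leafCost G (11 * Fintype.card G.Decision + 38) z' + 1) (fun hz' => ?_)
      (fun hz' => WP.skip (hnew _ b₂ d₂ fun hz'' => absurd ?_ hz') (by omega)) le_rfl
    swap
    · simp [i4, hz'', r₂.one]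
    replace hz' : G.children z' = ∅ := by
      by_contra hn
      simp [i4, hn, r₂.one] at hz'
    rw [leafCost_leaf hz']
    have hdep := G.depth_le_card z'
    refine WP.ite (T := 11 * Fintype.card G.Decision + 38) (fun heq => WP.skip
      (hnew _ b₂ d₂ fun _ hne => absurd (Fin.ext ?_) hne) (by omega)) (fun hne => ?_) le_rfl
    · simpa [i14, i15] using heq
    replace hne : z ≠ z' := by
      rintro rfl
      simp [i14, i15] at hne
    refine WP.seq (T₂ := 7 * Fintype.card G.Decision + 33) ((findJunction_spec (by decide)
      r₂.toEnv i15 (by rw [m6, i16]; exact hm)).mono le_rfl ?_) (by omega)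
    rintro s₃ hs₃ ⟨j17, -⟩ -
    have r₃ := r₂.same hs₃ (by decide) (by decide) (by decide) (by decide)
    have b₃ := b₂.same hs₃ (by decide) (by decide)
    have d₃ : ∀ x, Dominates s₁ x → Dominates s₃ x :=
      fun x hx => (d₂ x hx).same hs₃ (by decide) (by decide)
    refine WP.seq (T₁ := 1) (T₂ := 7 * Fintype.card G.Decision + 32)
      (WP.op (fun hs₄ => ?_) le_rfl) (by omega)
    have r₄ := r₃.same hs₄ (by decide) (by decide) (by decide) (by decide)
    have b₄ := b₃.same hs₄ (by decide) (by decide)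
    have d₄ : ∀ x, Dominates s₁ x → Dominates ((Instr.iload 5 1 17).apply s₃) x :=
      fun x hx => (d₃ x hx).same hs₄ (by decide) (by decide)
    have i5 : ((Instr.iload 5 1 17).apply s₃).ireg 5 = G.ownerCode (G.junction z z') := by
      simp [j17, r₃.owner]
    have k17 := (hs₄.ireg 17 (by decide)).trans j17
    have k14 := (hs₄.ireg 14 (by decide)).trans ((hs₃.ireg 14 (by decide)).trans i14)
    have k15 := (hs₄.ireg 15 (by decide)).trans ((hs₃.ireg 15 (by decide)).trans i15)
    have k8 := (hs₄.rreg 8 (by decide)).trans ((hs₃.rreg 8 (by decide)).trans g8)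
    have k10 := (hs₄.rreg 10 (by decide)).trans ((hs₃.rreg 10 (by decide)).trans g10)
    generalize (Instr.iload 5 1 17).apply s₃ = s₄ at *
    refine WP.ite (T := 7 * Fintype.card G.Decision + 31) (fun hF => WP.skip
      (hnew _ b₄ d₄ fun _ _ hF' => absurd ?_ hF') (by omega)) (fun hF => ?_) le_rfl
    · simpa [i5, r₄.one] using hF
    replace hF : ¬ G.IsF (G.junction z z') := by simpa [i5, r₄.one] using hF
    have hdep' := G.depth_le_card (G.junction z z')
    refine (tryPair_spec r₄ b₄ hz hz' (partAt_junction hz hz' hne hF) k14 k15 k17 k8 k10).mono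
      (by omega) ?_
    rintro s₅ - ⟨h1, h2, h3⟩
    exact hnew _ h1 (fun x hx => h2 x (d₄ x hx)) fun _ _ _ => h3
  · simp only [add_assoc, sum_leafCost_add]
    omega
  · rintro s' - ⟨h1, h2, h3⟩
    exact ⟨h1, h2, fun z' => h3 z' z'.2⟩

/-- Tries all candidates whose first leaf is in the index register `14`. -/
def scan : Prog :=
  .op (.iadd 16 14 2) ;; markPath 14 ;; .op (.rload 8 0 14) ;; .op (.rload 10 1 14) ;;
  .ite (.rlt 8 7) .skip trySingle ;; scanPairs

/-- The current candidate is at least as good for the follower as all candidates whose first leaf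
is `z`. -/
structure CoversAll (G : GameTree n) (UL UF : G.Leaf → ℝ) (z : Fin n) (s : State) : Prop where
  single : G.maximin G.IsF (payoffCode UL) G.root ≤ payoffCode UL z →
    Dominates s (payoffCode UF z)
  pair : ∀ z' : Fin n, G.children z' = ∅ → z ≠ z' → ¬ G.IsF (G.junction z z') →
    Covers G UL UF z z' (G.junction z z') s

theorem CoversAll.mono {z : Fin n} (h : CoversAll G UL UF z s)
    (hs : ∀ x, Dominates s x → Dominates s' x) : CoversAll G UL UF z s' :=
  ⟨fun h1 => hs _ (h.single h1), fun z' h1 h2 h3 => (h.pair z' h1 h2 h3).mono hs⟩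

/-- A bound on the running time of `scan`. -/
def scanCost (G : GameTree n) : ℕ :=
  11 * (Fintype.card G.Decision * Fintype.card G.Leaf) + 11 * Fintype.card G.Decision +
    43 * Fintype.card G.Leaf + 26

/-- The stamp `z + 1` exceeds all marks left by earlier leaves, so marks are never erased. -/
theorem scan_spec (h : Ready G UL UF s) (hb : Best G UL UF s) {z : Fin n}
    (hz : G.children z = ∅) (h14 : s.ireg 14 = z) (hm : ∀ w : Fin n, s.imem 6 w ≤ z) :
    WP scan s (scanCost G) fun s' => Best G UL UF s' ∧
      (∀ x, Dominates s x → Dominates s' x) ∧ CoversAll G UL UF z s' ∧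
      ∀ w : Fin n, s'.imem 6 w ≤ z + 1 := by
  classical
  have hdep := G.depth_le_card z
  refine WP.seq (T₁ := 1) (T₂ := (6 * Fintype.card G.Decision + 6) + (17 +
    (Fintype.card G.Leaf * (11 * Fintype.card G.Decision + 38) +
      (Fintype.card G.Decision + Fintype.card G.Leaf) * 5 + 2))) (WP.op (fun hs₁ => ?_) le_rfl) (by
    rw [scanCost]
    ring_nf
    omega)
  have r₁ := h.same hs₁ (by decide) (by decide) (by decide) (by decide)
  have b₁ := hb.same hs₁ (by decide) (by decide)
  have d₁ : ∀ x, Dominates s x → Dominates ((Instr.iadd 16 14 2).apply s) x :=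
    fun x hx => hx.same hs₁ (by decide) (by decide)
  have i14 := (hs₁.ireg 14 (by decide)).trans h14
  have i16 : ((Instr.iadd 16 14 2).apply s).ireg 16 = z + 1 := by simp [h14, h.one]
  have m6 := hs₁.imem 6 (by decide)
  generalize (Instr.iadd 16 14 2).apply s = s₁ at *
  refine WP.seq ((markPath_spec r₁.toEnv i14).mono (T' := 6 * Fintype.card G.Decision + 6)
    (by omega) ?_) le_rfl
  intro s₂ hs₂ hmark _
  have r₂ := r₁.same hs₂ (by decide) (by decide) (by decide) (by decide)
  have b₂ := b₁.same hs₂ (by decide) (by decide)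
  have d₂ : ∀ x, Dominates s x → Dominates s₂ x :=
    fun x hx => (d₁ x hx).same hs₂ (by decide) (by decide)
  refine WP.seq (T₁ := 1) (T₂ := 16 + (Fintype.card G.Leaf * (11 * Fintype.card G.Decision + 38) +
    (Fintype.card G.Decision + Fintype.card G.Leaf) * 5 + 2)) (WP.op (fun hs₃ => ?_) le_rfl)
    (by omega)
  refine WP.seq (T₁ := 1) (T₂ := 15 + (Fintype.card G.Leaf * (11 * Fintype.card G.Decision + 38) +
    (Fintype.card G.Decision + Fintype.card G.Leaf) * 5 + 2)) (WP.op (fun hs₄ => ?_) le_rfl)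
    (by omega)
  have r₄ := (r₂.same hs₃ (by decide) (by decide) (by decide) (by decide)).same hs₄ (by decide)
    (by decide) (by decide) (by decide)
  have b₄ := (b₂.same hs₃ (by decide) (by decide)).same hs₄ (by decide) (by decide)
  have d₄ : ∀ x, Dominates s x → Dominates
      ((Instr.rload 10 1 14).apply ((Instr.rload 8 0 14).apply s₂)) x :=
    fun x hx => ((d₂ x hx).same hs₃ (by decide) (by decide)).same hs₄ (by decide) (by decide)
  have j14 := (hs₂.ireg 14 (by decide)).trans i14
  have g8 : ((Instr.rload 10 1 14).apply ((Instr.rload 8 0 14).apply s₂)).rreg 8 =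
    payoffCode UL z := by simp [j14, r₂.payoff]
  have g10 : ((Instr.rload 10 1 14).apply ((Instr.rload 8 0 14).apply s₂)).rreg 10 =
    payoffCode UF z := by simp [j14, r₂.payoff']
  have k14 := (hs₄.ireg 14 (by decide)).trans ((hs₃.ireg 14 (by decide)).trans j14)
  have k16 := (hs₄.ireg 16 (by decide)).trans ((hs₃.ireg 16 (by decide)).trans
    ((hs₂.ireg 16 (by decide)).trans i16))
  have km := (hs₄.imem 6 (by decide)).trans (hs₃.imem 6 (by decide))
  generalize (Instr.rload 10 1 14).apply ((Instr.rload 8 0 14).apply s₂) = s₄ at *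
  refine WP.seq (T₁ := 15) ((WP.ite (T := 14) (Q := fun s₅ => Best G UL UF s₅ ∧
    (∀ x, Dominates s x → Dominates s₅ x) ∧ (G.maximin G.IsF (payoffCode UL) G.root ≤
      payoffCode UL z → Dominates s₅ (payoffCode UF z)))
    (fun hlt => WP.skip ⟨b₄, d₄, fun hle => absurd hle ?_⟩ (by omega)) (fun hlt => ?_)
    le_rfl).mono le_rfl ?_) le_rfl
  · simpa [g8, r₄.security] using hlt
  · refine (trySingle_spec r₄ b₄ hz k14 g8 g10 ?_).mono le_rfl ?_
    · simpa [g8, r₄.security] using hlt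
    · rintro s₅ - ⟨h1, h2, h3⟩
      exact ⟨h1, fun x hx => h2 x (d₄ x hx), fun _ => h3⟩
  · rintro s₅ - ⟨b₅, d₅, single⟩ hs₅
    have r₅ := r₄.same hs₅ (by decide) (by decide) (by decide) (by decide)
    have hmarks : ∀ w : Fin n, s₅.imem 6 w = if G.Below w z then z.1 + 1 else s.imem 6 w := by
      rw [hs₅.imem 6 (by decide), km]
      intro w
      rw [hmark, i16, m6]
    refine (scanPairs_spec r₅ b₅ hz ((hs₅.ireg 14 (by decide)).trans k14)
      ((hs₅.rreg 8 (by decide)).trans g8) ((hs₅.rreg 10 (by decide)).trans g10) ?_).mono le_rfl ?_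
    · intro w
      rw [hmarks, hs₅.ireg 16 (by decide), k16]
      have := hm w
      split_ifs with hw
      · simp [hw]
      · simp only [hw, not_false_eq_true, iff_true]
        omega
    · rintro s₆ hs₆ ⟨h1, h2, h3⟩
      refine ⟨h1, fun x hx => h2 x (d₅ x hx), ⟨fun hle => h2 _ (single hle), h3⟩, fun w => ?_⟩
      rw [hs₆.imem 6 (by decide), hmarks]
      have := hm w
      split_ifs <;> omega

/-- Tries all candidates. -/
def search : Prog := forNodes 14 (.op (.iload 4 4 14) ;; .ite (.ieq 4 2) scan .skip)

theorem search_spec (h : Ready G UL UF s) (h13 : s.ireg 13 = 0)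
    (hm : ∀ w : Fin n, s.imem 6 w = 0) :
    WP search s (Fintype.card G.Leaf * scanCost G +
        (Fintype.card G.Decision + Fintype.card G.Leaf) * 5 + 2) fun s' => Best G UL UF s' ∧
      (∀ z : Fin n, G.children z = ∅ → CoversAll G UL UF z s') ∧
      ∀ w : Fin n, s'.imem 6 w ≤ n := by
  let I : ℕ → State → Prop := fun k s' => Best G UL UF s' ∧
    (∀ z : Fin n, z.1 < k → G.children z = ∅ → CoversAll G UL UF z s') ∧
      ∀ w : Fin n, s'.imem 6 w ≤ k
  refine (WP.forNodes (n := n) I (fun k => leafCost G (scanCost G) k + 3)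
    (by decide) (by decide) (by decide) h.card h.one ?_ ⟨⟨Or.inl h13, by simp [h13]⟩, by simp,
      by simp [hm]⟩ ?_).mono ?_ ?_
  · rintro k s' x ⟨h1, h2, h3⟩
    exact ⟨h1.setI (by omega) x, fun z hz hz' => (h2 z hz hz').mono fun y hy =>
      hy.setI (by omega) x, h3⟩
  · rintro k hk s₁ hs₁ hi ⟨I1, I2, I3⟩
    have r₁ := h.same hs₁ (by decide) (by decide) (by decide) (by decide)
    obtain ⟨z, rfl⟩ : ∃ w : Fin n, w.1 = k := ⟨⟨k, hk⟩, rfl⟩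
    have hnew : ∀ s₂, Best G UL UF s₂ → (∀ x, Dominates s₁ x → Dominates s₂ x) →
        (G.children z = ∅ → CoversAll G UL UF z s₂) → (∀ w : Fin n, s₂.imem 6 w ≤ z + 1) →
        I (z.1 + 1) s₂ := by
      intro s₂ h1 h2 h3 h4
      refine ⟨h1, fun y hy => ?_, h4⟩
      rcases Nat.lt_succ_iff_lt_or_eq.1 hy with hy | hy
      · exact fun hy' => (I2 y hy hy').mono h2
      · rw [Fin.ext hy]
        exact h3
    refine WP.seq (T₁ := 1) (T₂ := leafCost G (scanCost G) z + 2)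
      (WP.op (fun hs₂ => ?_) le_rfl) (by omega)
    have r₂ := r₁.same hs₂ (by decide) (by decide) (by decide) (by decide)
    have b₂ := I1.same hs₂ (by decide) (by decide)
    have d₂ : ∀ x, Dominates s₁ x → Dominates ((Instr.iload 4 4 14).apply s₁) x :=
      fun x hx => hx.same hs₂ (by decide) (by decide)
    have i4 : ((Instr.iload 4 4 14).apply s₁).ireg 4 = if G.children z = ∅ then 1 else 0 := by
      simp [hi, r₁.flag]
    have i14 := (hs₂.ireg 14 (by decide)).trans hi
    have m6 : ∀ w : Fin n, ((Instr.iload 4 4 14).apply s₁).imem 6 w ≤ z := by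
      rw [hs₂.imem 6 (by decide)]; exact I3
    generalize (Instr.iload 4 4 14).apply s₁ = s₂ at *
    refine WP.ite (T := leafCost G (scanCost G) z + 1) (fun hz => ?_)
      (fun hz => WP.skip (hnew _ b₂ d₂ (fun hz' => absurd ?_ hz) fun w => (m6 w).trans (by omega))
        (by omega)) le_rfl
    swap
    · simp [i4, hz', r₂.one]
    replace hz : G.children z = ∅ := by
      by_contra hn
      simp [i4, hn, r₂.one] at hz
    rw [leafCost_leaf hz]
    refine (scan_spec r₂ b₂ hz i14 m6).mono (by omega) ?_
    rintro s₃ - ⟨h1, h2, h3, h4⟩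
    exact hnew _ h1 (fun x hx => h2 x (d₂ x hx)) (fun _ => h3) h4
  · simp only [add_assoc, sum_leafCost_add]
    omega
  · rintro s' - ⟨h1, h2, h3⟩
    exact ⟨h1, fun z => h2 z z.2, h3⟩

/-! ### The output -/

/-- Computes the reported payoff at the leaf in the index register `14`. -/
def setReport : Prog :=
  .ite (.ieq 14 10) (.op (.rsub 2 6 8) ;; .op (.rstore 3 14 2))
    (.ite (.ieq 14 11) (.op (.rsub 2 6 8) ;; .op (.rstore 3 14 2))
      (findJunction 14 ;;
        .ite (.ieq 17 12) (.op (.rsub 2 6 1) ;; .op (.rstore 3 14 2))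
          (.op (.rload 3 4 19) ;;
            .ite (.rlt 6 3) (.op (.rsub 2 6 1) ;; .op (.rstore 3 14 2))
              (.op (.rsub 2 3 8) ;; .op (.rstore 3 14 2)))))

theorem setReport_spec (h : Ready G UL UF s) {y z z' l : Fin n} (h14 : s.ireg 14 = y)
    (h8 : s.rreg 8 = payoffCode UL y) (h10 : s.ireg 10 = z) (h11 : s.ireg 11 = z')
    (h12 : s.ireg 12 = l) (hm : ∀ w : Fin n, s.imem 6 w < s.ireg 16 ↔ ¬ G.Below w l) :
    WP setReport s (4 * G.depth y + 11) fun s' => ∀ a, s'.rmem 3 a =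
      if a = y then G.report G.IsF (payoffCode UL) (s.rreg 1) z z' l (s.rreg 6) y
      else s.rmem 3 a := by
  refine WP.ite (T := 4 * G.depth y + 10) (fun hz => ?_) (fun hz => WP.ite
    (T := 4 * G.depth y + 9) (fun hz' => ?_) (fun hz' => ?_) le_rfl) le_rfl
  · have : y = z := Fin.ext (by simpa [h14, h10] using hz)
    refine (WP.of_pre (by decide) ?_).mono (T := 2) (by omega) fun _ _ h => h
    simp [h14, h8, RootedTree.report, this]
  · have : y = z' := Fin.ext (by simpa [h14, h11] using hz')
    refine (WP.of_pre (by decide) ?_).mono (T := 2) (by omega) fun _ _ h => h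
    simp [h14, h8, RootedTree.report, this]
  replace hz : y ≠ z := by rintro rfl; simp [h14, h10] at hz
  replace hz' : y ≠ z' := by rintro rfl; simp [h14, h11] at hz'
  refine WP.seq (T₂ := 5) ((findJunction_spec (by decide) h.toEnv h14 hm).mono le_rfl ?_) (by omega)
  rintro s₁ hs₁ ⟨h17, h19⟩ -
  have r₁ := h.same hs₁ (by decide) (by decide) (by decide) (by decide)
  have g14 := (hs₁.ireg 14 (by decide)).trans h14
  have g12 := (hs₁.ireg 12 (by decide)).trans h12
  have g8 := (hs₁.rreg 8 (by decide)).trans h8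
  have g1 := hs₁.rreg 1 (by decide)
  have g6 := hs₁.rreg 6 (by decide)
  have gm := hs₁.rmem 3 (by decide)
  refine (WP.of_pre (by decide) ?_).mono (by decide) fun _ _ h => h
  by_cases hl : G.junction l y = l
  · simp [h17, g12, hl, g1, g6, gm, g14, RootedTree.report, hz, hz']
  · by_cases hx : s.rreg 6 < G.maximin G.IsF (payoffCode UL) (G.branch l y)
    · simp [h17, h19, g12, hl, g1, g6, gm, g14, RootedTree.report, hz, hz', r₁.value, hx,
        Fin.val_inj]
    · simp [h17, h19, g12, hl, g6, gm, g14, RootedTree.report, hz, hz', r₁.value, hx,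
        Fin.val_inj, g8]

/-- Writes the reported payoffs. -/
def writeReport : Prog := forNodes 14 (
  .op (.iload 4 4 14) ;; .ite (.ieq 4 2) (.op (.rload 8 0 14) ;; setReport) .skip)

theorem writeReport_spec (h : Ready G UL UF s) {z z' l : Fin n} (h10 : s.ireg 10 = z)
    (h11 : s.ireg 11 = z') (h12 : s.ireg 12 = l)
    (hm : ∀ w : Fin n, s.imem 6 w < s.ireg 16 ↔ ¬ G.Below w l) :
    WP writeReport s (Fintype.card G.Leaf * (4 * Fintype.card G.Decision + 11) +
        (Fintype.card G.Decision + Fintype.card G.Leaf) * 5 + 2) fun s' =>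
      ∀ y : G.Leaf, s'.rmem 3 y.1 =
        G.report G.IsF (payoffCode UL) (s.rreg 1) z z' l (s.rreg 6) y.1 := by
  let I : ℕ → State → Prop := fun k s' => ∀ y : Fin n, y.1 < k → G.children y = ∅ →
    s'.rmem 3 y = G.report G.IsF (payoffCode UL) (s.rreg 1) z z' l (s.rreg 6) y
  refine (WP.forNodes (n := n) I (fun k => leafCost G (4 * Fintype.card G.Decision + 11) k + 3)
    (by decide) (by decide) (by decide) h.card h.one (fun _ _ _ h => h) (by simp [I]) ?_).mono ?_
    fun s' _ hI y => hI y.1 y.1.2 y.2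
  · rintro k hk s₁ hs₁ hi hI
    have r₁ := h.same hs₁ (by decide) (by decide) (by decide) (by decide)
    obtain ⟨y, rfl⟩ : ∃ w : Fin n, w.1 = k := ⟨⟨k, hk⟩, rfl⟩
    refine WP.seq (T₁ := 1) (T₂ := leafCost G (4 * Fintype.card G.Decision + 11) y + 2)
      (WP.op (fun hs₂ => ?_) le_rfl) (by omega)
    have i4 : ((Instr.iload 4 4 14).apply s₁).ireg 4 = if G.children y = ∅ then 1 else 0 := by
      simp [hi, r₁.flag]
    have r₂ := r₁.same hs₂ (by decide) (by decide) (by decide) (by decide)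
    have i14 := (hs₂.ireg 14 (by decide)).trans hi
    have i10 := (hs₂.ireg 10 (by decide)).trans ((hs₁.ireg 10 (by decide)).trans h10)
    have i11 := (hs₂.ireg 11 (by decide)).trans ((hs₁.ireg 11 (by decide)).trans h11)
    have i12 := (hs₂.ireg 12 (by decide)).trans ((hs₁.ireg 12 (by decide)).trans h12)
    have i16 := (hs₂.ireg 16 (by decide)).trans (hs₁.ireg 16 (by decide))
    have m6 := (hs₂.imem 6 (by decide)).trans (hs₁.imem 6 (by decide))
    have g1 := (hs₂.rreg 1 (by decide)).trans (hs₁.rreg 1 (by decide))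
    have g6 := (hs₂.rreg 6 (by decide)).trans (hs₁.rreg 6 (by decide))
    have m3 := hs₂.rmem 3 (by decide)
    generalize (Instr.iload 4 4 14).apply s₁ = s₂ at *
    refine WP.ite (T := leafCost G (4 * Fintype.card G.Decision + 11) y + 1) (fun hy => ?_)
      (fun hy => WP.skip ?_ (by omega)) le_rfl
    · replace hy : G.children y = ∅ := by
        by_contra hn
        simp [i4, hn, r₂.one] at hy
      rw [leafCost_leaf hy]
      have hdep := G.depth_le_card y
      refine WP.seq (T₁ := 1) (T₂ := 4 * Fintype.card G.Decision + 11)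
        (WP.op (fun hs₃ => ?_) le_rfl) (by omega)
      have r₃ := r₂.same hs₃ (by decide) (by decide) (by decide) (by decide)
      have g8 : ((Instr.rload 8 0 14).apply s₂).rreg 8 = payoffCode UL y := by
        simp [i14, r₂.payoff]
      refine (setReport_spec r₃ i14 g8 i10 i11 i12 (by
        rw [hs₃.imem 6 (by decide), hs₃.ireg 16 (by decide), m6, i16]; exact hm)).mono (by omega) ?_
      intro s₄ _ h4 x hx hx'
      rw [h4, hs₃.rreg 1 (by decide), g1, hs₃.rreg 6 (by decide), g6, hs₃.rmem 3 (by decide), m3]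
      rcases Nat.lt_succ_iff_lt_or_eq.1 hx with hx | hx
      · rw [if_neg hx.ne, hI x hx hx']
      · rw [Fin.ext hx, if_pos rfl]
    · intro x hx hx'
      rw [m3]
      rcases Nat.lt_succ_iff_lt_or_eq.1 hx with hx | hx
      · exact hI x hx hx'
      · rw [Fin.ext hx] at hx'
        simp [i4, hx', r₂.one] at hy
  · simp only [add_assoc, sum_leafCost_add]
    omega

/-- Writes the optimal distribution and the reported payoffs. -/
def output : Prog :=
  (.op (.rconst 2 1) ;; .op (.rsub 2 2 5) ;; .op (.rstore 2 11 2) ;; .op (.rstore 2 10 5) ;;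
    .op (.iadd 16 0 2)) ;; markPath 12 ;; writeReport

/-- All marks are at most `n`, so `n + 1` is a fresh stamp for the path to `l`. -/
theorem output_spec (h : Ready G UL UF s) {z z' l : Fin n} (h10 : s.ireg 10 = z)
    (h11 : s.ireg 11 = z') (h12 : s.ireg 12 = l) (hm : ∀ w : Fin n, s.imem 6 w ≤ n)
    (h2 : ∀ w : Fin n, s.rmem 2 w = 0) :
    WP output s (Fintype.card G.Leaf * (4 * Fintype.card G.Decision + 16) +
        11 * Fintype.card G.Decision + 13) fun s' =>
      (∀ y : G.Leaf, s'.rmem 2 y.1 = RootedTree.twoPoint z z' (s.rreg 5) y.1) ∧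
      ∀ y : G.Leaf, s'.rmem 3 y.1 =
        G.report G.IsF (payoffCode UL) (s.rreg 1) z z' l (s.rreg 6) y.1 := by
  classical
  have hdep := G.depth_le_card l
  refine WP.seq (T₁ := 5) (T₂ := (6 * Fintype.card G.Decision + 6) +
    (Fintype.card G.Leaf * (4 * Fintype.card G.Decision + 11) +
      (Fintype.card G.Decision + Fintype.card G.Leaf) * 5 + 2)) ((WP.of_pre (Q := fun s₁ =>
    s₁.ireg 16 = n + 1 ∧ ∀ w : Fin n, s₁.rmem 2 w = RootedTree.twoPoint z z' (s.rreg 5) w) rfl ?_).mono le_rfl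
    ?_) (by ring_nf; omega)
  -- The weight of `z` is stored after that of `z'` and prevails when the two leaves coincide, as in
  -- `twoPoint`.
  · simp [h10, h11, h.card, h.one, h2, RootedTree.twoPoint, Fin.val_inj]
  rintro s₁ - ⟨i16, hp⟩ hs₁
  have r₁ := h.same hs₁ (by decide) (by decide) (by decide) (by decide)
  have i12 := (hs₁.ireg 12 (by decide)).trans h12
  refine WP.seq ((markPath_spec r₁.toEnv i12).mono (T' := 6 * Fintype.card G.Decision + 6)
    (by omega) ?_) le_rfl
  intro s₂ hs₂ hmark _
  have r₂ := r₁.same hs₂ (by decide) (by decide) (by decide) (by decide)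
  refine (writeReport_spec r₂ ((hs₂.ireg 10 (by decide)).trans ((hs₁.ireg 10 (by decide)).trans
    h10)) ((hs₂.ireg 11 (by decide)).trans ((hs₁.ireg 11 (by decide)).trans h11))
    ((hs₂.ireg 12 (by decide)).trans i12) ?_).mono le_rfl ?_
  · intro w
    rw [hmark, hs₂.ireg 16 (by decide), i16, hs₁.imem 6 (by decide)]
    have := hm w
    split_ifs with hw
    · simp [hw]
    · simp only [hw, not_false_eq_true, iff_true]
      omega
  · intro s₃ hs₃ hR
    refine ⟨fun y => ?_, fun y => ?_⟩
    · rw [hs₃.rmem 2 (by decide), hs₂.rmem 2 (by decide), hp]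
    · rw [hR, hs₂.rreg 1 (by decide), hs₁.rreg 1 (by decide), hs₂.rreg 6 (by decide),
        hs₁.rreg 6 (by decide)]

/-! ### Exhaustiveness of the search and the time bound -/

namespace RootedTree

variable {n : ℕ} {T : RootedTree n} {F : Fin n → Prop} [DecidablePred F]

/-- The extremum is attained at a child all the way down. At the root this yields an admissible
single leaf, so the search always finds a candidate. -/
theorem exists_leaf_maximin_eq (u : Fin n → ℝ) (v : Fin n) :
    ∃ z, T.children z = ∅ ∧ T.maximin F u v = u z := by
  induction v using T.induction_children with
  | h v ih =>
    rcases (T.children v).eq_empty_or_nonempty with hv | hv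
    · exact ⟨v, hv, maximin_leaf hv⟩
    · have : ∃ w ∈ T.children v, T.maximin F u v = T.maximin F u w := by
        by_cases hF : F v
        exacts [(maximin_follower hv hF).2, (maximin_leader hv hF).2]
      obtain ⟨w, hw, heq⟩ := this
      rw [heq]
      exact ih w hw

omit [DecidablePred F] in
theorem PartAt.symm {v z z' l : Fin n} (h : T.PartAt F v z z' l) : T.PartAt F v z' z l := by
  obtain ⟨h1, h2, w, hw, w', hw', hne, h3, h4⟩ := h
  exact ⟨h1, h2, w', hw', w, hw, hne.symm, h4, h3⟩

variable (T) in
theorem one_le_card_leaf : 1 ≤ Fintype.card T.Leaf := by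
  obtain ⟨z, hz, -⟩ := exists_leaf_maximin_eq (T := T) (F := fun _ => True) (fun _ => 0) T.root
  exact Fintype.card_pos_iff.2 ⟨⟨z, hz⟩⟩

variable (T) in
-- Without decision nodes the root is the only node; this settles the degenerate case of the time
-- bound.
theorem card_leaf_le_one (h : Fintype.card T.Decision = 0) : Fintype.card T.Leaf ≤ 1 := by
  have hroot : T.children T.root = ∅ := by
    by_contra hne
    exact (Fintype.card_eq_zero_iff.1 h).false ⟨T.root, Finset.nonempty_iff_ne_empty.2 hne⟩
  have : ∀ z : Fin n, z = T.root := fun z => eq_of_below_leaf hroot (below_root z)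
  exact Fintype.card_le_one_iff.2 fun a b => Subtype.ext ((this a).trans (this b).symm)

end RootedTree

open GameTree Stackelberg.RootedTree

variable {n : ℕ} {G : GameTree n} {UL UF : G.Leaf → ℝ} {s s' : State}

theorem Dominates.mono {x y : ℝ} (h : Dominates s x) (hy : y ≤ x) : Dominates s y :=
  ⟨h.1, hy.trans h.2⟩

/-- If the leaf `z'`, worse for the leader, is better for the follower, he gains by lowering her
expected payoff, so the least admissible payoff `x₀` is best for him. In the remaining cases one of
the two leaves alone is admissible and does as well. -/
theorem dominates_pair (hall : ∀ z : Fin n, G.children z = ∅ → CoversAll G UL UF z s)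
    {z z' l : Fin n} {x t : ℝ} (hz : G.children z = ∅) (hz' : G.children z' = ∅)
    (hp : G.PartAt G.IsF G.root z z' l) (hT : G.Threat G.IsF (payoffCode UL) G.root l x)
    (hm : G.maximin G.IsF (payoffCode UL) G.root ≤ x) (ht0 : 0 ≤ t) (ht1 : t ≤ 1)
    (hx : x ≤ t * payoffCode UL z + (1 - t) * payoffCode UL z')
    (hle : payoffCode UL z' ≤ payoffCode UL z) :
    Dominates s (t * payoffCode UF z + (1 - t) * payoffCode UF z') := by
  have hxz : x ≤ payoffCode UL z := by nlinarith
  have hsz := (hall z hz).single (hm.trans hxz)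
  rcases le_total (payoffCode UF z') (payoffCode UF z) with hf | hf
  · exact hsz.mono (by nlinarith)
  have hl : G.junction z z' = l := by
    obtain ⟨-, -, w, hw, w', hw', hne, h1, h2⟩ := hp
    refine (branch_unique ?_ hw' (fun h3 => hne (eq_of_below_of_mem_children hw hw' h1 h3))
      h2).1
    exact (below_of_mem_children hw).trans h1
  have hne : z ≠ z' := by
    rintro rfl
    obtain ⟨-, -, -, -, h7, -⟩ := hp.branch_eq
    exact h7 rfl
  obtain ⟨x₀, hm₀, hlow, hdom⟩ := (hall z hz).pair z' hz' hne (by rw [hl]; exact hp.2.1)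
  rw [hl] at hlow
  have hx₀ := hlow x hm hT
  -- If `x₀` is at most the payoff of `z'`, that leaf alone is admissible. If `x₀` reaches the
  -- payoff of `z`, all weight must be on `z`.
  rcases le_or_gt x₀ (payoffCode UL z') with h1 | h1
  · exact ((hall z' hz').single (hm₀.trans h1)).mono (by nlinarith)
  rcases le_or_gt (payoffCode UL z) x₀ with h2 | h2
  · have ht : t = 1 := by
      by_contra hne
      have := lt_of_le_of_ne ht1 hne
      nlinarith
    exact hsz.mono (by rw [ht]; linarith)
  · refine (hdom h1 h2).mono ?_
    have hpos : 0 < payoffCode UL z - payoffCode UL z' := by linarith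
    -- Weight on `z` beyond what `x₀` requires cannot help the follower.
    have hlam : (x₀ - payoffCode UL z') / (payoffCode UL z - payoffCode UL z') ≤ t := by
      rw [div_le_iff₀ hpos]
      linarith
    nlinarith

theorem dominates_of_inducible
    (hall : ∀ z : Fin n, G.children z = ∅ → CoversAll G UL UF z s) {p : G.Leaf → ℝ}
    (hp : Inducible UL p) : Dominates s (utility UF p) := by
  obtain ⟨x, hm, z, z', hz, hz', hzz, t, ht0, ht1, hx, hU⟩ := hp.exists_supported_pair UF
  refine Dominates.mono ?_ hU
  rcases hzz with rfl | ⟨l, hpart, hT⟩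
  · exact ((hall z hz).single (hm.trans (by linarith))).mono (by linarith)
  · rcases le_total (payoffCode UL z') (payoffCode UL z) with hle | hle
    · exact dominates_pair hall hz hz' hpart hT hm ht0 ht1 hx hle
    · have := dominates_pair hall hz' hz hpart.symm hT hm (t := 1 - t) (by linarith) (by linarith)
        (by linarith) hle
      exact this.mono (by linarith)

/-- The program that computes an optimal distribution and a payoff function that induces it. -/
def solve : Prog := prepare ;; search ;; output

theorem solve_spec (G : GameTree n) (UL UF : G.Leaf → ℝ) :
    WP solve (G.input UL UF) (11 * (Fintype.card G.Decision * Fintype.card G.Leaf ^ 2) +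
      15 * (Fintype.card G.Decision * Fintype.card G.Leaf) + 43 * Fintype.card G.Leaf ^ 2 +
      105 * Fintype.card G.Decision + 136 * Fintype.card G.Leaf + 34) fun s =>
      IsOptimalReport UL UF (fun z => s.rmem 2 z.1) (fun z => s.rmem 3 z.1) ∧
        IsYShape fun z : G.Leaf => s.rmem 2 z.1 := by
  have hn := G.card_decision_add_card_leaf
  refine WP.seq ((prepare_spec G UL UF).mono le_rfl ?_) (T₂ := Fintype.card G.Leaf * scanCost G +
    (Fintype.card G.Decision + Fintype.card G.Leaf) * 5 + 2 +
    (Fintype.card G.Leaf * (4 * Fintype.card G.Decision + 16) +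
      11 * Fintype.card G.Decision + 13)) (by
    rw [scanCost, show 89 * n = 89 * (Fintype.card G.Decision + Fintype.card G.Leaf) by rw [hn]]
    apply le_of_eq
    ring)
  rintro s₁ - ⟨r₁, h13, hm, h2⟩ -
  refine WP.seq ((search_spec r₁ h13 hm).mono le_rfl ?_) le_rfl
  rintro s₂ hs₂ ⟨hb, hall, hm₂⟩ -
  have r₂ := r₁.same hs₂ (by decide) (by decide) (by decide) (by decide)
  have hflag : s₂.ireg 13 = 1 := by
    obtain ⟨z, hz, heq⟩ := exists_leaf_maximin_eq (T := G.toRootedTree) (F := G.IsF)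
      (payoffCode UL) G.root
    exact ((hall z hz).single heq.le).1
  obtain ⟨z, z', l, h10, h11, h12, hc, hv⟩ := hb.candidate hflag
  refine (output_spec r₂ h10 h11 h12 hm₂ (by rw [hs₂.rmem 2 (by decide)]; exact h2)).mono le_rfl ?_
  rintro s₃ - ⟨hp, hR⟩
  simp only [hp, hR]
  refine ⟨⟨⟨fun y => ?_, ?_⟩, induces_report hc fun y => ?_, fun q hq => ?_⟩, ?_⟩
  · simp only [twoPoint]
    split_ifs
    exacts [hc.nonneg, sub_nonneg.2 hc.le_one, le_rfl]
  · have := sum_mul_twoPoint (fun _ => 1) hc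
    rw [← sum_leaf] at this
    simpa using this
  · rw [← payoffCode_leaf UL y]
    exact r₂.bound y
  · refine (dominates_of_inducible hall hq).2.trans_eq (hv.trans ?_)
    rw [← sum_mul_twoPoint _ hc, ← sum_leaf]
    simp only [payoffCode_leaf, utility]
  · have hsub : (Function.support fun y : G.Leaf => twoPoint z z' (s₂.rreg 5) y.1) ⊆
        {⟨z, hc.leaf⟩, ⟨z', hc.leaf'⟩} := by
      intro y hy
      by_contra hn
      simp only [Set.mem_insert_iff, Set.mem_singleton_iff, not_or, Subtype.ext_iff] at hn
      exact hy (by simp [twoPoint, hn.1, hn.2])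
    exact (Set.ncard_le_ncard hsub (Set.toFinite _)).trans
      ((Set.ncard_insert_le _ _).trans (by simp))

end Stackelberg

theorem mainTheorem5 :
    ∃ (P : Stackelberg.Prog) (C : ℕ), ∀ (n : ℕ) (G : Stackelberg.GameTree n)
      (UL UF : G.Leaf → ℝ), ∃ (t : ℕ) (s : Stackelberg.State),
        Stackelberg.Exec P (G.input UL UF) t s ∧
        t ≤ C * (Fintype.card G.Decision * Fintype.card G.Leaf ^ 2 + 1) ∧
        Stackelberg.GameTree.IsOptimalReport UL UF
          (fun z : G.Leaf => s.rmem 2 z.1) (fun z : G.Leaf => s.rmem 3 z.1) ∧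
        Stackelberg.GameTree.IsYShape (fun z : G.Leaf => s.rmem 2 z.1) := by
  -- The constant is the sum of the coefficients in `solve_spec`. If $H\neq\emptyset$, every
  -- nonconstant monomial there is at most $|H|\cdot|Z|^2$; if $H=\emptyset$, there is one leaf and
  -- the summand `1` absorbs the bound.
  refine ⟨Stackelberg.solve, 344, fun n G UL UF => ?_⟩
  obtain ⟨t, s, h1, h2, h3⟩ := Stackelberg.solve_spec G UL UF
  refine ⟨t, s, h1, h2.trans ?_, h3⟩
  have h4 := G.one_le_card_leaf
  have h5 := G.card_leaf_le_one
  generalize Fintype.card G.Decision = a at *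
  generalize Fintype.card G.Leaf = b at *
  rcases Nat.eq_zero_or_pos a with rfl | ha
  · obtain rfl : b = 1 := le_antisymm (h5 rfl) h4
    simp
  · have h6 : b ≤ b ^ 2 := Nat.le_self_pow two_ne_zero b
    have h7 : a * b ≤ a * b ^ 2 := Nat.mul_le_mul_left a h6
    have h8 : b ^ 2 ≤ a * b ^ 2 := Nat.le_mul_of_pos_left _ ha
    have h9 : a ≤ a * b ^ 2 := Nat.le_mul_of_pos_right _ (by positivity)
    linarith
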